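/- Let $\mathcal G$ be a finite connected graph (self-loops and multiple edges are allowed) in which every vertex has degree at least $2$ (a self-loop counting twice), with a real number $B_v$ attached to each vertex $v$ and a number $A_e>0$ attached to each edge $e$. Let $\Xi:\mathcal T\to\mathcal G$ be its universal cover, so that $\mathcal T$ is a tree, and let $H$ be the associated periodic Jacobi matrix: the bounded self-adjoint operator on $\ell^2(V(\mathcal T))$ with matrix elements $H_{jj}=b_j=B_{\Xi(j)}$, $H_{jk}=a_\alpha=A_{\Xi(\alpha)}$ if $j\neq k$ are the ends of an edge $\alpha$ of $\mathcal T$, and $H_{jk}=0$ otherwise. For an edge $\beta$ of $\mathcal T$ and an end $j$ of $\beta$ let $\mathcal T_j^\beta$ be the component containing $j$ of the graph obtained from $\mathcal T$ by removing the edge $\beta$, and let $H(\mathcal T_j^\beta)$ be the restriction of the matrix $H$ to $\ell^2(V(\mathcal T_j^\beta))$. Put $$G_j(z)=\langle\delta_j,(H-z)^{-1}\delta_j\rangle,\qquad m_j^\beta(z)=\langle\delta_j,(H(\mathcal T_j^\beta)-z)^{-1}\delta_j\rangle ,$$ for all vertices $j$ of $\mathcal T$, respectively all edges $\beta$ of $\mathcal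 T$ and ends $j$ of $\beta$. Let $A=\min\operatorname{spec}(H)$, $B=\max\operatorname{spec}(H)$ and $\Omega=\mathbb C\setminus[A,B]$. Then the following hold. 1. For $z\in\Omega$ all these inverses exist as bounded operators. All the functions $G_j$ and $m_j^\beta$ are analytic on $\Omega$, and each is an algebraic function: for each such function $f$ there is a complex polynomial $P(z,w)$, of positive degree in $w$ and of positive degree in $z$, with $P(z,f(z))=0$ for all $z\in\Omega$. 2. There is a finite set $F_0\subset\mathbb R$ such that for every $f$ among all the functions $G_j$, $m_j^\beta$ the limit $\lim_{\varepsilon\downarrow0}f(x+i\varepsilon)$ exists in the Riemann sphere $\widehat{\mathbb C}=\mathbb C\cup\{\infty\}$ for every $x\in\mathbb R\setminus F_0$, uniformly (in the sense of the sphere) for $x$ in compact subsets of $\mathbb R\setminus F_0$. 3. All the functions $G_j$, $m_j^\beta$ continue meromorphically to a finite-sheeted Riemann surface: there are a compact connected Riemann surface $\mathcal R$, an integer $n$ and a holomorphic map $p:\mathcal R\to\widehat{\mathbb C}$ for which every point of $\widehat{\mathbb C}$ has at most $n$ preimages and all but finitely many points have exactly $n$, and a holomorphic map $\sigma:\Omega\to\mathcal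 R$ with $p\circ\sigma=\mathrm{id}_\Omega$, such that for every $f$ among the functions $G_j$, $m_j^\beta$ there is a meromorphic function $F$ on $\mathcal R$ with $F\circ\sigma=f$ on $\Omega$. -/

import Mathlib

open Filter Topology
open scoped Manifold ContDiff lp

namespace JacobiTree

/-! ### Graphs, universal covers and Jacobi parameters -/

/-- An undirected graph with vertex set `V`, in which self-loops and multiple edges are allowed,
described by its set `D` of directed edges. Every undirected edge (also a self-loop) is a pair
`{d, rev d}` of two distinct directed edges, `d` starting at `src d` and ending at `src (rev d)`. -/
structure Multigraph (V D : Type*) where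
  src : D → V
  rev : D → D
  rev_rev : ∀ d, rev (rev d) = d
  rev_ne : ∀ d, rev d ≠ d

namespace Multigraph

variable {V D : Type*} (G : Multigraph V D)

/-- The final vertex of a directed edge. -/
def tgt (d : D) : V := G.src (G.rev d)

/-- The number of edges at `v`, a self-loop at `v` being counted twice. -/
noncomputable def degree (v : V) : ℕ := Nat.card {d : D // G.src d = v}

/-- Any two vertices are joined by a path. -/
def Connected : Prop :=
  ∀ u v, Relation.ReflTransGen (fun x y => ∃ d, G.src d = x ∧ G.tgt d = y) u v

/-- The parameters of a Jacobi matrix on the graph: a real number for each vertex and a strictly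
positive real number for each (undirected) edge. -/
structure JacobiParameters where
  b : V → ℝ
  a : D → ℝ
  a_rev : ∀ d, a (G.rev d) = a d
  a_pos : ∀ d, 0 < a d

/-- A universal cover of the graph, with vertex set `U`: a tree together with a covering map,
i.e. a graph morphism that maps the directed edges which start at a vertex `u` bijectively
onto the directed edges which start at the image of `u`. -/
structure UniversalCover (U : Type*) where
  tree : SimpleGraph U
  isTree : tree.IsTree
  proj : U → V
  projDart : tree.Dart → D
  src_projDart : ∀ e, G.src (projDart e) = proj e.fst
  projDart_symm : ∀ e, projDart e.symm = G.rev (projDart e)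
  bijOn_projDart : ∀ u, Set.BijOn projDart {e | e.fst = u} {d | G.src d = proj u}

end Multigraph

/-! ### Operators on `ℓ²` given by a matrix -/

/-- Row sums and column sums of the absolute values of the entries are uniformly bounded. -/
def BddKernel {ι : Type*} (K : ι → ι → ℂ) : Prop :=
  ∃ C : ℝ, 0 ≤ C ∧ ∀ (i : ι) (s : Finset ι), ∑ j ∈ s, ‖K i j‖ ≤ C ∧ ∑ j ∈ s, ‖K j i‖ ≤ C

theorem BddKernel.comap {ι κ : Type*} {K : ι → ι → ℂ} (hK : BddKernel K) (f : κ ↪ ι) :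
    BddKernel (fun i j => K (f i) (f j)) := by
  obtain ⟨C, hC, h⟩ := hK
  refine ⟨C, hC, fun i s => ?_⟩
  simpa only [Finset.sum_map] using h (f i) (s.map f)

section kernel

variable {ι : Type*} {K : ι → ι → ℂ}

theorem summable_row (hK : BddKernel K) (f : ℓ²(ι, ℂ)) (i : ι) :
    Summable fun j => K i j * f j := by
  obtain ⟨C, hC, h⟩ := hK
  have h1 : Summable fun j => ‖K i j‖ :=
    summable_of_sum_le (fun _ => norm_nonneg _) fun s => (h i s).1
  refine Summable.of_norm_bounded (h1.mul_right ‖f‖) fun j => ?_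
  rw [norm_mul]
  exact mul_le_mul_of_nonneg_left (lp.norm_apply_le_norm two_ne_zero f j) (norm_nonneg _)

/-- The Schur test. -/
theorem sum_sq_le {C : ℝ} (hC : 0 ≤ C)
    (h : ∀ (i : ι) (s : Finset ι), ∑ j ∈ s, ‖K i j‖ ≤ C ∧ ∑ j ∈ s, ‖K j i‖ ≤ C)
    (f : ℓ²(ι, ℂ)) (s : Finset ι) :
    ∑ i ∈ s, ‖∑' j, K i j * f j‖ ^ 2 ≤ (C * ‖f‖) ^ 2 := by
  have hlim : Tendsto (fun t : Finset ι => ∑ i ∈ s, ‖∑ j ∈ t, K i j * f j‖ ^ 2) atTop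
      (𝓝 (∑ i ∈ s, ‖∑' j, K i j * f j‖ ^ 2)) :=
    tendsto_finsetSum _ fun i _ => ((summable_row ⟨C, hC, h⟩ f i).hasSum.norm).pow 2
  refine le_of_tendsto hlim (Eventually.of_forall fun t => ?_)
  have hrow : ∀ i, ‖∑ j ∈ t, K i j * f j‖ ^ 2 ≤ C * ∑ j ∈ t, ‖K i j‖ * ‖f j‖ ^ 2 := by
    intro i
    have h1 : ‖∑ j ∈ t, K i j * f j‖ ≤ ∑ j ∈ t, ‖K i j‖ * ‖f j‖ := by
      simpa only [norm_mul] using norm_sum_le t fun j => K i j * f j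
    have h2 : (∑ j ∈ t, ‖K i j‖ * ‖f j‖) ^ 2
        ≤ (∑ j ∈ t, ‖K i j‖) * ∑ j ∈ t, ‖K i j‖ * ‖f j‖ ^ 2 := by
      refine Finset.sum_sq_le_sum_mul_sum_of_sq_le_mul t (fun _ _ => norm_nonneg _)
        (fun _ _ => by positivity) fun j _ => le_of_eq ?_
      ring
    calc ‖∑ j ∈ t, K i j * f j‖ ^ 2 ≤ (∑ j ∈ t, ‖K i j‖ * ‖f j‖) ^ 2 := by gcongr
      _ ≤ (∑ j ∈ t, ‖K i j‖) * ∑ j ∈ t, ‖K i j‖ * ‖f j‖ ^ 2 := h2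
      _ ≤ C * ∑ j ∈ t, ‖K i j‖ * ‖f j‖ ^ 2 :=
        mul_le_mul_of_nonneg_right (h i t).1 (Finset.sum_nonneg fun _ _ => by positivity)
  have hf : ∑ j ∈ t, ‖f j‖ ^ 2 ≤ ‖f‖ ^ 2 := by
    have := lp.sum_rpow_le_norm_rpow (p := 2) (by norm_num) f t
    simpa using this
  calc ∑ i ∈ s, ‖∑ j ∈ t, K i j * f j‖ ^ 2
      ≤ ∑ i ∈ s, C * ∑ j ∈ t, ‖K i j‖ * ‖f j‖ ^ 2 := Finset.sum_le_sum fun i _ => hrow i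
    _ = C * ∑ j ∈ t, (∑ i ∈ s, ‖K i j‖) * ‖f j‖ ^ 2 := by
      rw [← Finset.mul_sum, Finset.sum_comm]
      simp only [Finset.sum_mul]
    _ ≤ C * ∑ j ∈ t, C * ‖f j‖ ^ 2 := by
      refine mul_le_mul_of_nonneg_left (Finset.sum_le_sum fun j _ => ?_) hC
      exact mul_le_mul_of_nonneg_right (h j s).2 (by positivity)
    _ = C ^ 2 * ∑ j ∈ t, ‖f j‖ ^ 2 := by rw [← Finset.mul_sum]; ring
    _ ≤ C ^ 2 * ‖f‖ ^ 2 := by gcongr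
    _ = (C * ‖f‖) ^ 2 := by ring

theorem memℓp_kernel (hK : BddKernel K) (f : ℓ²(ι, ℂ)) :
    Memℓp (fun i => ∑' j, K i j * f j) 2 := by
  obtain ⟨C, hC, h⟩ := hK
  refine memℓp_gen' (C := (C * ‖f‖) ^ 2) fun s => ?_
  simpa using sum_sq_le hC h f s

/-- The bounded operator on `ℓ²(ι)` with matrix `K`, that is `(K f) i = ∑ j, K i j * f j`. -/
noncomputable def kernelOperator (K : ι → ι → ℂ) (hK : BddKernel K) :
    ℓ²(ι, ℂ) →L[ℂ] ℓ²(ι, ℂ) :=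
  LinearMap.mkContinuousOfExistsBound
    { toFun := fun f => ⟨fun i => ∑' j, K i j * f j, memℓp_kernel hK f⟩
      map_add' := fun f g => by
        ext i
        have := (summable_row hK f i).tsum_add (summable_row hK g i)
        simp only [← mul_add] at this
        exact this
      map_smul' := fun c f => by
        ext i
        have := (summable_row hK f i).tsum_mul_left c
        simpa [mul_left_comm] using this }
    (by
      obtain ⟨C, hC, h⟩ := hK
      refine ⟨C, fun f => lp.norm_le_of_forall_sum_le (by norm_num) (by positivity) fun s => ?_⟩
      simpa using sum_sq_le hC h f s)

theorem kernelOperator_apply (hK : BddKernel K) (f : ℓ²(ι, ℂ)) (i : ι) :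
    kernelOperator K hK f i = ∑' j, K i j * f j := rfl

open Classical in
/-- The diagonal matrix element `⟨δ_i, (A - z)⁻¹ δ_i⟩` of the resolvent of `A`. -/
noncomputable def resolventEntry (A : ℓ²(ι, ℂ) →L[ℂ] ℓ²(ι, ℂ)) (i : ι) (z : ℂ) : ℂ :=
  inner ℂ (lp.single 2 i (1 : ℂ) : ℓ²(ι, ℂ))
    (Ring.inverse (A - algebraMap ℂ _ z) (lp.single 2 i (1 : ℂ)))

end kernel

/-! ### Periodic Jacobi matrices on trees, Green's functions and m-functions -/

namespace Multigraph

variable {V D U : Type*} {G : Multigraph V D}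

open Classical in
/-- The matrix elements of the lift of the Jacobi matrix to the universal cover. -/
noncomputable def JacobiParameters.kernel (J : G.JacobiParameters) (T : G.UniversalCover U)
    (u v : U) : ℂ :=
  if u = v then (J.b (T.proj u) : ℂ)
  else if h : T.tree.Adj u v then (J.a (T.projDart ⟨(u, v), h⟩) : ℂ)
  else 0

theorem JacobiParameters.kernel_comm (J : G.JacobiParameters) (T : G.UniversalCover U)
    (u v : U) : J.kernel T u v = J.kernel T v u := by
  by_cases huv : u = v
  · rw [huv]
  · by_cases h : T.tree.Adj u v
    · have h1 := J.a_rev (T.projDart ⟨(u, v), h⟩)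
      rw [← T.projDart_symm] at h1
      simp only [kernel, huv, Ne.symm huv, h, h.symm, if_false, dif_pos]
      exact congrArg _ h1.symm
    · have h' : ¬ T.tree.Adj v u := fun h' => h h'.symm
      simp [kernel, huv, Ne.symm huv, h, h']

theorem JacobiParameters.bddKernel [Finite V] [Finite D] (J : G.JacobiParameters)
    (T : G.UniversalCover U) : BddKernel (J.kernel T) := by
  classical
  have := Fintype.ofFinite V
  have := Fintype.ofFinite D
  have hC : 0 ≤ ∑ v, |J.b v| + ∑ d, J.a d :=
    add_nonneg (Finset.sum_nonneg fun _ _ => abs_nonneg _)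
      (Finset.sum_nonneg fun d _ => (J.a_pos d).le)
  have key : ∀ (u : U) (s : Finset U),
      ∑ v ∈ s, ‖J.kernel T u v‖ ≤ ∑ v, |J.b v| + ∑ d, J.a d := by
    intro u s
    have h1 : ∀ v, ‖J.kernel T u v‖ = (if u = v then |J.b (T.proj u)| else 0)
        + (if h : T.tree.Adj u v then J.a (T.projDart ⟨(u, v), h⟩) else 0) := by
      intro v
      by_cases huv : u = v
      · subst huv
        simp [kernel]
      · by_cases h : T.tree.Adj u v
        · simp [kernel, huv, h, abs_of_pos (J.a_pos _)]
        · simp [kernel, huv, h]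
    simp only [h1, Finset.sum_add_distrib]
    refine add_le_add ?_ ?_
    · rw [Finset.sum_ite_eq]
      split_ifs
      · exact Finset.single_le_sum (f := fun v => |J.b v|) (fun _ _ => abs_nonneg _)
          (Finset.mem_univ _)
      · exact Finset.sum_nonneg fun _ _ => abs_nonneg _
    · rw [← Finset.sum_filter_add_sum_filter_not s (fun v => T.tree.Adj u v)]
      have h0 : ∑ v ∈ s with ¬ T.tree.Adj u v,
          (if h : T.tree.Adj u v then J.a (T.projDart ⟨(u, v), h⟩) else 0) = 0 :=
        Finset.sum_eq_zero fun v hv => by simp [(Finset.mem_filter.1 hv).2]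
      rw [h0, add_zero, ← Finset.sum_attach]
      let g : {v // v ∈ s.filter fun v => T.tree.Adj u v} → D :=
        fun v => T.projDart ⟨(u, v.1), (Finset.mem_filter.1 v.2).2⟩
      have hg : Function.Injective g := by
        intro v w hvw
        have := (T.bijOn_projDart u).injOn (x₁ := ⟨(u, v.1), (Finset.mem_filter.1 v.2).2⟩)
          (x₂ := ⟨(u, w.1), (Finset.mem_filter.1 w.2).2⟩) rfl rfl hvw
        have h2 := congrArg (fun e : T.tree.Dart => e.snd) this
        exact Subtype.ext h2
      calc _ = ∑ v ∈ (s.filter fun v => T.tree.Adj u v).attach, J.a (g v) := by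
            refine Finset.sum_congr rfl fun v _ => ?_
            simp [g, (Finset.mem_filter.1 v.2).2]
        _ = ∑ d ∈ (s.filter fun v => T.tree.Adj u v).attach.map ⟨g, hg⟩, J.a d := by
            rw [Finset.sum_map]; rfl
        _ ≤ ∑ d, J.a d :=
            Finset.sum_le_sum_of_subset_of_nonneg (Finset.subset_univ _)
              fun d _ _ => (J.a_pos d).le
  refine ⟨_, hC, fun u s => ⟨key u s, ?_⟩⟩
  simpa only [J.kernel_comm T _ u] using key u s

variable [Finite V] [Finite D]

/-- The periodic Jacobi matrix `H` on `ℓ²` of the vertices of the universal cover. -/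
noncomputable def JacobiParameters.operator (J : G.JacobiParameters) (T : G.UniversalCover U) :
    ℓ²(U, ℂ) →L[ℂ] ℓ²(U, ℂ) :=
  kernelOperator (J.kernel T) (J.bddKernel T)

/-- The component that contains the initial vertex `e.fst` after the (undirected) edge
underlying `e` has been removed from the tree. -/
def UniversalCover.branch (T : G.UniversalCover U) (e : T.tree.Dart) : Set U :=
  {u | (T.tree.deleteEdges {e.edge}).Reachable e.fst u}

/-- The Jacobi matrix on `ℓ²` of the vertices of the component `T.branch e`. -/
noncomputable def JacobiParameters.branchOperator (J : G.JacobiParameters)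
    (T : G.UniversalCover U) (e : T.tree.Dart) :
    ℓ²(T.branch e, ℂ) →L[ℂ] ℓ²(T.branch e, ℂ) :=
  kernelOperator (fun u v : T.branch e => J.kernel T u v)
    ((J.bddKernel T).comap (Function.Embedding.subtype _))

/-- The Green's function `G_j(z) = ⟨δ_j, (H - z)⁻¹ δ_j⟩`. -/
noncomputable def JacobiParameters.green (J : G.JacobiParameters) (T : G.UniversalCover U)
    (j : U) : ℂ → ℂ :=
  resolventEntry (J.operator T) j

/-- The m-function `m_j^β(z) = ⟨δ_j, (H(T_j^β) - z)⁻¹ δ_j⟩`, where `j = e.fst` is an end of the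
edge `β` underlying `e`. (The m-function for the other end of `β` is the one of `e.symm`.) -/
noncomputable def JacobiParameters.mFunction (J : G.JacobiParameters) (T : G.UniversalCover U)
    (e : T.tree.Dart) : ℂ → ℂ :=
  resolventEntry (J.branchOperator T e) ⟨e.fst, SimpleGraph.Reachable.refl _⟩

/-- The set of all Green's functions and all m-functions. -/
def JacobiParameters.functions (J : G.JacobiParameters) (T : G.UniversalCover U) :
    Set (ℂ → ℂ) :=
  Set.range (J.green T) ∪ Set.range (J.mFunction T)

/-- The set `ℂ \ [A, B]`, where `A` and `B` are the bottom and the top of the spectrum of `H`. -/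
def JacobiParameters.domain (J : G.JacobiParameters) (T : G.UniversalCover U) : Set ℂ :=
  (Complex.ofReal ''
    Set.Icc (sInf (spectrum ℝ (J.operator T))) (sSup (spectrum ℝ (J.operator T))))ᶜ

end Multigraph

/-! ### Algebraic functions, boundary values, Riemann surfaces -/

/-- `f` solves `P(z, f(z)) = 0` on `Ω` for a polynomial `P(z, w)` in two variables that depends
non-trivially on both variables. -/
def IsAlgebraicFunctionOn (f : ℂ → ℂ) (Ω : Set ℂ) : Prop :=
  ∃ P : Polynomial (Polynomial ℂ),
    0 < P.natDegree ∧ (∃ n, 0 < (P.coeff n).natDegree) ∧ ∀ z ∈ Ω, P.evalEval z (f z) = 0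

/-- The limits of `f (x + i ε)` as `ε ↓ 0` exist in the Riemann sphere `ℂ ∪ {∞}`, for every
`x` in `S`, and uniformly in `x` on every compact subset of `S`. (The Riemann sphere is compact
and Hausdorff, so it has exactly one uniform structure, e.g. the one of the chordal metric.) -/
def HasBoundaryValuesOn (f : ℂ → ℂ) (S : Set ℝ) : Prop :=
  ∃ g : ℝ → OnePoint ℂ, ∀ L ⊆ S, IsCompact L →
    @TendstoUniformlyOn ℝ (OnePoint ℂ) ℝ uniformSpaceOfCompactR1
      (fun ε x => ((f (x + ε * Complex.I) : ℂ) : OnePoint ℂ)) g (𝓝[>] 0) L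

/-- `F` is a meromorphic function on the Riemann surface `R`. -/
def IsMeromorphic {R : Type*} [TopologicalSpace R] [ChartedSpace ℂ R] (F : R → ℂ) : Prop :=
  ∀ x, MeromorphicAt (F ∘ (chartAt ℂ x).symm) (chartAt ℂ x x)

/-- The function on the Riemann sphere that is `z` at `z ∈ ℂ` (with the value `0` assigned at its
pole `∞`). -/
def finitePart (z : OnePoint ℂ) : ℂ := z.elim 0 id

/-- `R` is a compact connected Riemann surface which is a finite-sheeted (branched) covering
surface of the Riemann sphere by means of the holomorphic map `p` with `n` sheets: apart from
finitely many points, each point of the sphere has exactly `n` preimages under `p`, and the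
exceptional (branch) points have fewer. A map into the sphere is holomorphic, when it is continuous
and its finite part is a meromorphic function. -/
structure IsFiniteSheetedSurface (R : Type*) [TopologicalSpace R] [ChartedSpace ℂ R]
    (p : R → OnePoint ℂ) (n : ℕ) : Prop where
  t2 : T2Space R
  compact : CompactSpace R
  connected : ConnectedSpace R
  isManifold : IsManifold 𝓘(ℂ) ω R
  continuous_proj : Continuous p
  meromorphic_proj : IsMeromorphic (finitePart ∘ p)
  finite_fiber : ∀ z, (p ⁻¹' {z}).Finite
  card_fiber_le : ∀ z, (p ⁻¹' {z}).ncard ≤ n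
  finite_branch : {z | (p ⁻¹' {z}).ncard ≠ n}.Finite

end JacobiTree

/-!
# Green's functions and m-functions of periodic Jacobi matrices on trees are algebraic

Let `Ω` be the complement of the segment from the bottom to the top of the spectrum of `H`. Every
compression of `H` has its numerical range in this segment, so all resolvents exist on `Ω`
(`isUnit_compression_sub`). The Schur complement formula (`resolventEntry_mul_eq_one`) expresses
each of the functions by the m-functions of the branches which are attached at its vertex. Near
infinity, these equations form a contraction; hence an m-function depends only on the image of its
directed edge in the finite graph, and a Green's function only on the image of its vertex
(`mFunction_eqOn`, `green_eqOn`). What remains is a system `m i * (c i - ∑ j, A i j * m j) = 1` for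
finitely many analytic functions over the ring `ℂ[z]`. Its Jacobian does not vanish identically,
because the functions are small near infinity. So a derivation which is trivial on the rational
functions kills all `m i`, and they are algebraic (`isAlgebraic_of_system`).

An algebraic analytic function `f` on `Ω` can be multiplied by a polynomial `c ≠ 0` such that
`c f` is a root of a monic polynomial `Q(z, ·)`, all of whose roots are simple off the zeros of a
polynomial `d ≠ 0`
(`IsAlgebraicFunctionOn.exists_monic_separable`). The cluster set of `c f` at
a boundary point is connected and consists of roots of `Q`, so it is a single point; this gives the
boundary values off the zeros of `c`, and convergence within the upper half plane, not only along vertical lines, makes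
them locally uniform (`hasBoundaryValuesOn_of_tendsto`).

For the Riemann surface, let `S` be the finite set of the zeros of all these `c` and `d`,
and consider the tuples `(z, w)` with `z ∉ S` and `Q i (z, w i) = 0` for all `i`.
By the implicit function theorem, `z` is a local coordinate on this set (`spread`). The component
which contains the graph of `c f` is a finite covering of the punctured plane (`sheetCover`). Over a
punctured disc about a point of `S` or about infinity, lifts of `exp` from a half-plane show that
each end of the covering is a punctured disc, on which the projection is `t ↦ t ^ k` in suitable
coordinates (`PuncturedCover.Ends.param`). Adding one point for each end yields a compact connected
Riemann surface (`PuncturedCover.Completion`). The coordinates `w i` grow at most polynomially, and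
so they are meromorphic at the added points; the section `c f` extends over the points of `S` in `Ω`
by the removable singularity theorem (`PuncturedCover.Completion.exists_section`).
-/

set_option linter.unusedSectionVars false

namespace JacobiTree

/-! ### Algebraicity of the solutions of a non-degenerate polynomial system -/

/-- The Jacobian criterion over a field: the universal derivation of `k(m)` over `k` vanishes, so
that this extension is unramified, hence separable and algebraic. -/
theorem isAlgebraic_of_field_system {k K ι : Type*} [Field k] [CharZero k] [Field K] [Algebra k K]
    [Fintype ι] [DecidableEq ι] (m : ι → K) (c : ι → k) (A : ι → ι → k)
    (h : ∀ i, m i * (algebraMap k K (c i) - ∑ j, algebraMap k K (A i j) * m j) = 1)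
    (hdet : (1 - Matrix.of fun i j => m i ^ 2 * algebraMap k K (A i j)).det ≠ 0) (i : ι) :
    IsAlgebraic k (m i) := by
  classical
  let L := IntermediateField.adjoin k (Set.range m)
  have hmL : ∀ i, m i ∈ L := fun i =>
    IntermediateField.subset_adjoin k _ (Set.mem_range_self i)
  let x : ι → L := fun i => ⟨m i, hmL i⟩
  have hx : ∀ i, x i * (algebraMap k L (c i) - ∑ j, algebraMap k L (A i j) * x j) = 1 := by
    intro i
    apply Subtype.ext
    simpa [x] using h i
  have hess : Algebra.EssFiniteType k L := by
    rw [IntermediateField.essFiniteType_iff]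
    exact IntermediateField.fg_adjoin_of_finite (Set.finite_range m)
  let N : Matrix ι ι L := 1 - Matrix.of fun i j => x i ^ 2 * algebraMap k L (A i j)
  have hN : N.det ≠ 0 := by
    intro h0
    apply hdet
    have h1 := congrArg (algebraMap L K) h0
    rw [RingHom.map_det, map_zero] at h1
    rw [← h1]
    congr 1
    ext i j
    simp only [N, Matrix.sub_apply, Matrix.of_apply, RingHom.mapMatrix_apply, Matrix.map_apply,
      map_sub, map_mul, map_pow, Matrix.one_apply]
    congr 1
    split_ifs <;> simp
  let D := KaehlerDifferential.D k L
  -- differentiate the `i`-th equation and multiply by `x i`, using that equation once more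
  have hD1 : ∀ i, D (x i) = ∑ j, (x i ^ 2 * algebraMap k L (A i j)) • D (x j) := by
    intro i
    have h1 := congrArg D (hx i)
    rw [Derivation.leibniz, map_sub, map_sum, Derivation.map_algebraMap, zero_sub] at h1
    simp only [Derivation.leibniz, Derivation.map_algebraMap, smul_zero, add_zero,
      Derivation.map_one_eq_zero] at h1
    have h2 := congrArg (fun w => x i • w) h1
    simp only [smul_add, smul_zero, smul_smul, hx i, one_smul, smul_neg] at h2
    rw [neg_add_eq_zero] at h2
    rw [← h2, Finset.smul_sum]
    refine Finset.sum_congr rfl fun j _ => ?_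
    rw [smul_smul, pow_two]
  have hD2 : ∀ i, ∑ j, N i j • D (x j) = 0 := by
    intro i
    simp only [N, Matrix.sub_apply, Matrix.of_apply, sub_smul, Finset.sum_sub_distrib, ← hD1 i,
      Matrix.one_apply, ite_smul, one_smul, zero_smul, Finset.sum_ite_eq, Finset.mem_univ, if_true,
      sub_self]
  have hD3 : ∀ i, D (x i) = 0 := by
    intro i
    have h1 : ∑ l, N.adjugate i l • ∑ j, N l j • D (x j) = 0 :=
      Finset.sum_eq_zero fun l _ => by rw [hD2 l, smul_zero]
    simp only [Finset.smul_sum, smul_smul] at h1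
    rw [Finset.sum_comm] at h1
    simp only [← Finset.sum_smul, ← Matrix.mul_apply, Matrix.adjugate_mul, Matrix.smul_apply,
      Matrix.one_apply, smul_eq_mul, mul_ite, mul_one, mul_zero, ite_smul, zero_smul,
      Finset.sum_ite_eq, Finset.mem_univ, if_true] at h1
    exact (smul_eq_zero.1 h1).resolve_left hN
  have hD4 : ∀ y (hy : y ∈ L), D ⟨y, hy⟩ = 0 := by
    intro y hy
    induction hy using IntermediateField.adjoin_induction with
    | mem y hy => obtain ⟨i, rfl⟩ := hy; exact hD3 i
    | algebraMap y => exact D.map_algebraMap y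
    | add y z hy hz h1 h2 =>
      have := D.map_add ⟨y, hy⟩ ⟨z, hz⟩
      rw [h1, h2, add_zero] at this
      exact this
    | inv y hy h1 =>
      have := D.leibniz_inv (⟨y, hy⟩ : L)
      rw [h1, smul_zero] at this
      exact this
    | mul y z hy hz h1 h2 =>
      have := D.leibniz ⟨y, hy⟩ ⟨z, hz⟩
      rw [h1, h2, smul_zero, smul_zero, add_zero] at this
      exact this
  have hunr : Algebra.FormallyUnramified k L := by
    rw [Algebra.formallyUnramified_iff]
    rw [← Submodule.subsingleton_iff L, ← subsingleton_iff_bot_eq_top,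
      ← KaehlerDifferential.span_range_derivation, eq_comm, Submodule.span_eq_bot]
    rintro _ ⟨y, rfl⟩
    exact hD4 y.1 y.2
  have hsep := (Algebra.FormallyUnramified.iff_isSeparable k L).1 hunr
  have : IsAlgebraic k (x i) := (Algebra.IsSeparable.isIntegral k (x i)).isAlgebraic
  exact this.algebraMap (A := K)

/-- The Jacobian criterion for the system `m i * (c i - ∑ j, A i j * m j) = 1`: a derivation over
the ground ring maps the vector `m` into the kernel of the matrix `1 - (m i ^ 2 * A i j)`, so that
it kills all `m i` when this matrix is invertible. -/
theorem isAlgebraic_of_system {k S ι : Type*} [CommRing k] [IsDomain k] [CharZero k]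
    [CommRing S] [IsDomain S] [Algebra k S] [FaithfulSMul k S]
    [Fintype ι] [DecidableEq ι] (m : ι → S) (c : ι → k) (A : ι → ι → k)
    (h : ∀ i, m i * (algebraMap k S (c i) - ∑ j, algebraMap k S (A i j) * m j) = 1)
    (hdet : (1 - Matrix.of fun i j => m i ^ 2 * algebraMap k S (A i j)).det ≠ 0) (i : ι) :
    IsAlgebraic k (m i) := by
  let K := FractionRing S
  let F := FractionRing k
  have hf : FaithfulSMul k K := FaithfulSMul.trans k S K
  let _ : Algebra F K := FractionRing.liftAlgebra k K
  have : IsScalarTower k F K := FractionRing.isScalarTower_liftAlgebra k K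
  have hc : CharZero F := charZero_of_injective_algebraMap (IsFractionRing.injective k F)
  have key : ∀ a : k, algebraMap F K (algebraMap k F a) = algebraMap S K (algebraMap k S a) := by
    intro a
    rw [← IsScalarTower.algebraMap_apply k F K, ← IsScalarTower.algebraMap_apply k S K]
  have h1 : IsAlgebraic F (algebraMap S K (m i)) := by
    refine isAlgebraic_of_field_system (fun i => algebraMap S K (m i)) (fun i => algebraMap k F (c i))
      (fun i j => algebraMap k F (A i j)) (fun i => ?_) ?_ i
    · simp only [key, ← map_mul, ← map_sum, ← map_sub, h, map_one]
    · have h2 : (1 - Matrix.of fun i j => algebraMap S K (m i) ^ 2 *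
          algebraMap F K (algebraMap k F (A i j))) =
          (algebraMap S K).mapMatrix (1 - Matrix.of fun i j => m i ^ 2 * algebraMap k S (A i j)) := by
        ext i j
        simp only [key, Matrix.sub_apply, Matrix.of_apply, RingHom.mapMatrix_apply, Matrix.map_apply,
          map_sub, map_mul, map_pow, Matrix.one_apply]
        congr 1
        split_ifs <;> simp
      rw [h2, ← RingHom.map_det]
      exact fun h3 => hdet ((map_eq_zero_iff _ (IsFractionRing.injective S K)).1 h3)
  rw [← IsFractionRing.isAlgebraic_iff k F K] at h1
  exact (isAlgebraic_algebraMap_iff (IsFractionRing.injective S K)).1 h1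

/-- An algebraic element becomes a root of a monic polynomial `Q` after multiplication by
some `c ≠ 0`, and `Q` may be taken to be separable over the field of fractions. -/
theorem exists_monic_separable {k S : Type*} [CommRing k] [IsDomain k] [IsIntegrallyClosed k]
    [CharZero k] [CommRing S] [IsDomain S] [Algebra k S] [FaithfulSMul k S] {x : S}
    (hx : IsAlgebraic k x) :
    ∃ (c : k) (Q A B : Polynomial k) (d : k), c ≠ 0 ∧ Q.Monic ∧ d ≠ 0 ∧
      A * Q + B * Polynomial.derivative Q = Polynomial.C d ∧ Polynomial.aeval (c • x) Q = 0 := by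
  obtain ⟨c, hc, hint⟩ := hx.exists_integral_multiple
  let K := FractionRing S
  let F := FractionRing k
  have hf : FaithfulSMul k K := FaithfulSMul.trans k S K
  let _ : Algebra F K := FractionRing.liftAlgebra k K
  have : IsScalarTower k F K := FractionRing.isScalarTower_liftAlgebra k K
  have hcz : CharZero F := charZero_of_injective_algebraMap (IsFractionRing.injective k F)
  let Q := minpoly k (c • x)
  have h1 := minpoly.isIntegrallyClosed_eq_field_fractions F K hint
  have hirr : Irreducible (Q.map (algebraMap k F)) := by
    rw [← h1]
    exact minpoly.irreducible (hint.algebraMap.tower_top)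
  obtain ⟨a, b, hab⟩ := hirr.separable
  obtain ⟨d1, hd1, ha⟩ := IsLocalization.integerNormalization_spec (nonZeroDivisors k) a
  obtain ⟨d2, hd2, hb⟩ := IsLocalization.integerNormalization_spec (nonZeroDivisors k) b
  set a' := IsLocalization.integerNormalization (nonZeroDivisors k) a
  set b' := IsLocalization.integerNormalization (nonZeroDivisors k) b
  have ha' : a'.map (algebraMap k F) = Polynomial.C (algebraMap k F d1) * a := by
    rw [ha]
    ext n
    rw [Polynomial.coeff_smul, Polynomial.coeff_C_mul, Algebra.smul_def]
  have hb' : b'.map (algebraMap k F) = Polynomial.C (algebraMap k F d2) * b := by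
    rw [hb]
    ext n
    rw [Polynomial.coeff_smul, Polynomial.coeff_C_mul, Algebra.smul_def]
  refine ⟨c, Q, Polynomial.C d2 * a', Polynomial.C d1 * b', d1 * d2, hc, minpoly.monic hint,
    mul_ne_zero (nonZeroDivisors.ne_zero hd1) (nonZeroDivisors.ne_zero hd2), ?_, minpoly.aeval _ _⟩
  apply Polynomial.map_injective _ (IsFractionRing.injective k F)
  simp only [Polynomial.map_add, Polynomial.map_mul, ha', hb', Polynomial.map_C, map_mul]
  rw [← Polynomial.derivative_map]
  linear_combination (Polynomial.C (algebraMap k F d1) * Polynomial.C (algebraMap k F d2)) * hab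

/-! ### The ring of analytic functions on a plane domain -/

section AnalyticRing

open Polynomial

/-- The functions on `Ω` that have an extension to `ℂ` which is analytic on a neighbourhood
of `Ω`. -/
def analyticSubalgebra (Ω : Set ℂ) : Subalgebra ℂ (Ω → ℂ) where
  carrier := {g | ∃ f : ℂ → ℂ, AnalyticOnNhd ℂ f Ω ∧ ∀ z : Ω, g z = f z}
  mul_mem' := by
    rintro g₁ g₂ ⟨f₁, h₁, e₁⟩ ⟨f₂, h₂, e₂⟩
    exact ⟨f₁ * f₂, h₁.mul h₂, fun z => by simp [e₁, e₂]⟩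
  add_mem' := by
    rintro g₁ g₂ ⟨f₁, h₁, e₁⟩ ⟨f₂, h₂, e₂⟩
    exact ⟨f₁ + f₂, h₁.add h₂, fun z => by simp [e₁, e₂]⟩
  algebraMap_mem' := fun c => ⟨fun _ => c, analyticOnNhd_const, fun _ => rfl⟩

/-- The ring of analytic functions on `Ω`. It is a type of its own, so as to be an algebra over
`ℂ[X]`, the variable acting as multiplication by the coordinate `z`. -/
def AnalyticRing (Ω : Set ℂ) : Type := analyticSubalgebra Ω

namespace AnalyticRing

variable {Ω : Set ℂ}

noncomputable instance : CommRing (AnalyticRing Ω) :=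
  inferInstanceAs (CommRing (analyticSubalgebra Ω))

noncomputable instance : Algebra ℂ (AnalyticRing Ω) :=
  inferInstanceAs (Algebra ℂ (analyticSubalgebra Ω))

/-- The analytic function as an element of the ring. -/
def of (f : ℂ → ℂ) (hf : AnalyticOnNhd ℂ f Ω) : AnalyticRing Ω :=
  ⟨fun z => f z, f, hf, fun _ => rfl⟩

noncomputable instance : Algebra ℂ[X] (AnalyticRing Ω) :=
  (aeval (of id analyticOnNhd_id : AnalyticRing Ω)).toRingHom.toAlgebra

/-- The value of an analytic function at a point of the domain. -/
noncomputable def evalAt (z : Ω) : AnalyticRing Ω →ₐ[ℂ] ℂ :=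
  (Pi.evalAlgHom ℂ (fun _ : Ω => ℂ) z).comp (analyticSubalgebra Ω).val

theorem evalAt_of (z : Ω) (f : ℂ → ℂ) (hf : AnalyticOnNhd ℂ f Ω) : evalAt z (of f hf) = f z := rfl

theorem ext {g₁ g₂ : AnalyticRing Ω} (h : ∀ z, evalAt z g₁ = evalAt z g₂) : g₁ = g₂ :=
  Subtype.ext (funext h)

theorem exists_evalAt_eq (g : AnalyticRing Ω) :
    ∃ f : ℂ → ℂ, AnalyticOnNhd ℂ f Ω ∧ ∀ z : Ω, evalAt z g = f z :=
  Subtype.property g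

theorem evalAt_algebraMap (z : Ω) (P : ℂ[X]) :
    evalAt z (algebraMap ℂ[X] (AnalyticRing Ω) P) = P.eval (z : ℂ) := by
  change evalAt z (aeval _ P) = _
  rw [← aeval_algHom_apply, evalAt_of, coe_aeval_eq_eval]
  rfl

theorem evalAt_aeval (z : Ω) (g : AnalyticRing Ω) (P : ℂ[X][X]) :
    evalAt z (aeval g P) = P.evalEval (z : ℂ) (evalAt z g) := by
  have h : ((evalAt z : AnalyticRing Ω →+* ℂ).comp (algebraMap ℂ[X] (AnalyticRing Ω))) =
      evalRingHom (z : ℂ) := by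
    refine RingHom.ext fun P => ?_
    exact evalAt_algebraMap z P
  have := hom_eval₂ P (algebraMap ℂ[X] (AnalyticRing Ω)) (evalAt z : AnalyticRing Ω →+* ℂ) g
  rw [h, eval₂_evalRingHom] at this
  exact this

theorem isDomain (hc : IsPreconnected Ω) (hne : Ω.Nonempty) : IsDomain (AnalyticRing Ω) := by
  have : Nontrivial (AnalyticRing Ω) := by
    obtain ⟨z, hz⟩ := hne
    refine ⟨0, 1, fun h => ?_⟩
    have := congrArg (evalAt ⟨z, hz⟩) h
    simp at this
  have : NoZeroDivisors (AnalyticRing Ω) := by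
    refine ⟨fun {a b} hab => ?_⟩
    obtain ⟨f, hf, ef⟩ := exists_evalAt_eq a
    obtain ⟨g, hg, eg⟩ := exists_evalAt_eq b
    have h1 : ∀ z ∈ Ω, (f * g) z = 0 := by
      intro z hz
      have := congrArg (evalAt ⟨z, hz⟩) hab
      rw [map_mul, map_zero] at this
      rwa [Pi.mul_apply, ← ef ⟨z, hz⟩, ← eg ⟨z, hz⟩]
    rcases hf.eq_zero_or_eq_zero_of_mul_eq_zero hg h1 hc with h | h
    · exact Or.inl (ext fun z => (ef z).trans (h z z.2))
    · exact Or.inr (ext fun z => (eg z).trans (h z z.2))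
  exact NoZeroDivisors.to_isDomain _

theorem faithfulSMul (ho : IsOpen Ω) (hne : Ω.Nonempty) :
    FaithfulSMul ℂ[X] (AnalyticRing Ω) := by
  rw [faithfulSMul_iff_algebraMap_injective, injective_iff_map_eq_zero]
  intro P hP
  obtain ⟨z, hz⟩ := hne
  refine Polynomial.eq_zero_of_infinite_isRoot P ((infinite_of_mem_nhds z (ho.mem_nhds hz)).mono ?_)
  intro w hw
  have := congrArg (evalAt ⟨w, hw⟩) hP
  rwa [evalAt_algebraMap, map_zero] at this

end AnalyticRing

variable {Ω : Set ℂ} {f : ℂ → ℂ}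

theorem isAlgebraicFunctionOn_of_isAlgebraic (hc : IsPreconnected Ω) (ho : IsOpen Ω)
    (hne : Ω.Nonempty) (hf : AnalyticOnNhd ℂ f Ω)
    (h : IsAlgebraic ℂ[X] (AnalyticRing.of f hf)) : IsAlgebraicFunctionOn f Ω := by
  have := AnalyticRing.isDomain hc hne
  have := AnalyticRing.faithfulSMul ho hne
  obtain ⟨P, hP, hPf⟩ := h
  have hinj := FaithfulSMul.algebraMap_injective ℂ[X] (AnalyticRing Ω)
  have hdeg : 0 < P.natDegree := by
    by_contra hd
    rw [Nat.pos_iff_ne_zero, not_not] at hd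
    rw [eq_C_of_natDegree_eq_zero hd, aeval_C] at hPf
    have h0 := (map_eq_zero_iff _ hinj).1 hPf
    apply hP
    rw [eq_C_of_natDegree_eq_zero hd, h0, C_0]
  -- the factor `z` makes the polynomial depend on `z`
  refine ⟨C X * P, ?_, ⟨P.natDegree, ?_⟩, fun z hz => ?_⟩
  · rwa [natDegree_C_mul X_ne_zero]
  · rw [coeff_C_mul, coeff_natDegree, natDegree_X_mul (leadingCoeff_ne_zero.2 hP)]
    exact Nat.succ_pos _
  · have := congrArg (AnalyticRing.evalAt ⟨z, hz⟩) hPf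
    rw [AnalyticRing.evalAt_aeval, map_zero, AnalyticRing.evalAt_of] at this
    rw [evalEval_mul, this, mul_zero]

theorem IsAlgebraicFunctionOn.isAlgebraic (h : IsAlgebraicFunctionOn f Ω)
    (hf : AnalyticOnNhd ℂ f Ω) : IsAlgebraic ℂ[X] (AnalyticRing.of f hf) := by
  obtain ⟨P, hP, -, hPf⟩ := h
  refine ⟨P, fun h0 => by simp [h0] at hP, AnalyticRing.ext fun z => ?_⟩
  rw [AnalyticRing.evalAt_aeval, map_zero, AnalyticRing.evalAt_of, hPf z z.2]

/-- For an algebraic function `f` there is a polynomial `c ≠ 0` such that `c f` is a root of a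
monic polynomial `Q`, all of whose roots over `z` are simple, unless `d z = 0`. -/
theorem IsAlgebraicFunctionOn.exists_monic_separable (h : IsAlgebraicFunctionOn f Ω)
    (hc : IsPreconnected Ω) (ho : IsOpen Ω) (hne : Ω.Nonempty) (hf : AnalyticOnNhd ℂ f Ω) :
    ∃ (c : ℂ[X]) (Q A B : ℂ[X][X]) (d : ℂ[X]), c ≠ 0 ∧ Q.Monic ∧ d ≠ 0 ∧
      A * Q + B * derivative Q = C d ∧ ∀ z ∈ Ω, Q.evalEval z (c.eval z * f z) = 0 := by
  have := AnalyticRing.isDomain hc hne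
  have := AnalyticRing.faithfulSMul ho hne
  obtain ⟨c, Q, A, B, d, h1, h2, h3, h4, h5⟩ :=
    JacobiTree.exists_monic_separable (h.isAlgebraic hf)
  refine ⟨c, Q, A, B, d, h1, h2, h3, h4, fun z hz => ?_⟩
  have := congrArg (AnalyticRing.evalAt ⟨z, hz⟩) h5
  rwa [AnalyticRing.evalAt_aeval, map_zero, Algebra.smul_def, map_mul,
    AnalyticRing.evalAt_algebraMap, AnalyticRing.evalAt_of] at this

end AnalyticRing

end JacobiTree

namespace JacobiTree

/-! ### Resolvents of self-adjoint operators and of their compressions -/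

section Compression

variable {E F : Type*} [NormedAddCommGroup E] [InnerProductSpace ℂ E] [CompleteSpace E]
  [NormedAddCommGroup F] [InnerProductSpace ℂ F] [CompleteSpace F]

open ContinuousLinearMap in
/-- The compression of a self-adjoint operator `T` has its spectrum in the convex hull of the
spectrum of `T`. -/
theorem isUnit_compression_sub {T : E →L[ℂ] E} (hT : IsSelfAdjoint T) (V : F →ₗᵢ[ℂ] E) {z : ℂ}
    (hz : z ∉ Complex.ofReal '' Set.Icc (sInf (spectrum ℝ T)) (sSup (spectrum ℝ T))) :
    IsUnit (adjoint V.toContinuousLinearMap ∘L T ∘L V.toContinuousLinearMap - algebraMap ℂ _ z) := by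
  set W := V.toContinuousLinearMap
  set S := adjoint W ∘L T ∘L W
  have hVV : adjoint W ∘L W = 1 := by
    ext1 x
    refine ext_inner_right ℂ fun y => ?_
    rw [comp_apply, adjoint_inner_left]
    exact V.inner_map_map x y
  have hS : IsSelfAdjoint S := hT.adjoint_conj W
  have hcpt : IsCompact (spectrum ℝ T) := spectrum.isCompact T
  have hconj : ∀ r : ℝ, adjoint W ∘L (algebraMap ℝ (E →L[ℂ] E) r) ∘L W =
      algebraMap ℝ (F →L[ℂ] F) r := by
    intro r
    ext1 x
    have := congrArg (fun L : F →L[ℂ] F => r • L x) hVV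
    simp only [Algebra.algebraMap_eq_smul_one, comp_apply, smul_apply]
    rw [← Complex.coe_smul, map_smul, Complex.coe_smul]
    exact this
  have hlow : algebraMap ℝ _ (sInf (spectrum ℝ T)) ≤ S := by
    have h1 : algebraMap ℝ _ (sInf (spectrum ℝ T)) ≤ T :=
      (algebraMap_le_iff_le_spectrum (R := ℝ) hT).2 fun x hx => csInf_le hcpt.bddBelow hx
    rw [ContinuousLinearMap.le_def] at h1 ⊢
    have h2 := h1.adjoint_conj W
    rwa [sub_comp, comp_sub, hconj] at h2
  have hupp : S ≤ algebraMap ℝ _ (sSup (spectrum ℝ T)) := by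
    have h1 : T ≤ algebraMap ℝ _ (sSup (spectrum ℝ T)) :=
      (le_algebraMap_iff_spectrum_le (R := ℝ) hT).2 fun x hx => le_csSup hcpt.bddAbove hx
    rw [ContinuousLinearMap.le_def] at h1 ⊢
    have h2 := h1.adjoint_conj W
    rwa [sub_comp, comp_sub, hconj] at h2
  rw [← neg_sub, IsUnit.neg_iff]
  by_contra hz'
  have hmem : z ∈ spectrum ℂ S := hz'
  have hre := hS.mem_spectrum_eq_re hmem
  rw [hre] at hmem
  have hmem' : z.re ∈ spectrum ℝ S := (spectrum.algebraMap_mem_iff ℂ).1 hmem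
  exact hz ⟨z.re, ⟨(algebraMap_le_iff_le_spectrum (R := ℝ) hS).1 hlow _ hmem',
    (le_algebraMap_iff_spectrum_le (R := ℝ) hS).1 hupp _ hmem'⟩, hre.symm⟩

theorem norm_inverse_sub_apply_le {E : Type*} [NormedAddCommGroup E] [InnerProductSpace ℂ E]
    {T : E →L[ℂ] E} {z : ℂ} (h : IsUnit (T - algebraMap ℂ _ z))
    {C : ℝ} (hT : ‖T‖ ≤ C) (hz : C < ‖z‖) (x : E) :
    ‖Ring.inverse (T - algebraMap ℂ _ z) x‖ ≤ ‖x‖ / (‖z‖ - C) := by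
  set u := Ring.inverse (T - algebraMap ℂ _ z) x
  have hu : T u - z • u = x := by
    have := congrArg (fun L : E →L[ℂ] E => L x) (Ring.mul_inverse_cancel _ h)
    rw [Algebra.algebraMap_eq_smul_one] at this
    simp only [u, Algebra.algebraMap_eq_smul_one]
    exact this
  rw [le_div_iff₀ (sub_pos.2 hz)]
  have h1 : ‖z‖ * ‖u‖ ≤ ‖T u‖ + ‖x‖ := by
    rw [← norm_smul, ← hu]
    have := norm_sub_le (T u) (T u - z • u)
    rwa [sub_sub_cancel] at this
  have h2 : ‖T u‖ ≤ C * ‖u‖ := (T.le_opNorm u).trans (by gcongr)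
  nlinarith

theorem differentiableAt_inverse_sub {T : E →L[ℂ] E} {z : ℂ}
    (h : IsUnit (T - algebraMap ℂ _ z)) :
    DifferentiableAt ℂ (fun w : ℂ => Ring.inverse (T - algebraMap ℂ (E →L[ℂ] E) w)) z := by
  have h1 : DifferentiableAt ℂ (fun w : ℂ => T - algebraMap ℂ (E →L[ℂ] E) w) z := by
    simp only [Algebra.algebraMap_eq_smul_one]
    fun_prop
  exact (differentiableAt_inverse (𝕜 := ℂ) h).comp z h1

end Compression

/-! ### Operators given by a matrix -/

section kernel

open ContinuousLinearMap

variable {ι κ : Type*} {K : ι → ι → ℂ}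

open Classical in
theorem eq_of_forall_single {E : Type*} [AddCommMonoid E] [Module ℂ E] [TopologicalSpace E]
    [T2Space E] {S T : ℓ²(ι, ℂ) →L[ℂ] E}
    (h : ∀ i, S (lp.single 2 i (1 : ℂ)) = T (lp.single 2 i (1 : ℂ))) : S = T := by
  ext f
  have h1 := lp.hasSum_single (p := 2) (by simp) f
  have h2 : ∀ i, lp.single 2 i (f i) = f i • (lp.single 2 i (1 : ℂ) : ℓ²(ι, ℂ)) := by
    intro i
    rw [← lp.single_smul, smul_eq_mul, mul_one]
  have hS := h1.mapL S
  have hT := h1.mapL T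
  simp only [h2, map_smul, h] at hS hT
  exact hS.unique hT

open Classical in
theorem inner_single_one_left (i : ι) (f : ℓ²(ι, ℂ)) :
    inner ℂ (lp.single 2 i (1 : ℂ) : ℓ²(ι, ℂ)) f = f i := by
  rw [lp.inner_single_left]
  simp

open Classical in
theorem kernelOperator_single_apply (hK : BddKernel K) (i j : ι) :
    kernelOperator K hK (lp.single 2 j (1 : ℂ)) i = K i j := by
  rw [kernelOperator_apply, tsum_eq_single j]
  · simp
  · intro k hk
    simp [hk]

theorem isSelfAdjoint_kernelOperator (hK : BddKernel K) (h : ∀ i j, star (K i j) = K j i) :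
    IsSelfAdjoint (kernelOperator K hK) := by
  classical
  rw [isSelfAdjoint_iff']
  refine eq_of_forall_single fun j => ?_
  ext i
  rw [kernelOperator_single_apply, ← inner_single_one_left, adjoint_inner_right,
    ← inner_conj_symm, inner_single_one_left, kernelOperator_single_apply]
  exact h j i

theorem orthonormal_single (φ : κ ↪ ι) [DecidableEq ι] :
    Orthonormal ℂ fun k => (lp.single 2 (φ k) (1 : ℂ) : ℓ²(ι, ℂ)) := by
  classical
  rw [orthonormal_iff_ite]
  intro i j
  rw [lp.inner_single_left]
  by_cases h : i = j
  · subst h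
    simp
  · rw [lp.single_apply_ne _ _ _ (fun h' => h (φ.injective h')), if_neg h]
    simp

open Classical in
/-- Extension by zero along an embedding of the index sets. -/
noncomputable def extendZero (φ : κ ↪ ι) : ℓ²(κ, ℂ) →ₗᵢ[ℂ] ℓ²(ι, ℂ) :=
  (orthonormal_single φ).orthogonalFamily.linearIsometry

open Classical in
theorem extendZero_single (φ : κ ↪ ι) (k : κ) :
    extendZero φ (lp.single 2 k (1 : ℂ)) = lp.single 2 (φ k) (1 : ℂ) := by
  rw [extendZero, OrthogonalFamily.linearIsometry_apply_single]
  simp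

theorem adjoint_extendZero_apply (φ : κ ↪ ι) (f : ℓ²(ι, ℂ)) (k : κ) :
    adjoint (extendZero φ).toContinuousLinearMap f k = f (φ k) := by
  classical
  rw [← inner_single_one_left, adjoint_inner_right, LinearIsometry.coe_toContinuousLinearMap,
    extendZero_single, inner_single_one_left]

theorem kernelOperator_comap (hK : BddKernel K) (φ : κ ↪ ι) :
    kernelOperator (fun i j => K (φ i) (φ j)) (hK.comap φ) =
      adjoint (extendZero φ).toContinuousLinearMap ∘L kernelOperator K hK ∘L
        (extendZero φ).toContinuousLinearMap := by
  classical
  refine eq_of_forall_single fun j => ?_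
  ext i
  rw [kernelOperator_single_apply, comp_apply, adjoint_extendZero_apply, comp_apply,
    LinearIsometry.coe_toContinuousLinearMap, extendZero_single, kernelOperator_single_apply]

theorem norm_kernelOperator_comap_le (hK : BddKernel K) (φ : κ ↪ ι) :
    ‖kernelOperator (fun i j => K (φ i) (φ j)) (hK.comap φ)‖ ≤ ‖kernelOperator K hK‖ := by
  rw [kernelOperator_comap]
  have hV : ‖(extendZero φ).toContinuousLinearMap‖ ≤ 1 := (extendZero φ).norm_toContinuousLinearMap_le
  have hV' : ‖adjoint (extendZero φ).toContinuousLinearMap‖ ≤ 1 := by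
    rwa [LinearIsometryEquiv.norm_map]
  calc _ ≤ ‖adjoint (extendZero φ).toContinuousLinearMap‖ *
        (‖kernelOperator K hK‖ * ‖(extendZero φ).toContinuousLinearMap‖) :=
      (opNorm_comp_le _ _).trans (by gcongr; exact opNorm_comp_le _ _)
    _ ≤ 1 * (‖kernelOperator K hK‖ * 1) := by gcongr
    _ = _ := by ring

theorem resolventEntry_eq (A : ℓ²(ι, ℂ) →L[ℂ] ℓ²(ι, ℂ)) (i : ι) (z : ℂ) [inst : DecidableEq ι] :
    resolventEntry A i z = Ring.inverse (A - algebraMap ℂ _ z) (lp.single 2 i (1 : ℂ)) i := by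
  rw [resolventEntry, inner_single_one_left]
  obtain rfl : inst = fun a b => Classical.propDecidable (a = b) :=
    Subsingleton.elim _ _
  rfl

theorem norm_resolventEntry_le {A : ℓ²(ι, ℂ) →L[ℂ] ℓ²(ι, ℂ)} (i : ι) {z : ℂ}
    (h : IsUnit (A - algebraMap ℂ _ z)) {C : ℝ} (hA : ‖A‖ ≤ C) (hz : C < ‖z‖) :
    ‖resolventEntry A i z‖ ≤ 1 / (‖z‖ - C) := by
  classical
  rw [resolventEntry_eq]
  refine (lp.norm_apply_le_norm two_ne_zero _ i).trans ?_
  refine (norm_inverse_sub_apply_le h hA hz _).trans (le_of_eq ?_)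
  rw [lp.norm_single (by norm_num)]
  simp

theorem analyticOnNhd_resolventEntry {A : ℓ²(ι, ℂ) →L[ℂ] ℓ²(ι, ℂ)} (i : ι) {Ω : Set ℂ}
    (ho : IsOpen Ω) (h : ∀ z ∈ Ω, IsUnit (A - algebraMap ℂ _ z)) :
    AnalyticOnNhd ℂ (resolventEntry A i) Ω := by
  classical
  refine DifferentiableOn.analyticOnNhd (fun z hz => ?_) ho
  refine DifferentiableAt.differentiableWithinAt ?_
  have h1 := differentiableAt_inverse_sub (h z hz)
  have h2 : DifferentiableAt ℂ (fun w => innerSL ℂ (lp.single 2 i (1 : ℂ) : ℓ²(ι, ℂ))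
      (Ring.inverse (A - algebraMap ℂ _ w) (lp.single 2 i (1 : ℂ)))) z :=
    (innerSL ℂ (lp.single 2 i (1 : ℂ) : ℓ²(ι, ℂ))).differentiableAt.comp z
      (h1.clm_apply (differentiableAt_const _))
  refine h2.congr_of_eventuallyEq (Eventually.of_forall fun w => ?_)
  simp only [innerSL_apply_apply]
  rw [resolventEntry_eq, inner_single_one_left]

/-- An element `g` with `(A - z) g = c δ_i` is `c (A - z)⁻¹ δ_i`. -/
theorem apply_eq_mul_resolventEntry [DecidableEq ι] {A : ℓ²(ι, ℂ) →L[ℂ] ℓ²(ι, ℂ)} {i : ι} {z : ℂ}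
    (h : IsUnit (A - algebraMap ℂ _ z)) {g : ℓ²(ι, ℂ)} {c : ℂ}
    (hg : A g - z • g = c • lp.single 2 i (1 : ℂ)) : g i = c * resolventEntry A i z := by
  have h1 := congrArg
    (fun f => Ring.inverse (A - algebraMap ℂ (ℓ²(ι, ℂ) →L[ℂ] ℓ²(ι, ℂ)) z) f) hg
  have h2 : Ring.inverse (A - algebraMap ℂ (ℓ²(ι, ℂ) →L[ℂ] ℓ²(ι, ℂ)) z) (A g - z • g) = g := by
    have := congrArg (fun L : ℓ²(ι, ℂ) →L[ℂ] ℓ²(ι, ℂ) => L g) (Ring.inverse_mul_cancel _ h)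
    simp only [Algebra.algebraMap_eq_smul_one] at this ⊢
    exact this
  simp only [h2, map_smul] at h1
  have h3 := congrArg (fun f : ℓ²(ι, ℂ) => (f i : ℂ)) h1
  rw [resolventEntry_eq]
  simpa using h3

theorem inverse_sub_apply {A : ℓ²(ι, ℂ) →L[ℂ] ℓ²(ι, ℂ)} {z : ℂ}
    (h : IsUnit (A - algebraMap ℂ _ z)) (f : ℓ²(ι, ℂ)) :
    A (Ring.inverse (A - algebraMap ℂ (ℓ²(ι, ℂ) →L[ℂ] ℓ²(ι, ℂ)) z) f) -
      z • Ring.inverse (A - algebraMap ℂ (ℓ²(ι, ℂ) →L[ℂ] ℓ²(ι, ℂ)) z) f = f := by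
  have := congrArg (fun L : ℓ²(ι, ℂ) →L[ℂ] ℓ²(ι, ℂ) => L f) (Ring.mul_inverse_cancel _ h)
  simp only [Algebra.algebraMap_eq_smul_one] at this ⊢
  exact this

end kernel

end JacobiTree

namespace JacobiTree

/-! ### Branches of the universal cover -/

namespace Multigraph

variable {V D U : Type*} {G : Multigraph V D} [Finite V] [Finite D]

namespace UniversalCover

variable (T : G.UniversalCover U)

theorem fst_mem_branch (e : T.tree.Dart) : e.fst ∈ T.branch e := SimpleGraph.Reachable.refl _

theorem snd_notMem_branch (e : T.tree.Dart) : e.snd ∉ T.branch e := by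
  have h := SimpleGraph.isAcyclic_iff_forall_adj_isBridge.1 T.isTree.isAcyclic e.adj
  exact SimpleGraph.isBridge_iff.1 h

/-- Only the edge underlying `e` leads out of `T.branch e`. -/
theorem eq_of_adj_of_notMem_branch {e : T.tree.Dart} {v w : U} (hv : v ∈ T.branch e)
    (h : T.tree.Adj v w) (hw : w ∉ T.branch e) : v = e.fst ∧ w = e.snd := by
  have h1 : s(v, w) = e.edge := by
    by_contra hne
    refine hw (SimpleGraph.Reachable.trans hv (SimpleGraph.Adj.reachable ?_))
    rw [SimpleGraph.deleteEdges_adj]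
    exact ⟨h, hne⟩
  rw [SimpleGraph.dart_edge_eq_mk'_iff'.2 (Or.inl ⟨rfl, rfl⟩), Sym2.eq_iff] at h1
  rcases h1 with h1 | ⟨h1, h2⟩
  · exact h1
  · exact absurd (h1 ▸ hv) (T.snd_notMem_branch e)

theorem branch_symm_subset_branch {e e' : T.tree.Dart} (h : e'.fst = e.fst) (hne : e' ≠ e) :
    T.branch e'.symm ⊆ T.branch e := by
  have hsnd : e'.snd ≠ e.snd := by
    intro h'
    exact hne (SimpleGraph.Dart.ext _ _ (Prod.ext h h'))
  have h0 : e'.fst ∉ T.branch e'.symm := T.snd_notMem_branch e'.symm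
  have h1 : e'.snd ∈ T.branch e := by
    refine SimpleGraph.Adj.reachable ?_
    rw [SimpleGraph.deleteEdges_adj, ← h]
    refine ⟨e'.adj, fun h2 => ?_⟩
    rw [Set.mem_singleton_iff, SimpleGraph.dart_edge_eq_mk'_iff'.2 (Or.inl ⟨rfl, rfl⟩),
      Sym2.eq_iff] at h2
    rcases h2 with ⟨-, h2⟩ | ⟨h2, -⟩
    · exact hsnd h2
    · exact e.adj.ne (h ▸ h2)
  intro u hu
  obtain ⟨p⟩ := hu
  have key : ∀ {v w : U} (p : (T.tree.deleteEdges {e'.symm.edge}).Walk v w),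
      v ∈ T.branch e → v ∈ T.branch e'.symm → w ∈ T.branch e := by
    intro v w p
    induction p with
    | nil => exact fun h _ => h
    | cons hadj p ih =>
      rename_i a b c
      intro ha ha'
      have hb' : b ∈ T.branch e'.symm := SimpleGraph.Reachable.trans ha' hadj.reachable
      refine ih ?_ hb'
      by_contra hb
      have := (T.eq_of_adj_of_notMem_branch ha
        ((SimpleGraph.deleteEdges_adj.1 hadj).1) hb).1
      rw [this, ← h] at ha'
      exact h0 ha'
  exact key p h1 (T.fst_mem_branch e'.symm)

theorem finite_setOf_fst_eq (u : U) : {e : T.tree.Dart | e.fst = u}.Finite :=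
  Set.Finite.of_finite_image (Set.toFinite _) (T.bijOn_projDart u).injOn

end UniversalCover

/-! ### The Schur complement formula -/

namespace JacobiParameters

variable (J : G.JacobiParameters) (T : G.UniversalCover U)

theorem kernel_self (u : U) : J.kernel T u u = J.b (T.proj u) := by
  simp [kernel]

theorem kernel_dart (e : T.tree.Dart) : J.kernel T e.fst e.snd = J.a (T.projDart e) := by
  simp only [kernel, e.adj.ne, e.adj, if_false, dif_pos]

theorem kernel_eq_zero {u v : U} (h : u ≠ v) (h' : ¬ T.tree.Adj u v) : J.kernel T u v = 0 := by
  simp [kernel, h, h']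

theorem star_kernel (u v : U) : star (J.kernel T u v) = J.kernel T v u := by
  rw [← J.kernel_comm T u v]
  unfold kernel
  split_ifs <;> simp

/-- The restriction of the resolvent to a branch that is attached at the vertex `φ j`. -/
theorem inverse_sub_single_apply {κ : Type*} [DecidableEq κ] (φ : κ ↪ U) {j k : κ}
    {e : T.tree.Dart} (he : e.fst = φ j) (hk : e.snd = φ k)
    (hsub : T.branch e.symm ⊆ Set.range φ) {z : ℂ}
    (h : IsUnit (kernelOperator (fun u v => J.kernel T (φ u) (φ v)) ((J.bddKernel T).comap φ) -
      algebraMap ℂ _ z))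
    (hb : IsUnit (J.branchOperator T e.symm - algebraMap ℂ _ z)) {g : ℓ²(κ, ℂ)}
    (hg : g = Ring.inverse (kernelOperator (fun u v => J.kernel T (φ u) (φ v))
      ((J.bddKernel T).comap φ) - algebraMap ℂ _ z) (lp.single 2 j (1 : ℂ))) :
    g k = -(J.a (T.projDart e) * g j) * J.mFunction T e.symm z := by
  classical
  have hg1 := inverse_sub_apply h (lp.single 2 j (1 : ℂ))
  rw [← hg] at hg1
  choose i hi using fun b : T.branch e.symm => hsub b.2
  have hinj : Function.Injective i := fun b c hbc => by
    apply Subtype.ext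
    rw [← hi b, ← hi c, hbc]
  have hj : ∀ b, i b ≠ j := by
    intro b hbj
    have h1 := hi b
    rw [hbj, ← he] at h1
    have h2 := b.2
    rw [← h1] at h2
    exact T.snd_notMem_branch e.symm h2
  let f : ℓ²(T.branch e.symm, ℂ) :=
    ContinuousLinearMap.adjoint (extendZero ⟨i, hinj⟩).toContinuousLinearMap g
  have hf : ∀ b, f b = g (i b) := adjoint_extendZero_apply ⟨i, hinj⟩ g
  have key : J.branchOperator T e.symm f - z • f = (-(J.a (T.projDart e) * g j)) •
      lp.single 2 ⟨e.symm.fst, T.fst_mem_branch e.symm⟩ (1 : ℂ) := by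
    ext b
    have h1 := congrArg (fun f : ℓ²(κ, ℂ) => (f (i b) : ℂ)) hg1
    have h2 : (kernelOperator (fun u v => J.kernel T (φ u) (φ v)) ((J.bddKernel T).comap φ)) g
        (i b) = J.kernel T b (φ j) * g j + J.branchOperator T e.symm f b := by
      have hs := summable_row ((J.bddKernel T).comap φ) g (i b)
      rw [kernelOperator_apply, hs.tsum_eq_add_tsum_ite j]
      simp only [hi]
      congr 1
      refine Eq.trans ?_ (kernelOperator_apply ((J.bddKernel T).comap
        (Function.Embedding.subtype (T.branch e.symm))) f b).symm
      rw [← hinj.tsum_eq]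
      · refine tsum_congr fun c => ?_
        rw [if_neg (hj c), hf c, hi]
        rfl
      · intro x hx
        rw [Function.mem_support] at hx
        have hxj : x ≠ j := fun h => hx (if_pos h)
        rw [if_neg hxj] at hx
        have hx' := left_ne_zero_of_mul hx
        by_cases hmem : φ x ∈ T.branch e.symm
        · exact ⟨⟨φ x, hmem⟩, φ.injective (hi _)⟩
        · exfalso
          have hne : (b : U) ≠ φ x := fun h => hmem (h ▸ b.2)
          have hadj : T.tree.Adj b (φ x) := by
            by_contra hadj
            exact hx' (J.kernel_eq_zero T hne hadj)
          have := (T.eq_of_adj_of_notMem_branch b.2 hadj hmem).2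
          exact hxj (φ.injective (this.trans he))
    have h3 : J.kernel T b (φ j) * g j = (J.a (T.projDart e) * g j) *
        (lp.single 2 (⟨e.symm.fst, T.fst_mem_branch e.symm⟩ : T.branch e.symm) (1 : ℂ) :
          ℓ²(T.branch e.symm, ℂ)) b := by
      by_cases hbe : b = ⟨e.symm.fst, T.fst_mem_branch e.symm⟩
      · subst hbe
        rw [← he, J.kernel_comm]
        change J.kernel T e.fst e.snd * g j = _
        rw [J.kernel_dart, lp.single_apply_self, mul_one]
      · have h4 : J.kernel T b (φ j) = 0 := by
          have hmem : φ j ∉ T.branch e.symm := by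
            rw [← he]
            exact T.snd_notMem_branch e.symm
          refine J.kernel_eq_zero T (fun h => hmem (h ▸ b.2)) fun hadj => ?_
          exact hbe (Subtype.ext (T.eq_of_adj_of_notMem_branch b.2 hadj hmem).1)
        rw [h4, zero_mul, lp.single_apply_ne 2 _ _ hbe, mul_zero]
    have h5 : (lp.single 2 j (1 : ℂ) : ℓ²(κ, ℂ)) (i b) = 0 := by
      simp [hj b]
    simp only [lp.coeFn_sub, lp.coeFn_smul, Pi.sub_apply, Pi.smul_apply, smul_eq_mul] at h1 ⊢
    rw [h5, h2, h3] at h1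
    rw [hf]
    linear_combination h1
  have h6 := apply_eq_mul_resolventEntry hb key
  rw [hf] at h6
  have h7 : i ⟨e.symm.fst, T.fst_mem_branch e.symm⟩ = k := by
    apply φ.injective
    rw [hi, ← hk]
    rfl
  rw [h7] at h6
  exact h6

/-- The Schur complement formula for a set of vertices (the range of `φ`) that consists of the
vertex `φ j` and of branches attached to it by the edges in `N`. -/
theorem resolventEntry_mul_eq_one {κ : Type*} (φ : κ ↪ U) {j : κ}
    (N : Finset T.tree.Dart) (hN : ∀ e ∈ N, e.fst = φ j)
    (hsub : ∀ e ∈ N, T.branch e.symm ⊆ Set.range φ)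
    (hadj : ∀ k, T.tree.Adj (φ j) (φ k) → ∃ e ∈ N, e.snd = φ k) {z : ℂ}
    (h : IsUnit (kernelOperator (fun u v => J.kernel T (φ u) (φ v)) ((J.bddKernel T).comap φ) -
      algebraMap ℂ _ z))
    (hb : ∀ e, IsUnit (J.branchOperator T e - algebraMap ℂ _ z)) :
    resolventEntry (kernelOperator (fun u v => J.kernel T (φ u) (φ v))
      ((J.bddKernel T).comap φ)) j z *
      (J.b (T.proj (φ j)) - z - ∑ e ∈ N, (J.a (T.projDart e) : ℂ) ^ 2 * J.mFunction T e.symm z)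
      = 1 := by
  classical
  obtain ⟨g, hg⟩ : ∃ g : ℓ²(κ, ℂ), g = Ring.inverse (kernelOperator
      (fun u v => J.kernel T (φ u) (φ v)) ((J.bddKernel T).comap φ) - algebraMap ℂ _ z)
      (lp.single 2 j (1 : ℂ)) := ⟨_, rfl⟩
  rw [resolventEntry_eq, ← hg]
  have hg1 := inverse_sub_apply h (lp.single 2 j (1 : ℂ))
  rw [← hg] at hg1
  have h1 := congrArg (fun f : ℓ²(κ, ℂ) => (f j : ℂ)) hg1
  have hk : ∀ e : N, ∃ k, e.1.snd = φ k := by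
    intro e
    obtain ⟨k, hk⟩ := hsub e.1 e.2 (T.fst_mem_branch e.1.symm)
    exact ⟨k, hk.symm⟩
  choose k hk using hk
  have hkj : ∀ e, k e ≠ j := by
    intro e hej
    have := hk e
    rw [hej, ← hN e e.2] at this
    exact e.1.adj.ne this.symm
  have hkinj : Function.Injective k := by
    intro e e' hee
    apply Subtype.ext
    refine SimpleGraph.Dart.ext _ _ (Prod.ext ?_ ?_)
    · exact (hN e e.2).trans (hN e' e'.2).symm
    · exact (hk e).trans ((congrArg φ hee).trans (hk e').symm)
  have h2 : (kernelOperator (fun u v => J.kernel T (φ u) (φ v)) ((J.bddKernel T).comap φ)) g j =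
      J.b (T.proj (φ j)) * g j + ∑ e ∈ N.attach, J.kernel T (φ j) (φ (k e)) * g (k e) := by
    rw [kernelOperator_apply, tsum_eq_sum (s := insert j (N.attach.map ⟨k, hkinj⟩)),
      Finset.sum_insert, Finset.sum_map, J.kernel_self]
    · rfl
    · simp only [Finset.mem_map, not_exists, not_and]
      exact fun e _ => hkj e
    · intro l hl
      rw [Finset.mem_insert, not_or] at hl
      rw [J.kernel_eq_zero T (fun h => hl.1 (φ.injective h).symm), zero_mul]
      intro hjl
      obtain ⟨e, he, hel⟩ := hadj l hjl
      refine hl.2 (Finset.mem_map.2 ⟨⟨e, he⟩, Finset.mem_attach _ _, ?_⟩)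
      exact φ.injective ((hk ⟨e, he⟩).symm.trans hel)
  have h3 : ∀ e ∈ N.attach, J.kernel T (φ j) (φ (k e)) * g (k e) =
      -g j * ((J.a (T.projDart e) : ℂ) ^ 2 * J.mFunction T e.1.symm z) := by
    intro e _
    rw [J.inverse_sub_single_apply T φ (hN e e.2) (hk e) (hsub e e.2) h (hb _) hg]
    rw [← hk e, ← hN e e.2, J.kernel_dart]
    ring
  rw [Finset.sum_congr rfl h3, ← Finset.mul_sum,
    Finset.sum_attach N fun e => (J.a (T.projDart e) : ℂ) ^ 2 * J.mFunction T e.symm z] at h2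
  simp only [lp.coeFn_sub, lp.coeFn_smul, Pi.sub_apply, Pi.smul_apply, smul_eq_mul] at h1
  rw [h2] at h1
  have h5 : (lp.single 2 j (1 : ℂ) : ℓ²(κ, ℂ)) j = 1 := by simp
  rw [h5] at h1
  linear_combination h1

end JacobiParameters

end Multigraph

end JacobiTree

namespace JacobiTree

/-! ### The plane with a real segment removed -/

theorem isPreconnected_compl_segment (A B : ℝ) :
    IsPreconnected (Complex.ofReal '' Set.Icc A B)ᶜ := by
  have h1 : IsPreconnected {z : ℂ | z.re < A} := (convex_halfSpace_re_lt A).isPreconnected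
  have h2 : IsPreconnected {z : ℂ | 0 < z.im} := (convex_halfSpace_im_gt 0).isPreconnected
  have h3 : IsPreconnected {z : ℂ | B < z.re} := (convex_halfSpace_re_gt B).isPreconnected
  have h4 : IsPreconnected {z : ℂ | z.im < 0} := (convex_halfSpace_im_lt 0).isPreconnected
  have h5 := h2.union' ⟨⟨A - 1, 1⟩, by simp, by simp⟩ h1
  have h6 := h4.union' ⟨⟨A - 1, -1⟩, by simp, by simp⟩ h5
  have h7 := h6.union' ⟨⟨B + 1, 1⟩, by simp, by simp⟩ h3
  convert h7 using 1
  ext z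
  simp only [Set.mem_compl_iff, Set.mem_image, Set.mem_Icc, Set.mem_union, Set.mem_ofPred_eq]
  constructor
  · intro h
    by_contra! hc
    obtain ⟨⟨h1, h2, h3⟩, h4⟩ := hc
    refine h ⟨z.re, ⟨h3, h4⟩, Complex.ext rfl ?_⟩
    simp only [Complex.ofReal_im]
    linarith
  · rintro h ⟨x, ⟨hx1, hx2⟩, rfl⟩
    simp only [Complex.ofReal_re, Complex.ofReal_im, lt_irrefl, false_or] at h
    rcases h with h | h <;> linarith

/-! ### The Green's functions and the m-functions on the domain -/

namespace Multigraph.JacobiParameters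

variable {V D U : Type*} {G : Multigraph V D} [Finite V] [Finite D]
  (J : G.JacobiParameters) (T : G.UniversalCover U)

theorem isOpen_domain : IsOpen (J.domain T) :=
  (isCompact_Icc.image Complex.continuous_ofReal).isClosed.isOpen_compl

theorem isPreconnected_domain : IsPreconnected (J.domain T) := isPreconnected_compl_segment _ _

theorem mem_domain_of_im_ne_zero {z : ℂ} (hz : z.im ≠ 0) : z ∈ J.domain T := by
  rintro ⟨x, -, rfl⟩
  simp at hz

theorem isUnit_kernelOperator_sub {κ : Type*} (φ : κ ↪ U) {z : ℂ} (hz : z ∈ J.domain T) :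
    IsUnit (kernelOperator (fun u v => J.kernel T (φ u) (φ v)) ((J.bddKernel T).comap φ) -
      algebraMap ℂ _ z) := by
  rw [kernelOperator_comap (J.bddKernel T)]
  exact isUnit_compression_sub (isSelfAdjoint_kernelOperator _ (J.star_kernel T)) _ hz

theorem isUnit_operator_sub {z : ℂ} (hz : z ∈ J.domain T) :
    IsUnit (J.operator T - algebraMap ℂ _ z) :=
  J.isUnit_kernelOperator_sub T (Function.Embedding.refl U) hz

theorem isUnit_branchOperator_sub (e : T.tree.Dart) {z : ℂ} (hz : z ∈ J.domain T) :
    IsUnit (J.branchOperator T e - algebraMap ℂ _ z) :=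
  J.isUnit_kernelOperator_sub T (Function.Embedding.subtype _) hz

theorem analyticOnNhd_green (j : U) : AnalyticOnNhd ℂ (J.green T j) (J.domain T) :=
  analyticOnNhd_resolventEntry _ (J.isOpen_domain T) fun _ hz => J.isUnit_operator_sub T hz

theorem analyticOnNhd_mFunction (e : T.tree.Dart) :
    AnalyticOnNhd ℂ (J.mFunction T e) (J.domain T) :=
  analyticOnNhd_resolventEntry _ (J.isOpen_domain T) fun _ hz => J.isUnit_branchOperator_sub T e hz

theorem norm_green_le (j : U) {z : ℂ} (hz : z ∈ J.domain T) (h : ‖J.operator T‖ < ‖z‖) :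
    ‖J.green T j z‖ ≤ 1 / (‖z‖ - ‖J.operator T‖) :=
  norm_resolventEntry_le _ (J.isUnit_operator_sub T hz) le_rfl h

theorem norm_mFunction_le (e : T.tree.Dart) {z : ℂ} (hz : z ∈ J.domain T)
    (h : ‖J.operator T‖ < ‖z‖) : ‖J.mFunction T e z‖ ≤ 1 / (‖z‖ - ‖J.operator T‖) :=
  norm_resolventEntry_le _ (J.isUnit_branchOperator_sub T e hz)
    (norm_kernelOperator_comap_le (J.bddKernel T) (Function.Embedding.subtype _)) h

open Classical in
/-- The m-function of the branch that is attached at the vertex `j` by the lift of the directed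
edge `d` (with the value `0` if `d` does not start at the image of `j`). -/
noncomputable def attachedMFunction (j : U) (d : D) : ℂ → ℂ :=
  if h : ∃ e : T.tree.Dart, e.fst = j ∧ T.projDart e = d then J.mFunction T h.choose.symm else 0

theorem attachedMFunction_projDart (e : T.tree.Dart) :
    J.attachedMFunction T e.fst (T.projDart e) = J.mFunction T e.symm := by
  have h : ∃ e' : T.tree.Dart, e'.fst = e.fst ∧ T.projDart e' = T.projDart e := ⟨e, rfl, rfl⟩
  rw [attachedMFunction, dif_pos h]
  have := (T.bijOn_projDart e.fst).injOn h.choose_spec.1 rfl h.choose_spec.2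
  rw [this]

theorem sum_attachedMFunction [Fintype D] (N : Finset T.tree.Dart) (j : U)
    (hN : ∀ e ∈ N, e.fst = j) (Q : D → Prop) [DecidablePred Q]
    (hQ : ∀ d, Q d → G.src d = T.proj j) (hNQ : ∀ e, e.fst = j → (e ∈ N ↔ Q (T.projDart e)))
    (z : ℂ) :
    ∑ e ∈ N, (J.a (T.projDart e) : ℂ) ^ 2 * J.mFunction T e.symm z =
      ∑ d with Q d, (J.a d : ℂ) ^ 2 * J.attachedMFunction T j d z := by
  refine Finset.sum_nbij T.projDart ?_ ?_ ?_ ?_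
  · intro e he
    simpa using (hNQ e (hN e he)).1 he
  · intro e he e' he' h
    exact (T.bijOn_projDart j).injOn (hN e he) (hN e' he') h
  · intro d hd
    have hd' : Q d := by simpa using hd
    obtain ⟨e, he, rfl⟩ := (T.bijOn_projDart j).surjOn (hQ d hd')
    exact ⟨e, (hNQ e he).2 hd', rfl⟩
  · intro e he
    rw [← hN e he, J.attachedMFunction_projDart T e]

/-- The recursion for the m-functions: the branch of `e` consists of the vertex `e.fst` and of the
branches which are attached there by the other edges. -/
theorem mFunction_mul_eq_one [Fintype D] (e : T.tree.Dart) (Q : D → Prop) [DecidablePred Q]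
    (hQ : ∀ d, Q d ↔ G.src d = T.proj e.fst ∧ d ≠ T.projDart e) {z : ℂ} (hz : z ∈ J.domain T) :
    J.mFunction T e z * (J.b (T.proj e.fst) - z -
      ∑ d with Q d, (J.a d : ℂ) ^ 2 * J.attachedMFunction T e.fst d z) = 1 := by
  have hfin : {e' : T.tree.Dart | e'.fst = e.fst ∧ e' ≠ e}.Finite :=
    (T.finite_setOf_fst_eq e.fst).subset fun _ h => h.1
  have hmem : ∀ e', e' ∈ hfin.toFinset ↔ e'.fst = e.fst ∧ e' ≠ e := fun e' => by simp
  rw [← J.sum_attachedMFunction T hfin.toFinset e.fst (fun e' he' => ((hmem e').1 he').1) Q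
    (fun d hd => ((hQ d).1 hd).1)]
  · refine J.resolventEntry_mul_eq_one T (Function.Embedding.subtype (T.branch e))
      (j := ⟨e.fst, T.fst_mem_branch e⟩) hfin.toFinset
      (fun e' he' => ((hmem e').1 he').1) (fun e' he' => ?_) (fun k hk => ?_)
      (J.isUnit_branchOperator_sub T e hz) fun e' => J.isUnit_branchOperator_sub T e' hz
    · obtain ⟨h1, h2⟩ := (hmem e').1 he'
      exact fun u hu => ⟨⟨u, T.branch_symm_subset_branch h1 h2 hu⟩, rfl⟩
    · refine ⟨⟨(e.fst, k.1), hk⟩, (hmem _).2 ⟨rfl, fun h => ?_⟩, rfl⟩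
      have h1 : k.1 = e.snd := congrArg (fun e : T.tree.Dart => e.snd) h
      exact T.snd_notMem_branch e (h1 ▸ k.2)
  · intro e' he'
    rw [hmem]
    have h1 : G.src (T.projDart e') = T.proj e.fst := by rw [T.src_projDart, he']
    have h2 : T.projDart e' = T.projDart e ↔ e' = e :=
      ⟨fun h => (T.bijOn_projDart e.fst).injOn he' rfl h, fun h => h ▸ rfl⟩
    rw [hQ, h1, Ne, Ne, h2]
    simp [he']

open Classical in
theorem green_mul_eq_one [Fintype D] (j : U) {z : ℂ} (hz : z ∈ J.domain T) :
    J.green T j z * (J.b (T.proj j) - z -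
      ∑ d with G.src d = T.proj j, (J.a d : ℂ) ^ 2 * J.attachedMFunction T j d z) = 1 := by
  have hfin := T.finite_setOf_fst_eq j
  have hmem : ∀ e', e' ∈ hfin.toFinset ↔ e'.fst = j := fun e' => by simp
  rw [← J.sum_attachedMFunction T hfin.toFinset j (fun e' he' => (hmem e').1 he') _
    (fun d hd => hd)]
  · refine J.resolventEntry_mul_eq_one T (Function.Embedding.refl U) (j := j) hfin.toFinset
      (fun e' he' => (hmem e').1 he') (fun e' he' u _ => ⟨u, rfl⟩) (fun k hk => ?_)
      (J.isUnit_operator_sub T hz) fun e' => J.isUnit_branchOperator_sub T e' hz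
    exact ⟨⟨(j, k), hk⟩, (hmem _).2 rfl, rfl⟩
  · intro e' he'
    rw [hmem, T.src_projDart, he']
    simp

theorem sum_sq_nonneg [Fintype D] : 0 ≤ ∑ d, J.a d ^ 2 :=
  Finset.sum_nonneg fun _ _ => sq_nonneg _

/-- Near infinity the system of equations for the m-functions is a contraction, so that it has at
most one solution. -/
theorem mFunction_eq_of_large [Fintype D] {e₁ e₂ : T.tree.Dart}
    (h : T.projDart e₁ = T.projDart e₂) {z : ℂ} (hz : z ∈ J.domain T)
    (hlarge : ‖J.operator T‖ + 1 + 2 * ∑ d, J.a d ^ 2 ≤ ‖z‖) :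
    J.mFunction T e₁ z = J.mFunction T e₂ z := by
  classical
  have hS := J.sum_sq_nonneg
  set S := ∑ d, J.a d ^ 2
  have hlt : ‖J.operator T‖ < ‖z‖ := by linarith
  set ε := 1 / (‖z‖ - ‖J.operator T‖) with hε
  have hpos : 0 < ‖z‖ - ‖J.operator T‖ := by linarith
  have hε0 : 0 ≤ ε := by positivity
  have hε1 : ε * (1 + 2 * S) ≤ 1 := by
    rw [hε, div_mul_eq_mul_div, div_le_one hpos]
    linarith
  have hε2 : ε * ε * S ≤ 1 / 2 := by nlinarith [mul_nonneg hε0 hS]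
  have hm := fun e => J.norm_mFunction_le T e hz hlt
  -- each use of the recursion halves the bound for the difference
  have key : ∀ n : ℕ, ∀ e₁ e₂ : T.tree.Dart, T.projDart e₁ = T.projDart e₂ →
      ‖J.mFunction T e₁ z - J.mFunction T e₂ z‖ ≤ 2 * ε * (1 / 2) ^ n := by
    intro n
    induction n with
    | zero =>
      intro e₁ e₂ _
      refine (norm_sub_le _ _).trans ?_
      have h1 := hm e₁
      have h2 := hm e₂
      rw [pow_zero]
      linarith
    | succ n ih =>
      intro e₁ e₂ h12
      have hp : T.proj e₁.fst = T.proj e₂.fst := by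
        rw [← T.src_projDart, ← T.src_projDart, h12]
      have h1 := J.mFunction_mul_eq_one T e₁
        (fun d => G.src d = T.proj e₂.fst ∧ d ≠ T.projDart e₂) (fun d => by rw [h12, hp]) hz
      have h2 := J.mFunction_mul_eq_one T e₂ _ (fun d => Iff.rfl) hz
      rw [hp] at h1
      set s₁ := ∑ d with G.src d = T.proj e₂.fst ∧ d ≠ T.projDart e₂,
        (J.a d : ℂ) ^ 2 * J.attachedMFunction T e₁.fst d z
      set s₂ := ∑ d with G.src d = T.proj e₂.fst ∧ d ≠ T.projDart e₂,
        (J.a d : ℂ) ^ 2 * J.attachedMFunction T e₂.fst d z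
      have h3 : J.mFunction T e₁ z - J.mFunction T e₂ z =
          J.mFunction T e₁ z * J.mFunction T e₂ z * (s₁ - s₂) := by
        linear_combination J.mFunction T e₂ z * h1 - J.mFunction T e₁ z * h2
      have h4 : ‖s₁ - s₂‖ ≤ S * (2 * ε * (1 / 2) ^ n) := by
        rw [← Finset.sum_sub_distrib]
        refine (norm_sum_le _ _).trans ?_
        rw [Finset.sum_mul]
        refine (Finset.sum_le_sum (g := fun d => J.a d ^ 2 * (2 * ε * (1 / 2) ^ n))
          fun d hd => ?_).trans (Finset.sum_le_sum_of_subset_of_nonneg (Finset.subset_univ _)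
            fun d _ _ => by positivity)
        have hd' : G.src d = T.proj e₂.fst := by
          have := (Finset.mem_filter.1 hd).2
          exact this.1
        obtain ⟨e₁', he₁, hd₁⟩ := (T.bijOn_projDart e₁.fst).surjOn (hd'.trans hp.symm)
        obtain ⟨e₂', he₂, hd₂⟩ := (T.bijOn_projDart e₂.fst).surjOn hd'
        rw [← mul_sub, norm_mul, norm_pow, Complex.norm_real, Real.norm_eq_abs, sq_abs]
        refine mul_le_mul_of_nonneg_left ?_ (sq_nonneg _)
        have h5 := J.attachedMFunction_projDart T e₁'
        have h6 := J.attachedMFunction_projDart T e₂'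
        rw [hd₁, he₁] at h5
        rw [hd₂, he₂] at h6
        rw [h5, h6]
        refine ih _ _ ?_
        rw [T.projDart_symm, T.projDart_symm, hd₁, hd₂]
      rw [h3, norm_mul, norm_mul]
      calc ‖J.mFunction T e₁ z‖ * ‖J.mFunction T e₂ z‖ * ‖s₁ - s₂‖
          ≤ ε * ε * (S * (2 * ε * (1 / 2) ^ n)) := by
            gcongr
            · exact hm e₁
            · exact hm e₂
        _ = (ε * ε * S) * (2 * ε * (1 / 2) ^ n) := by ring
        _ ≤ 1 / 2 * (2 * ε * (1 / 2) ^ n) := by gcongr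
        _ = 2 * ε * (1 / 2) ^ (n + 1) := by ring
  have hlim : Tendsto (fun n : ℕ => 2 * ε * (1 / 2 : ℝ) ^ n) atTop (𝓝 (2 * ε * 0)) :=
    (tendsto_pow_atTop_nhds_zero_of_lt_one (by norm_num) (by norm_num)).const_mul _
  rw [mul_zero] at hlim
  have h0 : ‖J.mFunction T e₁ z - J.mFunction T e₂ z‖ ≤ 0 :=
    ge_of_tendsto hlim (Eventually.of_forall fun n => key n e₁ e₂ h)
  exact sub_eq_zero.1 (norm_le_zero_iff.1 h0)

theorem exists_large_mem_domain (R : ℝ) : ∃ z ∈ J.domain T, R < ‖z‖ := by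
  refine ⟨((|R| + 1 : ℝ) : ℂ) * Complex.I, J.mem_domain_of_im_ne_zero T ?_, ?_⟩
  · have : (0 : ℝ) < |R| + 1 := by positivity
    simpa using this.ne'
  · rw [norm_mul, Complex.norm_I, mul_one, Complex.norm_real, Real.norm_eq_abs]
    exact lt_of_le_of_lt (le_abs_self R) ((lt_add_one _).trans_le (le_abs_self _))

/-- The m-function depends only on the image of the directed edge in the finite graph. -/
theorem mFunction_eqOn {e₁ e₂ : T.tree.Dart} (h : T.projDart e₁ = T.projDart e₂) :
    Set.EqOn (J.mFunction T e₁) (J.mFunction T e₂) (J.domain T) := by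
  have := Fintype.ofFinite D
  obtain ⟨z₀, hz₀, hlarge⟩ :=
    J.exists_large_mem_domain T (‖J.operator T‖ + 1 + 2 * ∑ d, J.a d ^ 2)
  refine (J.analyticOnNhd_mFunction T e₁).eqOn_of_preconnected_of_eventuallyEq
    (J.analyticOnNhd_mFunction T e₂) (J.isPreconnected_domain T) hz₀ ?_
  filter_upwards [(J.isOpen_domain T).mem_nhds hz₀,
    continuous_norm.continuousAt.eventually (lt_mem_nhds hlarge)] with z hz hz'
  exact J.mFunction_eq_of_large T h hz hz'.le

theorem attachedMFunction_eqOn {j : U} {d : D} (hd : G.src d = T.proj j) {e : T.tree.Dart}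
    (he : T.projDart e = G.rev d) :
    Set.EqOn (J.attachedMFunction T j d) (J.mFunction T e) (J.domain T) := by
  obtain ⟨e', he', rfl⟩ := (T.bijOn_projDart j).surjOn hd
  have h1 := J.attachedMFunction_projDart T e'
  rw [he'] at h1
  rw [h1]
  exact J.mFunction_eqOn T (by rw [he, T.projDart_symm])

theorem green_eqOn {j₁ j₂ : U} (h : T.proj j₁ = T.proj j₂) :
    Set.EqOn (J.green T j₁) (J.green T j₂) (J.domain T) := by
  classical
  have := Fintype.ofFinite D
  intro z hz
  have h1 := J.green_mul_eq_one T j₁ hz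
  have h2 := J.green_mul_eq_one T j₂ hz
  rw [h] at h1
  have h3 : ∑ d with G.src d = T.proj j₂, (J.a d : ℂ) ^ 2 * J.attachedMFunction T j₁ d z =
      ∑ d with G.src d = T.proj j₂, (J.a d : ℂ) ^ 2 * J.attachedMFunction T j₂ d z := by
    refine Finset.sum_congr rfl fun d hd => ?_
    have hd' : G.src d = T.proj j₂ := (Finset.mem_filter.1 hd).2
    obtain ⟨e, he, rfl⟩ := (T.bijOn_projDart j₂).surjOn hd'
    rw [J.attachedMFunction_eqOn T (hd'.trans h.symm) (T.projDart_symm e) hz,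
      J.attachedMFunction_eqOn T hd' (T.projDart_symm e) hz]
  rw [h3] at h1
  linear_combination J.green T j₂ z * h1 - J.green T j₁ z * h2

end Multigraph.JacobiParameters

end JacobiTree

namespace JacobiTree

namespace Multigraph.JacobiParameters

open Polynomial

variable {V D U : Type*} {G : Multigraph V D} [Finite V] [Finite D]
  (J : G.JacobiParameters) (T : G.UniversalCover U)

/-- The directed edges and the vertices of the finite graph that are images of directed edges and
vertices of the cover. They index the different m-functions and Green's functions. -/
abbrev Index : Type _ := {d : D // ∃ e, T.projDart e = d} ⊕ {v : V // ∃ j, T.proj j = v}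

/-- The m-functions and Green's functions, indexed by the finite graph. -/
noncomputable def indexed : Index T → ℂ → ℂ
  | .inl d => J.mFunction T d.2.choose
  | .inr v => J.green T v.2.choose

/-- The diagonal matrix element that belongs to an index. -/
def indexedB : Index T → ℝ
  | .inl d => J.b (G.src d)
  | .inr v => J.b v

/-- The directed edges along which a path may go on: from the initial vertex of `d`, it must not
use `d` itself. -/
def Continues : Index T → D → Prop
  | .inl d, d' => G.src d' = G.src d ∧ d' ≠ d
  | .inr v, d' => G.src d' = v

open Classical in
/-- The coefficients of the system that the functions `J.indexed T` solve. -/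
noncomputable def coefficient (i : Index T) : Index T → ℝ
  | .inl d => if Continues T i (G.rev d) then J.a d ^ 2 else 0
  | .inr _ => 0

theorem analyticOnNhd_indexed (i : Index T) : AnalyticOnNhd ℂ (J.indexed T i) (J.domain T) := by
  rcases i with d | v
  · exact J.analyticOnNhd_mFunction T _
  · exact J.analyticOnNhd_green T _

theorem norm_indexed_le (i : Index T) {z : ℂ} (hz : z ∈ J.domain T) (h : ‖J.operator T‖ < ‖z‖) :
    ‖J.indexed T i z‖ ≤ 1 / (‖z‖ - ‖J.operator T‖) := by
  rcases i with d | v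
  · exact J.norm_mFunction_le T _ hz h
  · exact J.norm_green_le T _ hz h

theorem exists_eqOn_indexed {f : ℂ → ℂ} (hf : f ∈ J.functions T) :
    ∃ i, Set.EqOn f (J.indexed T i) (J.domain T) := by
  rcases hf with ⟨j, rfl⟩ | ⟨e, rfl⟩
  · have h : ∃ j', T.proj j' = T.proj j := ⟨j, rfl⟩
    exact ⟨.inr ⟨_, h⟩, J.green_eqOn T h.choose_spec.symm⟩
  · have h : ∃ e', T.projDart e' = T.projDart e := ⟨e, rfl⟩
    exact ⟨.inl ⟨_, h⟩, J.mFunction_eqOn T h.choose_spec.symm⟩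

open Classical in
theorem sum_coefficient [Fintype D] [Fintype V] (i : Index T) (j : U)
    (hi : ∀ d, Continues T i d → G.src d = T.proj j) {z : ℂ} (hz : z ∈ J.domain T) :
    ∑ k, (J.coefficient T i k : ℂ) * J.indexed T k z =
      ∑ d with Continues T i d, (J.a d : ℂ) ^ 2 * J.attachedMFunction T j d z := by
  rw [Fintype.sum_sum_type]
  simp only [coefficient, Complex.ofReal_zero, zero_mul, Finset.sum_const_zero, add_zero,
    apply_ite Complex.ofReal, ite_mul, ← Finset.sum_filter]
  have hlift : ∀ d, Continues T i d → ∃ e, T.projDart e = G.rev d := by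
    intro d hd
    obtain ⟨e, -, rfl⟩ := (T.bijOn_projDart j).surjOn (hi d hd)
    exact ⟨e.symm, T.projDart_symm e⟩
  symm
  refine Finset.sum_bij (fun d hd => ⟨G.rev d, hlift d (Finset.mem_filter.1 hd).2⟩) ?_ ?_ ?_ ?_
  · intro d hd
    simpa [G.rev_rev] using hd
  · intro d _ d' _ h
    rw [← G.rev_rev d, ← G.rev_rev d']
    exact congrArg G.rev (congrArg Subtype.val h)
  · intro d hd
    exact ⟨G.rev d, by simpa using hd, Subtype.ext (G.rev_rev d)⟩
  · intro d hd
    have hd' := (Finset.mem_filter.1 hd).2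
    have he : ∃ e, T.projDart e = G.rev d := hlift d hd'
    rw [J.attachedMFunction_eqOn T (hi d hd') he.choose_spec hz, J.a_rev]
    simp [indexed]

open Classical in
theorem indexed_mul_eq_one [Fintype D] [Fintype V] (i : Index T) {z : ℂ}
    (hz : z ∈ J.domain T) :
    J.indexed T i z *
      (J.indexedB T i - z - ∑ k, (J.coefficient T i k : ℂ) * J.indexed T k z) = 1 := by
  rcases i with d | v
  · have hd := d.2.choose_spec
    have h0 : G.src d = T.proj d.2.choose.fst := by rw [← T.src_projDart, hd]
    have h := J.mFunction_mul_eq_one T d.2.choose (Continues T (.inl d))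
      (fun d' => by rw [hd, ← h0, Continues]) hz
    rw [← h0] at h
    rw [J.sum_coefficient T (.inl d) d.2.choose.fst (fun d' hd' => hd'.1.trans h0) hz]
    exact h
  · have hv := v.2.choose_spec
    have h := J.green_mul_eq_one T v.2.choose hz
    rw [hv] at h
    rw [J.sum_coefficient T (.inr v) v.2.choose (fun d' hd' => Eq.trans hd' hv.symm) hz]
    exact h

open Classical in
theorem sum_abs_coefficient_le [Fintype D] [Fintype V] (i : Index T) :
    ∑ k, |J.coefficient T i k| ≤ ∑ d, J.a d ^ 2 := by
  rw [Fintype.sum_sum_type]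
  simp only [coefficient, abs_zero, Finset.sum_const_zero, add_zero]
  calc ∑ d : {d : D // ∃ e, T.projDart e = d}, |if Continues T i (G.rev d) then J.a d ^ 2 else 0|
      ≤ ∑ d : {d : D // ∃ e, T.projDart e = d}, J.a d ^ 2 := by
        refine Finset.sum_le_sum fun d _ => ?_
        split_ifs
        · rw [abs_of_nonneg (sq_nonneg _)]
        · rw [abs_zero]
          exact sq_nonneg _
    _ ≤ ∑ d, J.a d ^ 2 := by
        rw [← Finset.sum_subtype (Finset.univ.filter fun d => ∃ e, T.projDart e = d)
          (fun d => by simp) fun d => J.a d ^ 2]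
        exact Finset.sum_le_sum_of_subset_of_nonneg (Finset.subset_univ _) fun _ _ _ => sq_nonneg _

open Classical in
/-- Near infinity all `J.indexed T i` are small, and the matrix that decides about the
non-degeneracy of the system is strictly diagonally dominant. -/
theorem det_ne_zero_of_large [Fintype D] [Fintype V]
    {z : ℂ} (hz : z ∈ J.domain T)
    (hlarge : ‖J.operator T‖ + 1 + 2 * ∑ d, J.a d ^ 2 ≤ ‖z‖) :
    (1 - Matrix.of fun i k => J.indexed T i z ^ 2 * (J.coefficient T i k : ℂ)).det ≠ 0 := by
  have hS := J.sum_sq_nonneg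
  set S := ∑ d, J.a d ^ 2 with hSdef
  have hlt : ‖J.operator T‖ < ‖z‖ := by linarith
  set ε := 1 / (‖z‖ - ‖J.operator T‖) with hε
  have hpos : 0 < ‖z‖ - ‖J.operator T‖ := by linarith
  have hε0 : 0 ≤ ε := by positivity
  have hε1 : ε * (1 + 2 * S) ≤ 1 := by
    rw [hε, div_mul_eq_mul_div, div_le_one hpos]
    linarith
  have hε2 : ε ^ 2 * S ≤ 1 / 2 := by nlinarith [mul_nonneg hε0 hS]
  refine det_ne_zero_of_sum_row_lt_diag fun i => ?_
  set N : Index T → ℝ := fun k => ‖J.indexed T i z ^ 2 * (J.coefficient T i k : ℂ)‖ with hN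
  have hsum : ∑ k, N k ≤ 1 / 2 := by
    refine le_trans ?_ hε2
    calc ∑ k, N k ≤ ∑ k, ε ^ 2 * |J.coefficient T i k| := by
          refine Finset.sum_le_sum fun k _ => ?_
          rw [hN]
          simp only [norm_mul, norm_pow, Complex.norm_real, Real.norm_eq_abs]
          gcongr
          exact J.norm_indexed_le T i hz hlt
      _ = ε ^ 2 * ∑ k, |J.coefficient T i k| := by rw [Finset.mul_sum]
      _ ≤ ε ^ 2 * S := by
          gcongr
          exact J.sum_abs_coefficient_le T i
  rw [← Finset.add_sum_erase _ _ (Finset.mem_univ i)] at hsum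
  have h1 : ∑ k ∈ Finset.univ.erase i,
      ‖(1 - Matrix.of fun i k => J.indexed T i z ^ 2 * (J.coefficient T i k : ℂ)) i k‖ =
      ∑ k ∈ Finset.univ.erase i, N k := by
    refine Finset.sum_congr rfl fun k hk => ?_
    rw [Matrix.sub_apply, Matrix.one_apply_ne (Finset.ne_of_mem_erase hk).symm, zero_sub, norm_neg]
    rfl
  have h2 : 1 - N i ≤
      ‖(1 - Matrix.of fun i k => J.indexed T i z ^ 2 * (J.coefficient T i k : ℂ)) i i‖ := by
    rw [Matrix.sub_apply, Matrix.one_apply_eq]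
    refine le_trans ?_ (norm_sub_norm_le _ _)
    rw [norm_one]
    rfl
  rw [h1]
  linarith

/-- The Jacobian criterion applies, since the determinant is an analytic function that does not
vanish identically. -/
theorem isAlgebraicFunctionOn_indexed (i : Index T) :
    IsAlgebraicFunctionOn (J.indexed T i) (J.domain T) := by
  classical
  have := Fintype.ofFinite V
  have := Fintype.ofFinite D
  obtain ⟨z₀, hz₀, hlarge⟩ :=
    J.exists_large_mem_domain T (‖J.operator T‖ + 1 + 2 * ∑ d, J.a d ^ 2)
  have hne : (J.domain T).Nonempty := ⟨z₀, hz₀⟩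
  have hpre := J.isPreconnected_domain T
  have hopen := J.isOpen_domain T
  have := AnalyticRing.isDomain hpre hne
  have := AnalyticRing.faithfulSMul hopen hne
  refine isAlgebraicFunctionOn_of_isAlgebraic hpre hopen hne (J.analyticOnNhd_indexed T i) ?_
  refine isAlgebraic_of_system (k := ℂ[X])
    (fun i => AnalyticRing.of (J.indexed T i) (J.analyticOnNhd_indexed T i))
    (fun i => C (J.indexedB T i : ℂ) - X) (fun i k => C (J.coefficient T i k : ℂ)) ?_ ?_ i
  · intro i
    refine AnalyticRing.ext fun z => ?_
    rw [map_mul, map_sub, map_sum, map_one, AnalyticRing.evalAt_of,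
      AnalyticRing.evalAt_algebraMap, eval_sub, eval_C, eval_X, ← J.indexed_mul_eq_one T i z.2]
    congr 2
    refine Finset.sum_congr rfl fun k _ => ?_
    rw [map_mul, AnalyticRing.evalAt_of, AnalyticRing.evalAt_algebraMap, eval_C]
  · intro h
    have h1 := congrArg (AnalyticRing.evalAt ⟨z₀, hz₀⟩) h
    rw [AlgHom.map_det, map_zero] at h1
    refine J.det_ne_zero_of_large T hz₀ hlarge.le (Eq.trans ?_ h1)
    congr 1
    ext i k
    simp only [AlgHom.mapMatrix_apply, Matrix.map_apply, Matrix.sub_apply, Matrix.of_apply, map_sub,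
      map_mul, map_pow, AnalyticRing.evalAt_algebraMap, AnalyticRing.evalAt_of, eval_C,
      Matrix.one_apply]
    congr 1
    split_ifs <;> simp

end Multigraph.JacobiParameters

end JacobiTree

namespace JacobiTree

open Polynomial

/-! ### Roots of a polynomial with polynomial coefficients -/

theorem evalEval_eq_sum (Q : ℂ[X][X]) (z w : ℂ) :
    Q.evalEval z w = ∑ i ∈ Finset.range (Q.natDegree + 1), (Q.coeff i).eval z * w ^ i := by
  rw [evalEval, eval_eq_sum_range (p := Q), eval_finsetSum]
  simp

theorem continuous_evalEval (Q : ℂ[X][X]) : Continuous fun x : ℂ × ℂ => Q.evalEval x.1 x.2 := by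
  simp only [evalEval_eq_sum]
  fun_prop

/-- A bound for the roots of the monic polynomial `Q(z, ·)` (Cauchy's bound). -/
noncomputable def rootBound (Q : ℂ[X][X]) (z : ℂ) : ℝ :=
  1 + ∑ i ∈ Finset.range Q.natDegree, ‖(Q.coeff i).eval z‖

theorem continuous_rootBound (Q : ℂ[X][X]) : Continuous (rootBound Q) := by
  unfold rootBound
  fun_prop

theorem norm_le_rootBound {Q : ℂ[X][X]} (hQ : Q.Monic) {z w : ℂ} (h : Q.evalEval z w = 0) :
    ‖w‖ ≤ rootBound Q z := by
  have hm : (Q.map (evalRingHom z)).Monic := hQ.map _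
  have hroot : (Q.map (evalRingHom z)).IsRoot w := by
    rw [IsRoot, map_evalRingHom_eval]
    exact h
  have h1 := hroot.norm_lt_cauchyBound hm.ne_zero
  refine (NNReal.coe_lt_coe.2 h1).le.trans ?_
  rw [cauchyBound, hm.leadingCoeff, nnnorm_one, div_one, hQ.natDegree_map, rootBound, add_comm,
    NNReal.coe_add, NNReal.coe_one]
  refine add_le_add_right ?_ 1
  have h2 : (∑ i ∈ Finset.range Q.natDegree, ‖(Q.coeff i).eval z‖) =
      ((∑ i ∈ Finset.range Q.natDegree, ‖(Q.coeff i).eval z‖₊ : NNReal) : ℝ) := by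
    push_cast
    rfl
  rw [h2, NNReal.coe_le_coe]
  refine Finset.sup_le fun i hi => ?_
  rw [coeff_map]
  exact Finset.single_le_sum (f := fun i => ‖(Q.coeff i).eval z‖₊) (fun _ _ => zero_le) hi

/-! ### Boundary values of algebraic functions -/

/-- A continuous root of a monic polynomial has limits at the boundary: its cluster set is
connected, and contained in the finite set of the roots over the boundary point. -/
theorem exists_tendsto_of_evalEval_eq_zero {Q : ℂ[X][X]} (hQ : Q.Monic) {v : ℂ → ℂ} {H : Set ℂ}
    (hH : Convex ℝ H) (hv : ContinuousOn v H) (hroot : ∀ z ∈ H, Q.evalEval z (v z) = 0) {x : ℂ}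
    (hx : x ∈ closure H) : ∃ l, Tendsto v (𝓝[H] x) (𝓝 l) := by
  have hne : (𝓝[H] x).NeBot := mem_closure_iff_nhdsWithin_neBot.1 hx
  have hH' : ∀ᶠ z in 𝓝[H] x, z ∈ H := eventually_mem_nhdsWithin
  -- cluster points of `v` are roots of `Q(x, ·)`
  have hcl : ∀ w, MapClusterPt w (𝓝[H] x) v → Q.evalEval x w = 0 := by
    intro w hw
    obtain ⟨F, hF, hvF⟩ := mapClusterPt_iff_ultrafilter.1 hw
    have h1 : Tendsto (fun z => (z, v z)) F (𝓝 (x, w)) :=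
      (tendsto_id.mono_left (hF.trans inf_le_left)).prodMk_nhds hvF
    have h2 := ((continuous_evalEval Q).tendsto (x, w)).comp h1
    refine tendsto_nhds_unique h2 (tendsto_const_nhds.congr' ?_)
    filter_upwards [hF hH'] with z hz
    exact (hroot z hz).symm
  have hfin : {w | Q.evalEval x w = 0}.Finite := by
    have hm : (Q.map (evalRingHom x)) ≠ 0 := (hQ.map _).ne_zero
    refine (finite_setOfPred_isRoot hm).subset fun w hw => ?_
    rw [Set.mem_ofPred_eq, IsRoot, map_evalRingHom_eval]
    exact hw
  have hbdd : ∀ᶠ z in 𝓝[H] x, v z ∈ Metric.closedBall (0 : ℂ) (rootBound Q x + 1) := by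
    have h1 : ∀ᶠ z in 𝓝[H] x, rootBound Q z < rootBound Q x + 1 :=
      ((continuous_rootBound Q).continuousAt.eventually
        (gt_mem_nhds (lt_add_one _))).filter_mono inf_le_left
    filter_upwards [h1, hH'] with z hz hzH
    rw [mem_closedBall_zero_iff]
    exact (norm_le_rootBound hQ (hroot z hzH)).trans hz.le
  obtain ⟨l, -, hl⟩ := (isCompact_closedBall (0 : ℂ) (rootBound Q x + 1)).exists_mapClusterPt_of_frequently
    hbdd.frequently
  refine ⟨l, ?_⟩
  rw [Metric.tendsto_nhds]
  by_contra! hcon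
  obtain ⟨ε₀, hε₀, hcon⟩ := hcon
  -- a radius between `0` and `ε₀` that is not the distance of a root from `l`
  obtain ⟨ε, ⟨hε1, hε2⟩, hε3⟩ : (Set.Ioo 0 ε₀ \ (fun w => dist w l) ''
      {w | Q.evalEval x w = 0}).Nonempty :=
    ((Set.Ioo_infinite hε₀).sdiff (hfin.image _)).nonempty
  have hsphere : ∃ᶠ z in 𝓝[H] x, v z ∈ Metric.sphere l ε := by
    rw [(nhdsWithin_hasBasis Metric.nhds_basis_ball H).frequently_iff]
    intro δ hδ
    have hmem : Metric.ball x δ ∩ H ∈ 𝓝[H] x :=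
      inter_mem (mem_nhdsWithin_of_mem_nhds (Metric.ball_mem_nhds x hδ)) self_mem_nhdsWithin
    obtain ⟨z₁, hz₁, hz₁'⟩ := (hcon.and_eventually hmem).exists
    obtain ⟨z₂, hz₂, hz₂'⟩ :=
      ((mapClusterPt_iff_frequently.1 hl _ (Metric.ball_mem_nhds l hε1)).and_eventually hmem).exists
    have hpre : IsPreconnected (Metric.ball x δ ∩ H) :=
      ((convex_ball x δ).inter hH).isPreconnected
    have hcont : ContinuousOn (fun z => dist (v z) l) (Metric.ball x δ ∩ H) :=
      continuous_dist.comp_continuousOn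
        ((hv.mono Set.inter_subset_right).prodMk continuousOn_const)
    obtain ⟨z, hz, hz'⟩ := hpre.intermediate_value hz₂' hz₁' hcont
      ⟨(Metric.mem_ball.1 hz₂).le, hε2.le.trans hz₁⟩
    exact ⟨z, hz, hz'⟩
  obtain ⟨w, hw, hw'⟩ := (isCompact_sphere l ε).exists_mapClusterPt_of_frequently hsphere
  exact hε3 ⟨w, hcl w hw', hw⟩

/-- Boundary values that exist everywhere on `S` exist locally uniformly. -/
theorem hasBoundaryValuesOn_of_tendsto {f : ℂ → ℂ} {S : Set ℝ}
    (h : ∀ x ∈ S, ∃ l, Tendsto f (𝓝[{z | 0 < z.im}] (x : ℂ)) (𝓝 l)) :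
    HasBoundaryValuesOn f S := by
  classical
  choose! l hl using h
  refine ⟨fun x => (l x : OnePoint ℂ), fun L hLS hL => ?_⟩
  let _ : UniformSpace (OnePoint ℂ) := uniformSpaceOfCompactR1
  have hl' : ∀ x ∈ S, Tendsto (fun z => (f z : OnePoint ℂ)) (𝓝[{z | 0 < z.im}] (x : ℂ))
      (𝓝 (l x : OnePoint ℂ)) := fun x hx =>
    (OnePoint.continuous_coe.tendsto (l x)).comp (hl x hx)
  have hne : ∀ x : ℝ, (𝓝[{z : ℂ | 0 < z.im}] (x : ℂ)).NeBot := by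
    intro x
    rw [← mem_closure_iff_nhdsWithin_neBot, Complex.closure_setOfPred_lt_im]
    simp
  change TendstoUniformlyOn _ _ _ _
  rw [← tendstoLocallyUniformlyOn_iff_tendstoUniformlyOn_of_compact hL]
  intro u hu x₀ hx₀
  obtain ⟨t, ht, htsymm, htu⟩ := comp_symm_mem_uniformity_sets hu
  obtain ⟨s, hs, hssymm, hst⟩ := comp_symm_mem_uniformity_sets ht
  have h1 : ∀ᶠ z in 𝓝[{z : ℂ | 0 < z.im}] (x₀ : ℂ), ((l x₀ : OnePoint ℂ), (f z : OnePoint ℂ)) ∈ s :=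
    hl' x₀ (hLS hx₀) (UniformSpace.ball_mem_nhds _ hs)
  obtain ⟨δ, hδ, hδs⟩ := (nhdsWithin_hasBasis Metric.nhds_basis_ball _).eventually_iff.1 h1
  have hball : ∀ x : ℝ, dist x x₀ < δ / 2 → ∀ᶠ z in 𝓝[{z : ℂ | 0 < z.im}] (x : ℂ),
      ((l x₀ : OnePoint ℂ), (f z : OnePoint ℂ)) ∈ s := by
    intro x hx
    have h2 : ∀ᶠ z in 𝓝[{z : ℂ | 0 < z.im}] (x : ℂ), z ∈ Metric.ball (x : ℂ) (δ / 2) :=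
      mem_nhdsWithin_of_mem_nhds (Metric.ball_mem_nhds _ (half_pos hδ))
    filter_upwards [h2, self_mem_nhdsWithin] with z hz hzH
    refine hδs ⟨?_, hzH⟩
    have h3 : dist (x : ℂ) x₀ < δ / 2 := by
      rw [Complex.dist_eq, ← Complex.ofReal_sub, Complex.norm_real]
      exact hx
    rw [Metric.mem_ball] at hz ⊢
    linarith [dist_triangle z x x₀]
  refine ⟨Metric.ball x₀ (δ / 2) ∩ L, inter_mem (mem_nhdsWithin_of_mem_nhds
    (Metric.ball_mem_nhds _ (half_pos hδ))) self_mem_nhdsWithin, ?_⟩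
  filter_upwards [Ioo_mem_nhdsGT (half_pos hδ)] with ε hε x hx
  have hpos : x + ε * Complex.I ∈ {z : ℂ | 0 < z.im} := by simpa using hε.1
  have h4 : ((l x₀ : OnePoint ℂ), (f (x + ε * Complex.I) : OnePoint ℂ)) ∈ s := by
    refine hδs ⟨?_, hpos⟩
    have h5 : dist (x : ℂ) x₀ < δ / 2 := by
      rw [Complex.dist_eq, ← Complex.ofReal_sub, Complex.norm_real]
      exact hx.1
    have h6 : dist (x + ε * Complex.I : ℂ) x < δ / 2 := by
      rw [dist_eq_norm, add_sub_cancel_left, norm_mul, Complex.norm_I, mul_one, Complex.norm_real,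
        Real.norm_eq_abs, abs_of_pos hε.1]
      exact hε.2
    rw [Metric.mem_ball]
    linarith [dist_triangle (x + ε * Complex.I : ℂ) x x₀]
  have h7 : ∀ᶠ z in 𝓝[{z : ℂ | 0 < z.im}] (x : ℂ), ((l x : OnePoint ℂ), (f z : OnePoint ℂ)) ∈ s :=
    hl' x (hLS hx.2) (UniformSpace.ball_mem_nhds _ hs)
  obtain ⟨z, hz1, hz2⟩ := (h7.and (hball x hx.1)).exists
  have h8 : ((l x : OnePoint ℂ), (l x₀ : OnePoint ℂ)) ∈ t :=
    hst ⟨(f z : OnePoint ℂ), hz1, hssymm.symm _ _ hz2⟩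
  refine htu ⟨(l x₀ : OnePoint ℂ), h8, hst ⟨(l x₀ : OnePoint ℂ), ?_, h4⟩⟩
  exact refl_mem_uniformity hs

/-- An analytic algebraic function on a domain that contains the upper half plane has boundary
values, apart from finitely many points. -/
theorem IsAlgebraicFunctionOn.exists_hasBoundaryValuesOn {f : ℂ → ℂ} {Ω : Set ℂ}
    (h : IsAlgebraicFunctionOn f Ω) (hc : IsPreconnected Ω) (ho : IsOpen Ω)
    (hf : AnalyticOnNhd ℂ f Ω) (hΩ : {z : ℂ | 0 < z.im} ⊆ Ω) :
    ∃ F : Set ℝ, F.Finite ∧ HasBoundaryValuesOn f Fᶜ := by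
  obtain ⟨c, Q, -, -, -, hc0, hQ, -, -, hroot⟩ :=
    h.exists_monic_separable hc ho ⟨Complex.I, hΩ (by simp)⟩ hf
  refine ⟨{x : ℝ | c.IsRoot x}, (finite_setOfPred_isRoot hc0).preimage
    Complex.ofReal_injective.injOn, hasBoundaryValuesOn_of_tendsto fun x hx => ?_⟩
  have hx' : c.eval (x : ℂ) ≠ 0 := hx
  have hcont : ContinuousOn (fun z => c.eval z * f z) {z : ℂ | 0 < z.im} :=
    c.continuous.continuousOn.mul (hf.continuousOn.mono hΩ)
  obtain ⟨l, hl⟩ := exists_tendsto_of_evalEval_eq_zero hQ (convex_halfSpace_im_gt 0) hcont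
    (fun z hz => hroot z (hΩ hz)) (x := x) (by rw [Complex.closure_setOfPred_lt_im]; simp)
  have hcx : Tendsto (fun z => c.eval z) (𝓝[{z : ℂ | 0 < z.im}] (x : ℂ)) (𝓝 (c.eval (x : ℂ))) :=
    (c.continuous.tendsto _).mono_left inf_le_left
  refine ⟨l / c.eval (x : ℂ), (hl.div hcx hx').congr' ?_⟩
  filter_upwards [hcx.eventually_ne hx'] with z hz
  exact mul_div_cancel_left₀ (f z) hz

end JacobiTree

namespace JacobiTree

/-! ### Finite coverings of the punctured plane and their ends -/

/-- A finite unbranched covering `proj` of the plane punctured at finitely many points, together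
with a radius that is so small that the discs of this radius about the punctures and the
neighbourhood `‖z‖ > radius⁻¹` of infinity are disjoint. Finiteness is expressed by properness. -/
structure PuncturedCover (X : Type*) [TopologicalSpace X] where
  proj : X → ℂ
  punctures : Finset ℂ
  radius : ℝ
  radius_pos : 0 < radius
  isLocalHomeomorph : IsLocalHomeomorph proj
  proj_notMem : ∀ x, proj x ∉ punctures
  isCompact_preimage : ∀ K : Set ℂ, IsCompact K → (∀ z ∈ K, z ∉ punctures) →
    IsCompact (proj ⁻¹' K)
  two_radius_le : ∀ s ∈ punctures, ∀ t ∈ punctures, s ≠ t → 2 * radius ≤ dist s t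
  norm_add_radius_le : ∀ s ∈ punctures, ‖s‖ + radius ≤ radius⁻¹

namespace PuncturedCover

/-- The open left half-plane, which `Complex.exp` maps onto the punctured unit disc. -/
def leftHalfPlane : Set ℂ := {ζ | ζ.re < 0}

theorem convex_leftHalfPlane : Convex ℝ leftHalfPlane := convex_halfSpace_re_lt 0

theorem isOpen_leftHalfPlane : IsOpen leftHalfPlane :=
  isOpen_lt Complex.continuous_re continuous_const

theorem neg_one_mem_leftHalfPlane : (-1 : ℂ) ∈ leftHalfPlane := by
  simp [leftHalfPlane]

theorem add_mem_leftHalfPlane (m : ℤ) {ζ : ℂ} :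
    ζ + m * (2 * Real.pi * Complex.I) ∈ leftHalfPlane ↔ ζ ∈ leftHalfPlane := by
  simp [leftHalfPlane]

theorem norm_exp_lt_one {ζ : ℂ} : ‖Complex.exp ζ‖ < 1 ↔ ζ ∈ leftHalfPlane := by
  simp [Complex.norm_exp, leftHalfPlane]

theorem log_mem_leftHalfPlane {u : ℂ} (h0 : u ≠ 0) (h1 : ‖u‖ < 1) :
    Complex.log u ∈ leftHalfPlane := by
  rwa [← norm_exp_lt_one, Complex.exp_log h0]

variable {X : Type*} [TopologicalSpace X] (C : PuncturedCover X)

/-- The local coordinate discs about the punctures (`some s`) and about infinity (`none`). -/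
noncomputable def coord : Option C.punctures → ℂ → ℂ
  | some s, u => s + C.radius * u
  | none, u => (C.radius * u)⁻¹

/-- The coordinate discs as maps into the sphere. -/
noncomputable def sphereCoord : Option C.punctures → ℂ → OnePoint ℂ
  | some s, u => ((s + C.radius * u : ℂ) : OnePoint ℂ)
  | none, u => if u = 0 then OnePoint.infty else (((C.radius * u)⁻¹ : ℂ) : OnePoint ℂ)

theorem radius_ne_zero : (C.radius : ℂ) ≠ 0 := by exact_mod_cast C.radius_pos.ne'

theorem norm_radius_mul (u : ℂ) : ‖(C.radius : ℂ) * u‖ = C.radius * ‖u‖ := by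
  simp [abs_of_pos C.radius_pos]

theorem sphereCoord_of_ne_zero (s : Option C.punctures) {u : ℂ} (hu : u ≠ 0) :
    C.sphereCoord s u = (C.coord s u : OnePoint ℂ) := by
  cases s <;> simp [sphereCoord, coord, hu]

theorem coord_eq_coord {s s' : Option C.punctures} {u u' : ℂ} (h0 : u ≠ 0) (h1 : ‖u‖ < 1)
    (h0' : u' ≠ 0) (h1' : ‖u'‖ < 1) (h : C.coord s u = C.coord s' u') : s = s' ∧ u = u' := by
  have hr := C.radius_pos
  -- the discs about the punctures are disjoint from the one about infinity
  have key : ∀ (s : C.punctures) (u v : ℂ), ‖u‖ < 1 → v ≠ 0 → ‖v‖ < 1 →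
      (s : ℂ) + C.radius * u ≠ (C.radius * v)⁻¹ := by
    intro s u v hu hv0 hv h
    have h1 : ‖(s : ℂ) + C.radius * u‖ < C.radius⁻¹ := by
      refine lt_of_lt_of_le ?_ (C.norm_add_radius_le s s.2)
      refine (norm_add_le _ _).trans_lt ?_
      rw [norm_radius_mul]
      nlinarith
    have h2 : C.radius⁻¹ < ‖(C.radius * v)⁻¹‖ := by
      rw [norm_inv, norm_radius_mul]
      have hv' : 0 < ‖v‖ := norm_pos_iff.2 hv0
      gcongr
      nlinarith
    rw [h] at h1
    exact lt_asymm h1 h2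
  cases s with
  | none =>
    cases s' with
    | none =>
      refine ⟨rfl, ?_⟩
      have := inv_injective h
      exact mul_left_cancel₀ C.radius_ne_zero this
    | some s' => exact absurd h.symm (key s' u' u h1' h0 h1)
  | some s =>
    cases s' with
    | none => exact absurd h (key s u u' h1 h0' h1')
    | some s' =>
      have hs : s = s' := by
        by_contra hne
        have h2 := C.two_radius_le s s.2 s' s'.2 fun h => hne (Subtype.ext h)
        have h3 : (s : ℂ) - s' = C.radius * u' - C.radius * u := by
          simp only [coord] at h
          linear_combination h
        have h4 := norm_sub_le ((C.radius : ℂ) * u') (C.radius * u)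
        rw [dist_eq_norm, h3] at h2
        rw [norm_radius_mul, norm_radius_mul] at h4
        nlinarith
      subst hs
      exact ⟨rfl, mul_left_cancel₀ C.radius_ne_zero (add_left_cancel h)⟩

theorem coord_notMem (s : Option C.punctures) {u : ℂ} (h0 : u ≠ 0) (h1 : ‖u‖ < 1) :
    C.coord s u ∉ C.punctures := by
  have hr := C.radius_pos
  intro hm
  cases s with
  | none =>
    have h2 : C.radius⁻¹ < ‖(C.radius * u)⁻¹‖ := by
      rw [norm_inv, norm_radius_mul]
      have hv' : 0 < ‖u‖ := norm_pos_iff.2 h0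
      gcongr
      nlinarith
    have := C.norm_add_radius_le _ hm
    simp only [coord] at this
    linarith
  | some s =>
    have hne : C.coord (some s) u ≠ s := by
      simp [coord, C.radius_ne_zero, h0]
    have := C.two_radius_le _ hm s s.2 hne
    simp only [coord, dist_eq_norm, add_sub_cancel_left, norm_radius_mul] at this
    nlinarith

theorem hasDerivAt_coord (s : Option C.punctures) {u : ℂ} (h0 : u ≠ 0) :
    ∃ c ≠ 0, HasDerivAt (C.coord s) c u := by
  have h1 : HasDerivAt (fun u : ℂ => (C.radius : ℂ) * u) C.radius u := by
    simpa using (hasDerivAt_id u).const_mul (C.radius : ℂ)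
  cases s with
  | none =>
    refine ⟨_, ?_, h1.inv (mul_ne_zero C.radius_ne_zero h0)⟩
    exact div_ne_zero (neg_ne_zero.2 C.radius_ne_zero)
      (pow_ne_zero _ (mul_ne_zero C.radius_ne_zero h0))
  | some s => exact ⟨_, C.radius_ne_zero, h1.const_add (s : ℂ)⟩

theorem continuousOn_coord (s : Option C.punctures) : ContinuousOn (C.coord s) {0}ᶜ := by
  intro u hu
  obtain ⟨c, -, hc⟩ := C.hasDerivAt_coord s hu
  exact hc.continuousAt.continuousWithinAt

theorem continuousAt_sphereCoord_zero (s : Option C.punctures) :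
    ContinuousAt (C.sphereCoord s) 0 := by
  cases s with
  | some s =>
    have : Continuous fun u : ℂ => (s : ℂ) + C.radius * u := by fun_prop
    exact (OnePoint.continuous_coe.comp this).continuousAt
  | none =>
    have h1 : Tendsto (fun u : ℂ => (C.radius * u)⁻¹) (𝓝[≠] 0) (Bornology.cobounded ℂ) := by
      refine tendsto_inv₀_nhdsNE_zero.comp ?_
      refine tendsto_nhdsWithin_iff.2 ⟨?_, ?_⟩
      · have : Continuous fun u : ℂ => (C.radius : ℂ) * u := by fun_prop
        simpa using (this.tendsto 0).mono_left nhdsWithin_le_nhds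
      · filter_upwards [self_mem_nhdsWithin] with u hu
        exact mul_ne_zero C.radius_ne_zero hu
    rw [continuousAt_iff_punctured_nhds]
    have h2 : C.sphereCoord none 0 = OnePoint.infty := by simp [sphereCoord]
    rw [h2]
    have h3 : Tendsto (fun z : ℂ => (z : OnePoint ℂ)) (Bornology.cobounded ℂ)
        (𝓝 OnePoint.infty) := by
      rw [Metric.cobounded_eq_cocompact, ← Filter.coclosedCompact_eq_cocompact]
      exact OnePoint.tendsto_coe_infty
    refine (h3.comp h1).congr' ?_
    filter_upwards [self_mem_nhdsWithin] with u hu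
    exact (C.sphereCoord_of_ne_zero none hu).symm

/-- A compact part of the punctured plane, whose complement is covered by coordinate discs. -/
def core : Set ℂ :=
  {z | ‖z‖ ≤ 2 * C.radius⁻¹ ∧ ∀ s ∈ C.punctures, C.radius / 2 ≤ ‖z - s‖}

theorem isCompact_core : IsCompact C.core := by
  refine Metric.isCompact_of_isClosed_isBounded ?_ ?_
  · simp only [core, Set.ofPred_and, Set.ofPred_forall]
    refine (isClosed_le continuous_norm continuous_const).inter ?_
    exact isClosed_iInter fun s => isClosed_iInter fun _ =>
      isClosed_le continuous_const (by fun_prop)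
  · refine (Metric.isBounded_closedBall (x := (0 : ℂ)) (r := 2 * C.radius⁻¹)).subset ?_
    intro z hz
    simpa using hz.1

theorem core_notMem {z : ℂ} (hz : z ∈ C.core) : z ∉ C.punctures := by
  intro h
  have := hz.2 z h
  simp only [sub_self, norm_zero] at this
  linarith [C.radius_pos]

theorem mem_core_or {z : ℂ} (hz : z ∉ C.punctures) :
    z ∈ C.core ∨ ∃ s u, u ≠ 0 ∧ ‖u‖ ≤ 1 / 2 ∧ C.coord s u = z := by
  have hr := C.radius_pos
  by_cases h : z ∈ C.core
  · exact Or.inl h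
  right
  simp only [core, Set.mem_ofPred_eq, not_and_or, not_le, not_forall] at h
  rcases h with h | ⟨s, hs, h⟩
  · have hz0 : z ≠ 0 := by
      rintro rfl
      have : 0 < C.radius⁻¹ := inv_pos.2 hr
      simp only [norm_zero] at h
      linarith
    refine ⟨none, (C.radius * z)⁻¹, inv_ne_zero (mul_ne_zero C.radius_ne_zero hz0), ?_, ?_⟩
    · rw [norm_inv, norm_radius_mul]
      have : 2 < C.radius * ‖z‖ := by
        have := mul_lt_mul_of_pos_left h hr
        rwa [mul_left_comm, mul_inv_cancel₀ hr.ne', mul_one] at this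
      rw [one_div]
      gcongr
    · have := C.radius_ne_zero
      simp only [coord]
      field_simp
  · refine ⟨some ⟨s, hs⟩, (z - s) / C.radius, ?_, ?_, ?_⟩
    · refine div_ne_zero (sub_ne_zero.2 ?_) C.radius_ne_zero
      rintro rfl
      exact hz hs
    · rw [norm_div, Complex.norm_real, Real.norm_of_nonneg hr.le, div_le_iff₀ hr]
      linarith
    · have := C.radius_ne_zero
      simp only [coord]
      field_simp
      ring

/-! ### The covering property and lifts -/

theorem continuous_proj : Continuous C.proj := C.isLocalHomeomorph.continuous

variable [T2Space X]

theorem finite_fiber (z : ℂ) : (C.proj ⁻¹' {z}).Finite := by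
  by_cases hz : z ∈ C.punctures
  · rw [Set.preimage_singleton_eq_empty.2]
    · exact Set.finite_empty
    · rintro ⟨x, rfl⟩
      exact C.proj_notMem x hz
  · have hc := C.isCompact_preimage {z} isCompact_singleton (by simpa using hz)
    refine hc.induction_on (p := Set.Finite) Set.finite_empty (fun _ _ h1 h2 => h2.subset h1)
      (fun _ _ h1 h2 => h1.union h2) fun x _ => ?_
    obtain ⟨U, hU, hxU, hinj⟩ := C.isLocalHomeomorph.isLocallyInjective x
    refine ⟨U ∩ C.proj ⁻¹' {z}, ?_, Set.Subsingleton.finite ?_⟩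
    · exact inter_mem (nhdsWithin_le_nhds (hU.mem_nhds hxU)) self_mem_nhdsWithin
    · rintro y ⟨hy, hy'⟩ y' ⟨hy2, hy2'⟩
      exact hinj hy hy2 (hy'.trans hy2'.symm)

/-- A proper local homeomorphism is a covering map. -/
theorem isCoveringMapOn : IsCoveringMapOn C.proj {z | z ∉ C.punctures} := by
  have hS : IsOpen {z | z ∉ C.punctures} := C.punctures.finite_toSet.isClosed.isOpen_compl
  refine IsCoveringMapOn.of_isCoveringMap_subtype hS C.proj_notMem ?_
  rw [isCoveringMap_iff_isCoveringMapOn_univ]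
  have : LocallyCompactSpace {z | z ∉ C.punctures} := hS.locallyCompactSpace
  have hcont : Continuous fun x => (⟨C.proj x, C.proj_notMem x⟩ : {z | z ∉ C.punctures}) :=
    C.continuous_proj.subtype_mk _
  refine IsClosedMap.isCoveringMapOn_of_isLocalHomeomorphOn ?_ ?_ ?_
  · refine IsProperMap.isClosedMap (isProperMap_iff_isCompact_preimage.2 ⟨hcont, fun K hK => ?_⟩)
    have h := C.isCompact_preimage _ (hK.image continuous_subtype_val)
      (by rintro _ ⟨z, -, rfl⟩; exact z.2)
    convert h using 1
    ext x
    simp [C.proj_notMem x]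
  · intro z _
    refine (C.finite_fiber z).subset fun x hx => ?_
    exact congrArg Subtype.val hx
  · rw [Set.preimage_univ, ← isLocalHomeomorph_iff_isLocalHomeomorphOn_univ]
    exact IsLocalHomeomorph.of_comp (g := (Subtype.val : {z | z ∉ C.punctures} → ℂ))
      C.isLocalHomeomorph hS.isOpenEmbedding_subtypeVal.isLocalHomeomorph hcont

/-- A lift of `coord s ∘ exp` to the covering surface. -/
structure IsLift (s : Option C.punctures) (L : ℂ → X) : Prop where
  continuousOn : ContinuousOn L leftHalfPlane
  proj_apply : ∀ ζ ∈ leftHalfPlane, C.proj (L ζ) = C.coord s (Complex.exp ζ)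

variable {C} {s : Option C.punctures} {L L' : ℂ → X}

theorem IsLift.eqOn (h : C.IsLift s L) (h' : C.IsLift s L') {ζ : ℂ} (hζ : ζ ∈ leftHalfPlane)
    (heq : L ζ = L' ζ) : Set.EqOn L L' leftHalfPlane :=
  (T2Space.isSeparatedMap C.proj).eqOn_of_comp_eqOn C.isLocalHomeomorph.isLocallyInjective
    convex_leftHalfPlane.isPreconnected h.continuousOn h'.continuousOn
    (fun ζ hζ => (h.proj_apply ζ hζ).trans (h'.proj_apply ζ hζ).symm) hζ heq

theorem IsLift.shift (h : C.IsLift s L) (m : ℤ) :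
    C.IsLift s fun ζ => L (ζ + m * (2 * Real.pi * Complex.I)) where
  continuousOn := h.continuousOn.comp (by fun_prop) fun _ hζ => (add_mem_leftHalfPlane m).2 hζ
  proj_apply ζ hζ := by
    rw [h.proj_apply _ ((add_mem_leftHalfPlane m).2 hζ), Complex.exp_add,
      Complex.exp_int_mul_two_pi_mul_I, mul_one]

theorem exists_isLift {x : X} {ζ₀ : ℂ} (hζ₀ : ζ₀ ∈ leftHalfPlane)
    (hx : C.proj x = C.coord s (Complex.exp ζ₀)) : ∃ L, C.IsLift s L ∧ L ζ₀ = x := by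
  classical
  have h1 : ContractibleSpace leftHalfPlane :=
    convex_leftHalfPlane.contractibleSpace ⟨ζ₀, hζ₀⟩
  have h2 : LocallyPathConnectedSpace leftHalfPlane :=
    isOpen_leftHalfPlane.locallyPathConnectedSpace
  have hf : Continuous fun ζ : leftHalfPlane => C.coord s (Complex.exp ζ) :=
    (C.continuousOn_coord s).comp_continuous (by fun_prop) fun ζ => Complex.exp_ne_zero _
  obtain ⟨F, ⟨hF0, hF⟩, -⟩ := C.isCoveringMapOn.existsUnique_continuousMap_lifts ⟨_, hf⟩
    (a₀ := ⟨ζ₀, hζ₀⟩) (e₀ := x) hx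
    fun ζ => C.coord_notMem s (Complex.exp_ne_zero _) (norm_exp_lt_one.2 ζ.2)
  refine ⟨fun ζ => if h : ζ ∈ leftHalfPlane then F ⟨ζ, h⟩ else x, ⟨?_, ?_⟩, ?_⟩
  · rw [continuousOn_iff_continuous_domRestrict]
    convert F.continuous using 1
    ext ζ
    simp
  · intro ζ hζ
    simp only [hζ, dif_pos]
    exact congrFun hF ⟨ζ, hζ⟩
  · simp [hζ₀, hF0]

variable (C) in
/-- The ends of the covering surface, i.e. the components of the preimage of the coordinate discs,
each being the range of a lift. -/
def Ends : Type _ := {c : Set X // ∃ s L, C.IsLift s L ∧ c = L '' leftHalfPlane}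

namespace Ends

/-- The puncture, or infinity, at which the end lies. -/
noncomputable def puncture (e : C.Ends) : Option C.punctures := e.2.choose

/-- A parametrization of the end by a half-plane. -/
noncomputable def lift (e : C.Ends) : ℂ → X := e.2.choose_spec.choose

theorem isLift (e : C.Ends) : C.IsLift e.puncture e.lift := e.2.choose_spec.choose_spec.1

theorem val_eq (e : C.Ends) : e.1 = e.lift '' leftHalfPlane := e.2.choose_spec.choose_spec.2

theorem lift_mem (e : C.Ends) {ζ : ℂ} (hζ : ζ ∈ leftHalfPlane) : e.lift ζ ∈ e.1 :=
  e.val_eq ▸ Set.mem_image_of_mem _ hζ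

/-- Two lifts with a common point in their ranges agree up to a deck transformation of `exp`. -/
theorem eq_shift (e : C.Ends) (h : C.IsLift s L) {ζ : ℂ} (hζ : ζ ∈ leftHalfPlane)
    (hm : L ζ ∈ e.1) : s = e.puncture ∧ ∃ m : ℤ,
      Set.EqOn L (fun ζ => e.lift (ζ + m * (2 * Real.pi * Complex.I))) leftHalfPlane := by
  rw [e.val_eq] at hm
  obtain ⟨ζ', hζ', heq⟩ := hm
  have h1 : C.coord s (Complex.exp ζ) = C.coord e.puncture (Complex.exp ζ') := by
    rw [← h.proj_apply ζ hζ, ← e.isLift.proj_apply ζ' hζ', heq]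
  obtain ⟨rfl, h2⟩ := C.coord_eq_coord (Complex.exp_ne_zero _) (norm_exp_lt_one.2 hζ)
    (Complex.exp_ne_zero _) (norm_exp_lt_one.2 hζ') h1
  obtain ⟨m, hm⟩ := Complex.exp_eq_exp_iff_exists_int.1 h2.symm
  exact ⟨rfl, m, h.eqOn (e.isLift.shift m) hζ (by rw [← heq, hm])⟩

theorem val_eq_image (e : C.Ends) (h : C.IsLift s L) {ζ : ℂ} (hζ : ζ ∈ leftHalfPlane)
    (hm : L ζ ∈ e.1) : e.1 = L '' leftHalfPlane := by
  obtain ⟨-, m, hL⟩ := e.eq_shift h hζ hm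
  rw [e.val_eq, hL.image_eq]
  ext x
  constructor
  · rintro ⟨ζ, hζ, rfl⟩
    exact ⟨ζ + (-m : ℤ) * (2 * Real.pi * Complex.I), (add_mem_leftHalfPlane _).2 hζ, by simp⟩
  · rintro ⟨ζ, hζ, rfl⟩
    exact ⟨_, (add_mem_leftHalfPlane m).2 hζ, rfl⟩

theorem eq_of_mem {e e' : C.Ends} {x : X} (h : x ∈ e.1) (h' : x ∈ e'.1) : e = e' := by
  have h1 := h
  rw [e.val_eq] at h1
  obtain ⟨ζ, hζ, rfl⟩ := h1
  exact Subtype.ext (e.val_eq.trans (e'.val_eq_image e.isLift hζ h').symm)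

/-- The end containing the range of a given lift. -/
def ofLift (h : C.IsLift s L) : C.Ends := ⟨L '' leftHalfPlane, s, L, h, rfl⟩

theorem puncture_ofLift (h : C.IsLift s L) : (ofLift h).puncture = s :=
  ((ofLift h).eq_shift h neg_one_mem_leftHalfPlane
    (Set.mem_image_of_mem _ neg_one_mem_leftHalfPlane)).1.symm

/-- Together with `mapsTo_lift`: at each puncture, there are at most as many ends as sheets. -/
theorem lift_injOn (s : Option C.punctures) :
    Set.InjOn (fun e : C.Ends => e.lift (-1)) {e | e.puncture = s} := fun e _ e' _ h => by
  refine eq_of_mem (e.lift_mem neg_one_mem_leftHalfPlane) ?_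
  rw [show e.lift (-1) = e'.lift (-1) from h]
  exact e'.lift_mem neg_one_mem_leftHalfPlane

theorem mapsTo_lift (s : Option C.punctures) :
    Set.MapsTo (fun e : C.Ends => e.lift (-1)) {e | e.puncture = s}
      (C.proj ⁻¹' {C.coord s (Complex.exp (-1))}) := by
  rintro e rfl
  exact e.isLift.proj_apply _ neg_one_mem_leftHalfPlane

instance : Finite C.Ends := by
  rw [← Set.finite_univ_iff]
  have : (Set.univ : Set C.Ends) = ⋃ s : Option C.punctures, {e | e.puncture = s} := by
    ext e
    simp
  rw [this]
  exact Set.finite_iUnion fun s =>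
    Set.Finite.of_injOn (mapsTo_lift s) (lift_injOn s) (C.finite_fiber _)

/-- By the pigeonhole principle, as the fibre over `coord _ (exp (-1))` is finite. -/
theorem exists_period (e : C.Ends) : ∃ k : ℕ, 0 < k ∧
    ∀ ζ ∈ leftHalfPlane, e.lift (ζ + k * (2 * Real.pi * Complex.I)) = e.lift ζ := by
  obtain ⟨i, -, j, -, hij, h⟩ := Set.infinite_univ.exists_lt_map_eq_of_mapsTo
    (f := fun j : ℕ => e.lift (-1 + (j : ℤ) * (2 * Real.pi * Complex.I)))
    (t := C.proj ⁻¹' {C.coord e.puncture (Complex.exp (-1))})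
    (fun j _ => (e.isLift.shift j).proj_apply _ neg_one_mem_leftHalfPlane) (C.finite_fiber _)
  refine ⟨j - i, by omega, fun ζ hζ => ?_⟩
  have h1 := (e.isLift.shift i).eqOn (e.isLift.shift j) neg_one_mem_leftHalfPlane h
    ((add_mem_leftHalfPlane (-i : ℤ)).2 hζ)
  push_cast [hij.le] at h1 ⊢
  convert h1.symm using 2 <;> ring

open Classical in
/-- The number of sheets of the covering at an end. -/
noncomputable def order (e : C.Ends) : ℕ := Nat.find e.exists_period

theorem order_pos (e : C.Ends) : 0 < e.order := by
  classical exact (Nat.find_spec e.exists_period).1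

theorem lift_add_mul (e : C.Ends) (j : ℤ) {ζ : ℂ} (hζ : ζ ∈ leftHalfPlane) :
    e.lift (ζ + (e.order * j : ℤ) * (2 * Real.pi * Complex.I)) = e.lift ζ := by
  classical
  have key : ∀ ζ ∈ leftHalfPlane, e.lift (ζ + (e.order : ℤ) * (2 * Real.pi * Complex.I))
      = e.lift ζ := fun ζ hζ => by
    simpa only [order, Int.cast_natCast] using (Nat.find_spec e.exists_period).2 ζ hζ
  induction j with
  | zero => simp
  | succ j ih =>
    rw [← ih, ← key (ζ + (e.order * j : ℤ) * _) ((add_mem_leftHalfPlane _).2 hζ)]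
    congr 1
    push_cast
    ring
  | pred j ih =>
    rw [← ih, ← key (ζ + _ * _) ((add_mem_leftHalfPlane _).2 hζ)]
    congr 1
    push_cast
    ring

theorem lift_eq_lift (e : C.Ends) {ζ ζ' : ℂ} (hζ : ζ ∈ leftHalfPlane) (hζ' : ζ' ∈ leftHalfPlane)
    (h : e.lift ζ = e.lift ζ') :
    ∃ j : ℤ, ζ = ζ' + (e.order * j : ℤ) * (2 * Real.pi * Complex.I) := by
  classical
  have h1 : C.coord e.puncture (Complex.exp ζ) = C.coord e.puncture (Complex.exp ζ') := by
    rw [← e.isLift.proj_apply ζ hζ, ← e.isLift.proj_apply ζ' hζ', h]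
  obtain ⟨m, hm⟩ := Complex.exp_eq_exp_iff_exists_int.1 (C.coord_eq_coord (Complex.exp_ne_zero _)
    (norm_exp_lt_one.2 hζ) (Complex.exp_ne_zero _) (norm_exp_lt_one.2 hζ') h1).2
  -- By minimality of the order, the remainder of `m` modulo the order vanishes.
  have hpos : (0 : ℤ) < e.order := by exact_mod_cast e.order_pos
  have hr0 := Int.emod_nonneg m hpos.ne'
  have hr1 := Int.emod_lt_of_pos m hpos
  obtain ⟨r, hr⟩ := Int.eq_ofNat_of_zero_le hr0
  have hdm := Int.emod_add_mul_ediv m e.order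
  have hr' : r = 0 := by
    by_contra hne
    refine Nat.find_min e.exists_period (m := r) (by rw [← order]; omega)
      ⟨Nat.pos_of_ne_zero hne, fun ξ hξ => ?_⟩
    have h2 : e.lift (ζ' + (m : ℂ) * (2 * Real.pi * Complex.I)) = e.lift ζ' := by rw [← hm, h]
    have h3 := (e.isLift.shift m).eqOn e.isLift hζ' h2 hξ
    rw [← e.lift_add_mul (m / e.order) (by exact_mod_cast (add_mem_leftHalfPlane r).2 hξ), ← h3]
    congr 1
    have hm' : (m : ℂ) = r + e.order * (m / e.order : ℤ) := by
      rw [hr] at hdm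
      exact_mod_cast hdm.symm
    rw [hm']
    push_cast
    ring
  refine ⟨m / e.order, ?_⟩
  rw [hm, show (e.order : ℤ) * (m / e.order) = m by rw [hr, hr'] at hdm; simpa using hdm]

end Ends

end PuncturedCover
end JacobiTree

namespace JacobiTree
namespace PuncturedCover

/-! ### The compactification of a finite covering of the punctured plane -/

/-- The punctured open unit disc. -/
def puncturedDisc : Set ℂ := {t | t ≠ 0 ∧ ‖t‖ < 1}

theorem isOpen_puncturedDisc : IsOpen puncturedDisc :=
  isOpen_ne.inter (isOpen_lt continuous_norm continuous_const)

theorem eventually_mem_puncturedDisc : ∀ᶠ t in 𝓝[≠] (0 : ℂ), t ∈ puncturedDisc := by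
  filter_upwards [self_mem_nhdsWithin,
    nhdsWithin_le_nhds (Metric.ball_mem_nhds (0 : ℂ) one_pos)] with t h0 h1
  exact ⟨h0, by simpa using h1⟩

theorem pow_mem_puncturedDisc {t : ℂ} (ht : t ∈ puncturedDisc) {k : ℕ} (hk : 0 < k) :
    t ^ k ∈ puncturedDisc :=
  ⟨pow_ne_zero _ ht.1, by rw [norm_pow]; exact pow_lt_one₀ (norm_nonneg _) ht.2 hk.ne'⟩

variable {X : Type*} [TopologicalSpace X] [T2Space X] {C : PuncturedCover X}

namespace Ends

variable (e : C.Ends)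

/-- The parametrization of an end by the punctured disc, in terms of which the projection is
`t ↦ t ^ order`. -/
noncomputable def param (t : ℂ) : X := e.lift (e.order * Complex.log t)

theorem order_ne_zero : (e.order : ℂ) ≠ 0 := by exact_mod_cast e.order_pos.ne'

variable {e}

theorem exp_order_mul {t w : ℂ} (h : Complex.exp w = t) :
    Complex.exp (e.order * w) = t ^ e.order := by
  rw [Complex.exp_nat_mul, h]

theorem order_mul_mem {t w : ℂ} (ht : t ∈ puncturedDisc) (h : Complex.exp w = t) :
    e.order * w ∈ leftHalfPlane := by
  rw [← norm_exp_lt_one, exp_order_mul h]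
  exact (pow_mem_puncturedDisc ht e.order_pos).2

theorem param_eq {t w : ℂ} (ht : t ∈ puncturedDisc) (h : Complex.exp w = t) :
    e.param t = e.lift (e.order * w) := by
  have h1 : Complex.exp (Complex.log t) = Complex.exp w := by rw [Complex.exp_log ht.1, h]
  obtain ⟨m, hm⟩ := Complex.exp_eq_exp_iff_exists_int.1 h1
  rw [param, hm, ← e.lift_add_mul m (order_mul_mem ht h)]
  congr 1
  push_cast
  ring

theorem proj_param {t : ℂ} (ht : t ∈ puncturedDisc) :
    C.proj (e.param t) = C.coord e.puncture (t ^ e.order) := by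
  have h := Complex.exp_log ht.1
  rw [param, e.isLift.proj_apply _ (order_mul_mem ht h), exp_order_mul h]

theorem param_mem {t : ℂ} (ht : t ∈ puncturedDisc) : e.param t ∈ e.1 :=
  e.lift_mem (order_mul_mem ht (Complex.exp_log ht.1))

theorem injOn_param : Set.InjOn e.param puncturedDisc := by
  intro t ht t' ht' h
  obtain ⟨j, hj⟩ := e.lift_eq_lift (order_mul_mem ht (Complex.exp_log ht.1))
    (order_mul_mem ht' (Complex.exp_log ht'.1)) h
  have h1 : Complex.log t = Complex.log t' + j * (2 * Real.pi * Complex.I) := by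
    refine mul_left_cancel₀ e.order_ne_zero ?_
    rw [hj]
    push_cast
    ring
  rw [← Complex.exp_log ht.1, ← Complex.exp_log ht'.1, h1, Complex.exp_add,
    Complex.exp_int_mul_two_pi_mul_I, mul_one]

/-- A point that lies over `coord s u` is in the image of the parametrization of an end. -/
theorem exists_param_eq {x : X} {s : Option C.punctures} {u : ℂ} (hu : u ∈ puncturedDisc)
    (hx : C.proj x = C.coord s u) :
    ∃ e : C.Ends, e.puncture = s ∧ ∃ t ∈ puncturedDisc, t ^ e.order = u ∧ e.param t = x := by
  have hlog := Complex.exp_log hu.1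
  obtain ⟨L, hL, hLx⟩ := exists_isLift (log_mem_leftHalfPlane hu.1 hu.2) (hlog ▸ hx)
  have hm : x ∈ (ofLift hL).1 := ⟨_, log_mem_leftHalfPlane hu.1 hu.2, hLx⟩
  have hmem := hm
  rw [(ofLift hL).val_eq] at hm
  obtain ⟨ζ, hζ, rfl⟩ := hm
  have hs : (ofLift hL).puncture = s := puncture_ofLift hL
  generalize ofLift hL = e at *
  have hexp : Complex.exp ζ = u := by
    rw [e.isLift.proj_apply ζ hζ] at hx
    exact (C.coord_eq_coord (Complex.exp_ne_zero _) (norm_exp_lt_one.2 hζ) hu.1 hu.2 hx).2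
  have ht : Complex.exp (ζ / e.order) ∈ puncturedDisc := by
    refine ⟨Complex.exp_ne_zero _, norm_exp_lt_one.2 ?_⟩
    have hpos : (0 : ℝ) < e.order := by exact_mod_cast e.order_pos
    have : (ζ / e.order).re = ζ.re / e.order := Complex.div_natCast_re ζ e.order
    rw [leftHalfPlane, Set.mem_ofPred_eq, this]
    exact div_neg_of_neg_of_pos hζ hpos
  refine ⟨e, hs, Complex.exp (ζ / e.order), ht, ?_, ?_⟩
  · rw [← Complex.exp_nat_mul, mul_div_cancel₀ _ e.order_ne_zero, hexp]
  · rw [param_eq ht rfl, mul_div_cancel₀ _ e.order_ne_zero]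

theorem continuousOn_param : ContinuousOn e.param puncturedDisc := by
  intro t₀ ht₀
  have hpos : ∀ t ∈ puncturedDisc,
      Complex.exp (Complex.log t₀ + Complex.log (t / t₀)) = t := fun t ht => by
    rw [Complex.exp_add, Complex.exp_log ht₀.1, Complex.exp_log (div_ne_zero ht.1 ht₀.1),
      mul_div_cancel₀ _ ht₀.1]
  have h1 : ContinuousAt (fun t => (e.order : ℂ) * (Complex.log t₀ + Complex.log (t / t₀))) t₀ := by
    have : t₀ / t₀ ∈ Complex.slitPlane := by simp [div_self ht₀.1]
    fun_prop (disch := assumption)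
  have h2 : ContinuousAt e.lift (e.order * (Complex.log t₀ + Complex.log (t₀ / t₀))) :=
    e.isLift.continuousOn.continuousAt
      (isOpen_leftHalfPlane.mem_nhds (order_mul_mem ht₀ (hpos _ ht₀)))
  have h3 : ContinuousAt (fun t => e.lift (e.order * (Complex.log t₀ + Complex.log (t / t₀)))) t₀ :=
    ContinuousAt.comp (g := e.lift) h2 h1
  exact h3.continuousWithinAt.congr (fun t ht => param_eq ht (hpos t ht))
    (param_eq ht₀ (hpos t₀ ht₀))

theorem hasDerivAt_coord_pow {t : ℂ} (ht : t ≠ 0) :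
    ∃ c ≠ 0, HasDerivAt (fun t => C.coord e.puncture (t ^ e.order)) c t := by
  obtain ⟨c, hc, h⟩ := C.hasDerivAt_coord e.puncture (pow_ne_zero e.order ht)
  exact ⟨_, mul_ne_zero hc (mul_ne_zero (mul_ne_zero e.order_ne_zero
    (pow_ne_zero (e.order - 1) ht)) one_ne_zero),
    h.comp t ((hasDerivAt_id t).pow e.order)⟩

theorem hasStrictDerivAt_coord_pow {t : ℂ} (ht : t ≠ 0) :
    ∃ c ≠ 0, HasStrictDerivAt (fun t => C.coord e.puncture (t ^ e.order)) c t := by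
  obtain ⟨c, hc, h⟩ := hasDerivAt_coord_pow (e := e) ht
  have h1 : DifferentiableOn ℂ (fun t => C.coord e.puncture (t ^ e.order)) {0}ᶜ := fun t ht =>
    (hasDerivAt_coord_pow (e := e) ht).choose_spec.2.differentiableAt.differentiableWithinAt
  have h2 : AnalyticAt ℂ (fun t => C.coord e.puncture (t ^ e.order)) t :=
    h1.analyticAt (isOpen_compl_singleton.mem_nhds ht)
  exact ⟨c, hc, h.deriv ▸ h2.hasStrictDerivAt⟩

/-- The parametrization of an end is open, since the projection is locally injective and
`t ↦ proj (param t)` is open. -/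
theorem nhds_le_map_param {t : ℂ} (ht : t ∈ puncturedDisc) :
    𝓝 (e.param t) ≤ map e.param (𝓝 t) := by
  intro A hA
  obtain ⟨W, hW, hxW, hinj⟩ := C.isLocalHomeomorph.isLocallyInjective (e.param t)
  have hcont : ContinuousAt e.param t :=
    continuousOn_param.continuousAt (isOpen_puncturedDisc.mem_nhds ht)
  have h1 : e.param ⁻¹' A ∩ e.param ⁻¹' W ∩ puncturedDisc ∈ 𝓝 t :=
    inter_mem (inter_mem hA (hcont (hW.mem_nhds hxW))) (isOpen_puncturedDisc.mem_nhds ht)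
  obtain ⟨c, hc, h⟩ := hasStrictDerivAt_coord_pow (e := e) ht.1
  have h2 := image_mem_map (m := fun t => C.coord e.puncture (t ^ e.order)) h1
  rw [h.map_nhds_eq hc, ← proj_param ht] at h2
  filter_upwards [C.continuous_proj.continuousAt h2, hW.mem_nhds hxW] with y hy hyW
  obtain ⟨t', ⟨⟨h3, h4⟩, h5⟩, h6⟩ := hy
  have : e.param t' = y := hinj h4 hyW (by rw [proj_param h5, ← h6])
  exact this ▸ h3

theorem isOpen_image_param {V : Set ℂ} (hV : IsOpen V) (hVD : V ⊆ puncturedDisc) :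
    IsOpen (e.param '' V) := by
  rw [isOpen_iff_mem_nhds]
  rintro _ ⟨t, ht, rfl⟩
  exact nhds_le_map_param (hVD ht) (image_mem_map (hV.mem_nhds ht))

end Ends

variable (C) in
/-- The compactification of the covering surface by one point for each end. -/
def Completion : Type _ := X ⊕ C.Ends

namespace Completion

/-- The inclusion of the covering surface into its compactification. -/
def incl (x : X) : C.Completion := Sum.inl x

/-- The point at an end. -/
def point (e : C.Ends) : C.Completion := Sum.inr e

theorem incl_injective : Function.Injective (incl (C := C)) := Sum.inl_injective

theorem point_injective : Function.Injective (point (C := C)) := Sum.inr_injective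

theorem incl_ne_point (x : X) (e : C.Ends) : incl x ≠ point e := Sum.inl_ne_inr

@[elab_as_elim]
theorem ind {P : C.Completion → Prop} (h1 : ∀ x, P (incl x)) (h2 : ∀ e, P (point e)) (y) : P y :=
  Sum.rec h1 h2 y

/-- A set is open if its part in the covering surface is open and it contains a punctured disc
about each of its points at the ends. -/
instance : TopologicalSpace C.Completion where
  IsOpen U := IsOpen (incl ⁻¹' U) ∧ ∀ e, point e ∈ U → ∀ᶠ t in 𝓝[≠] (0 : ℂ), incl (e.param t) ∈ U
  isOpen_univ := ⟨isOpen_univ, fun _ _ => by simp⟩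
  isOpen_inter U V hU hV := ⟨hU.1.inter hV.1, fun e he => (hU.2 e he.1).and (hV.2 e he.2)⟩
  isOpen_sUnion S hS := by
    refine ⟨?_, fun e he => ?_⟩
    · rw [Set.preimage_sUnion]
      exact isOpen_biUnion fun U hU => (hS U hU).1
    · obtain ⟨U, hU, heU⟩ := he
      exact ((hS U hU).2 e heU).mono fun t ht => ⟨U, hU, ht⟩

theorem isOpen_iff {U : Set C.Completion} : IsOpen U ↔ IsOpen (incl ⁻¹' U) ∧
    ∀ e, point e ∈ U → ∀ᶠ t in 𝓝[≠] (0 : ℂ), incl (e.param t) ∈ U := Iff.rfl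

theorem isOpenEmbedding_incl : IsOpenEmbedding (incl (C := C)) := by
  refine IsOpenEmbedding.of_continuous_injective_isOpenMap
    (continuous_def.2 fun U hU => hU.1) incl_injective fun U hU => isOpen_iff.2 ⟨?_, ?_⟩
  · rwa [Set.preimage_image_eq _ incl_injective]
  · rintro e ⟨x, -, h⟩
    exact absurd h (incl_ne_point _ _)

open Classical in
/-- The parametrization of a neighbourhood of the point at an end by the unit disc. -/
noncomputable def disc (e : C.Ends) (t : ℂ) : C.Completion :=
  if t = 0 then point e else incl (e.param t)

@[simp]
theorem disc_zero (e : C.Ends) : disc e 0 = point e := by simp [disc]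

theorem disc_of_ne_zero (e : C.Ends) {t : ℂ} (ht : t ≠ 0) : disc e t = incl (e.param t) := by
  simp [disc, ht]

theorem mem_puncturedDisc {t : ℂ} (ht : t ∈ Metric.ball (0 : ℂ) 1) (h0 : t ≠ 0) :
    t ∈ puncturedDisc := ⟨h0, by simpa using ht⟩

theorem disc_eq_disc {e e' : C.Ends} {t t' : ℂ} (ht : t ∈ Metric.ball (0 : ℂ) 1)
    (ht' : t' ∈ Metric.ball (0 : ℂ) 1) (h : disc e t = disc e' t') : e = e' ∧ t = t' := by
  by_cases h0 : t = 0
  · subst h0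
    by_cases h0' : t' = 0
    · subst h0'
      exact ⟨point_injective (by simpa using h), rfl⟩
    · rw [disc_zero, disc_of_ne_zero _ h0'] at h
      exact absurd h.symm (incl_ne_point _ _)
  · by_cases h0' : t' = 0
    · subst h0'
      rw [disc_zero, disc_of_ne_zero _ h0] at h
      exact absurd h (incl_ne_point _ _)
    · rw [disc_of_ne_zero _ h0, disc_of_ne_zero _ h0'] at h
      have h1 := incl_injective h
      have he : e = e' := Ends.eq_of_mem (Ends.param_mem (mem_puncturedDisc ht h0))
        (h1 ▸ Ends.param_mem (mem_puncturedDisc ht' h0'))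
      subst he
      exact ⟨rfl, Ends.injOn_param (mem_puncturedDisc ht h0) (mem_puncturedDisc ht' h0') h1⟩

theorem continuousOn_disc (e : C.Ends) : ContinuousOn (disc e) (Metric.ball 0 1) := by
  intro t ht
  refine ContinuousAt.continuousWithinAt ?_
  by_cases h0 : t = 0
  · subst h0
    rw [continuousAt_iff_punctured_nhds, disc_zero]
    intro U hU
    obtain ⟨V, hVU, hV, he⟩ := mem_nhds_iff.1 hU
    rw [mem_map]
    filter_upwards [hV.2 e he, self_mem_nhdsWithin] with t ht h0
    rw [Set.mem_preimage, disc_of_ne_zero e h0]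
    exact hVU ht
  · have h1 : ContinuousAt e.param t := Ends.continuousOn_param.continuousAt
      (isOpen_puncturedDisc.mem_nhds (mem_puncturedDisc ht h0))
    have h2 := (isOpenEmbedding_incl (C := C)).continuous.continuousAt.comp h1
    refine h2.congr ?_
    filter_upwards [isOpen_ne.mem_nhds h0] with t ht
    exact (disc_of_ne_zero e ht).symm

theorem isOpen_image_disc (e : C.Ends) {V : Set ℂ} (hV : IsOpen V)
    (hVD : V ⊆ Metric.ball 0 1) : IsOpen (disc e '' V) := by
  refine isOpen_iff.2 ⟨?_, fun e' he' => ?_⟩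
  · have hV' : IsOpen (V ∩ {t | t ≠ 0}) := hV.inter isOpen_ne
    convert Ends.isOpen_image_param (e := e) hV'
      (fun t ht => mem_puncturedDisc (hVD ht.1) ht.2) using 1
    ext x
    constructor
    · rintro ⟨t, ht, h⟩
      by_cases h0 : t = 0
      · rw [h0, disc_zero] at h
        exact absurd h.symm (incl_ne_point _ _)
      · rw [disc_of_ne_zero e h0] at h
        exact ⟨t, ⟨ht, h0⟩, incl_injective h⟩
    · rintro ⟨t, ⟨ht, h0⟩, rfl⟩
      exact ⟨t, ht, disc_of_ne_zero e h0⟩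
  · obtain ⟨t, ht, h⟩ := he'
    rw [← disc_zero e'] at h
    obtain ⟨rfl, rfl⟩ := disc_eq_disc (hVD ht) (Metric.mem_ball_self one_pos) h
    filter_upwards [nhdsWithin_le_nhds (hV.mem_nhds ht), self_mem_nhdsWithin] with t ht h0
    exact ⟨t, ht, disc_of_ne_zero e h0⟩

/-- The chart about the point at an end. -/
noncomputable def discChart (e : C.Ends) : OpenPartialHomeomorph C.Completion ℂ :=
  (OpenPartialHomeomorph.ofContinuousOpenRestrict
    (Set.InjOn.toPartialEquiv (disc e) (Metric.ball 0 1)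
      fun _ ht _ ht' h => (disc_eq_disc ht ht' h).2)
    (continuousOn_disc e)
    (fun V hV => by
      rw [Set.domRestrict_eq, Set.image_comp]
      refine isOpen_image_disc e (Metric.isOpen_ball.isOpenMap_subtype_val V hV) ?_
      rintro _ ⟨t, -, rfl⟩
      exact t.2)
    Metric.isOpen_ball).symm

@[simp]
theorem discChart_symm_apply (e : C.Ends) (t : ℂ) : (discChart e).symm t = disc e t := rfl

@[simp]
theorem discChart_target (e : C.Ends) : (discChart e).target = Metric.ball 0 1 := rfl

theorem discChart_disc (e : C.Ends) {t : ℂ} (ht : t ∈ Metric.ball (0 : ℂ) 1) :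
    discChart e (disc e t) = t := (discChart e).right_inv ht

theorem point_mem_discChart_source (e : C.Ends) : point e ∈ (discChart e).source :=
  ⟨0, Metric.mem_ball_self one_pos, disc_zero e⟩

/-! ### The projection of the compactification to the sphere -/

variable (C) in
/-- The projection of the compactification to the sphere. -/
noncomputable def sphereProj : C.Completion → OnePoint ℂ :=
  Sum.elim (fun x => (C.proj x : OnePoint ℂ)) fun e => C.sphereCoord e.puncture 0

@[simp]
theorem sphereProj_incl (x : X) : sphereProj C (incl x) = (C.proj x : OnePoint ℂ) := rfl

@[simp]
theorem sphereProj_point (e : C.Ends) :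
    sphereProj C (point e) = C.sphereCoord e.puncture 0 := rfl

theorem sphereProj_disc (e : C.Ends) {t : ℂ} (ht : t ∈ Metric.ball (0 : ℂ) 1) :
    sphereProj C (disc e t) = C.sphereCoord e.puncture (t ^ e.order) := by
  by_cases h0 : t = 0
  · simp [h0, e.order_pos.ne']
  · rw [disc_of_ne_zero e h0, sphereProj_incl, Ends.proj_param (mem_puncturedDisc ht h0),
      sphereCoord_of_ne_zero _ _ (pow_ne_zero _ h0)]

theorem continuous_sphereProj : Continuous (sphereProj C) := by
  refine continuous_def.2 fun U hU => isOpen_iff.2 ⟨?_, fun e he => ?_⟩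
  · exact (OnePoint.continuous_coe.comp C.continuous_proj).isOpen_preimage U hU
  · have h1 : Tendsto (fun t : ℂ => t ^ e.order) (𝓝 0) (𝓝 0) := by
      have := (continuous_pow (M := ℂ) e.order).tendsto 0
      rwa [zero_pow e.order_pos.ne'] at this
    have h2 := ((C.continuousAt_sphereCoord_zero e.puncture).tendsto.comp h1).mono_left
      (nhdsWithin_le_nhds (s := {0}ᶜ))
    filter_upwards [h2 (hU.mem_nhds he), eventually_mem_puncturedDisc] with t ht htD
    rw [Set.mem_preimage, ← disc_of_ne_zero e htD.1, sphereProj_disc e (by simpa using htD.2)]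
    exact ht

theorem sphereProj_incl_ne (x : X) (e : C.Ends) :
    sphereProj C (incl x) ≠ sphereProj C (point e) := by
  rw [sphereProj_incl, sphereProj_point]
  cases h : e.puncture with
  | none => simp [sphereCoord]
  | some s =>
    simp only [sphereCoord, mul_zero, add_zero, ne_eq, OnePoint.coe_eq_coe]
    intro hx
    exact C.proj_notMem x (hx ▸ s.2)

instance : T2Space C.Completion := by
  have key : ∀ y y' : C.Completion, sphereProj C y ≠ sphereProj C y' →
      ∃ u v, IsOpen u ∧ IsOpen v ∧ y ∈ u ∧ y' ∈ v ∧ Disjoint u v := fun y y' h =>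
    separated_by_continuous continuous_sphereProj h
  refine ⟨fun y y' => ?_⟩
  induction y using ind with
  | h1 x =>
    induction y' using ind with
    | h1 x' =>
      intro h
      obtain ⟨u, v, hu, hv, hx, hx', hd⟩ := t2_separation fun hxx : x = x' => h (congrArg _ hxx)
      exact ⟨_, _, isOpenEmbedding_incl.isOpenMap u hu, isOpenEmbedding_incl.isOpenMap v hv,
        Set.mem_image_of_mem _ hx, Set.mem_image_of_mem _ hx',
        (Set.disjoint_image_iff incl_injective).2 hd⟩
    | h2 e => exact fun _ => key _ _ (sphereProj_incl_ne x e)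
  | h2 e =>
    induction y' using ind with
    | h1 x => exact fun _ => key _ _ (sphereProj_incl_ne x e).symm
    | h2 e' =>
      intro h
      refine ⟨_, _, isOpen_image_disc e Metric.isOpen_ball subset_rfl,
        isOpen_image_disc e' Metric.isOpen_ball subset_rfl, point_mem_discChart_source e,
        point_mem_discChart_source e', Set.disjoint_left.2 ?_⟩
      rintro _ ⟨t, ht, rfl⟩ ⟨t', ht', heq⟩
      exact h (congrArg point (disc_eq_disc ht' ht heq).1.symm)

instance : CompactSpace C.Completion := by
  refine ⟨?_⟩
  have hK : IsCompact (incl (C := C) '' (C.proj ⁻¹' C.core)) :=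
    (C.isCompact_preimage _ C.isCompact_core fun z hz => C.core_notMem hz).image
      isOpenEmbedding_incl.continuous
  have hball : ∀ e : C.Ends, {t : ℂ | ‖t‖ ^ e.order ≤ 1 / 2} ⊆ Metric.ball 0 1 := fun e t ht => by
    rw [mem_ball_zero_iff]
    by_contra h
    have h1 : 1 ≤ ‖t‖ ^ e.order := one_le_pow₀ (not_lt.1 h)
    have h2 : ‖t‖ ^ e.order ≤ 1 / 2 := ht
    linarith
  have hE : ∀ e : C.Ends, IsCompact (disc e '' {t : ℂ | ‖t‖ ^ e.order ≤ 1 / 2}) := fun e => by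
    refine IsCompact.image_of_continuousOn ?_ ((continuousOn_disc e).mono (hball e))
    exact Metric.isCompact_of_isClosed_isBounded (isClosed_le (by fun_prop) continuous_const)
      (Metric.isBounded_ball.subset (hball e))
  convert hK.union (isCompact_iUnion hE)
  refine (Set.eq_univ_of_forall fun y => ?_).symm
  induction y using ind with
  | h2 e =>
    refine Or.inr (Set.mem_iUnion.2 ⟨e, 0, ?_, disc_zero e⟩)
    simp [e.order_pos.ne']
  | h1 x =>
    rcases C.mem_core_or (C.proj_notMem x) with h | ⟨s, u, hu0, hu, h⟩
    · exact Or.inl (Set.mem_image_of_mem _ h)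
    · obtain ⟨e, -, t, ht, rfl, rfl⟩ := Ends.exists_param_eq ⟨hu0, by linarith⟩ h.symm
      refine Or.inr (Set.mem_iUnion.2 ⟨e, t, ?_, disc_of_ne_zero e ht.1⟩)
      rwa [Set.mem_ofPred_eq, ← norm_pow]

theorem denseRange_incl : DenseRange (incl (C := C)) := by
  intro y
  induction y using ind with
  | h1 x => exact subset_closure (Set.mem_range_self x)
  | h2 e =>
    rw [mem_closure_iff]
    intro U hU he
    obtain ⟨t, ht⟩ := ((isOpen_iff.1 hU).2 e he).exists
    exact ⟨_, ht, Set.mem_range_self _⟩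

instance [ConnectedSpace X] : ConnectedSpace C.Completion where
  toPreconnectedSpace := denseRange_incl.preconnectedSpace isOpenEmbedding_incl.continuous
  toNonempty := Nonempty.map incl ‹ConnectedSpace X›.toNonempty

end Completion

end PuncturedCover
end JacobiTree

namespace JacobiTree
namespace PuncturedCover

variable {X : Type*} [TopologicalSpace X] [T2Space X] {C : PuncturedCover X}

namespace Completion

/-! ### The complex structure of the compactification -/

variable (C) in
/-- A local branch of the inverse of the covering map, as a chart of the covering surface. -/
noncomputable def branchChart (x : X) : OpenPartialHomeomorph X ℂ := (C.isLocalHomeomorph x).choose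

theorem mem_branchChart_source (x : X) : x ∈ (branchChart C x).source :=
  (C.isLocalHomeomorph x).choose_spec.1

@[simp]
theorem coe_branchChart (x : X) : ⇑(branchChart C x) = C.proj :=
  (C.isLocalHomeomorph x).choose_spec.2.symm

/-- The projection as a local coordinate near a point of the covering surface. -/
noncomputable def inclChart (x : X) : OpenPartialHomeomorph C.Completion ℂ :=
  (branchChart C x).lift_openEmbedding isOpenEmbedding_incl

@[simp]
theorem inclChart_incl (x x' : X) : inclChart (C := C) x (incl x') = C.proj x' := by
  rw [inclChart, OpenPartialHomeomorph.lift_openEmbedding_apply, coe_branchChart]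

theorem inclChart_symm (x : X) (z : ℂ) :
    (inclChart (C := C) x).symm z = incl ((branchChart C x).symm z) := rfl

theorem proj_branchChart_symm (x : X) {z : ℂ} (hz : z ∈ (branchChart C x).target) :
    C.proj ((branchChart C x).symm z) = z := by
  rw [← coe_branchChart (C := C) x]
  exact (branchChart C x).right_inv hz

theorem proj_mem_branchChart_target (x : X) : C.proj x ∈ (branchChart C x).target := by
  have := (branchChart C x).map_source (mem_branchChart_source x)
  rwa [coe_branchChart] at this

theorem branchChart_symm_proj (x : X) : (branchChart C x).symm (C.proj x) = x := by
  have := (branchChart C x).left_inv (mem_branchChart_source x)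
  rwa [coe_branchChart] at this

noncomputable instance : ChartedSpace ℂ C.Completion where
  atlas := Set.range inclChart ∪ Set.range discChart
  chartAt := Sum.elim inclChart discChart
  mem_chart_source y := by
    induction y using ind with
    | h1 x => exact ⟨x, mem_branchChart_source x, rfl⟩
    | h2 e => exact point_mem_discChart_source e
  chart_mem_atlas y := by
    induction y using ind with
    | h1 x => exact Or.inl ⟨x, rfl⟩
    | h2 e => exact Or.inr ⟨e, rfl⟩

@[simp]
theorem chartAt_incl (x : X) : chartAt ℂ (incl x : C.Completion) = inclChart x := rfl

@[simp]
theorem chartAt_point (e : C.Ends) : chartAt ℂ (point e) = discChart e := rfl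

theorem hasDerivAt_discChart_inclChart (e : C.Ends) (x : X) {t : ℂ}
    (ht : t ∈ ((discChart e).symm ≫ₕ inclChart x).source) :
    ∃ c ≠ 0, HasDerivAt ((discChart e).symm ≫ₕ inclChart x) c t := by
  have h1 : ∀ t ∈ ((discChart e).symm ≫ₕ inclChart x).source, t ≠ 0 ∧
      ((discChart e).symm ≫ₕ inclChart x) t = C.coord e.puncture (t ^ e.order) := by
    intro t ht
    rw [OpenPartialHomeomorph.trans_source, Set.mem_inter_iff, Set.mem_preimage,
      discChart_symm_apply] at ht
    have h0 : t ≠ 0 := by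
      rintro rfl
      obtain ⟨x', -, h⟩ := ht.2
      exact incl_ne_point x' e (by simpa using h)
    refine ⟨h0, ?_⟩
    rw [OpenPartialHomeomorph.coe_trans, Function.comp_apply, discChart_symm_apply,
      disc_of_ne_zero e h0, inclChart_incl, Ends.proj_param (mem_puncturedDisc ht.1 h0)]
  obtain ⟨c, hc, h⟩ := Ends.hasDerivAt_coord_pow (e := e) (h1 t ht).1
  refine ⟨c, hc, h.congr_of_eventuallyEq ?_⟩
  filter_upwards [((discChart e).symm ≫ₕ inclChart x).open_source.mem_nhds ht] with t ht
  exact (h1 t ht).2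

/-- A transition from the coordinate `t` of an end to `proj` is `t ↦ coord _ (t ^ k)`, with a
derivative that does not vanish, so that its inverse is differentiable too. -/
theorem differentiableOn_transition {φ φ' : OpenPartialHomeomorph C.Completion ℂ}
    (hφ : φ ∈ atlas ℂ C.Completion) (hφ' : φ' ∈ atlas ℂ C.Completion) :
    DifferentiableOn ℂ (φ.symm ≫ₕ φ') (φ.symm ≫ₕ φ').source := by
  rcases hφ with ⟨x, rfl⟩ | ⟨e, rfl⟩ <;> rcases hφ' with ⟨x', rfl⟩ | ⟨e', rfl⟩
  · refine differentiableOn_id.congr fun z hz => ?_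
    rw [OpenPartialHomeomorph.trans_source] at hz
    rw [OpenPartialHomeomorph.coe_trans, Function.comp_apply, inclChart_symm, inclChart_incl,
      proj_branchChart_symm x hz.1, id]
  · intro z hz
    set T := (discChart e').symm ≫ₕ inclChart x with hT
    have hz' : z ∈ T.target := by
      rw [hT, ← OpenPartialHomeomorph.symm_source, OpenPartialHomeomorph.trans_symm_eq_symm_trans_symm,
        OpenPartialHomeomorph.symm_symm]
      exact hz
    obtain ⟨c, hc, h⟩ := hasDerivAt_discChart_inclChart e' x (T.map_target hz')
    exact (T.hasDerivAt_symm hz' hc h).differentiableAt.differentiableWithinAt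
  · intro t ht
    obtain ⟨c, -, h⟩ := hasDerivAt_discChart_inclChart e x' ht
    exact h.differentiableAt.differentiableWithinAt
  · refine differentiableOn_id.congr fun t ht => ?_
    rw [OpenPartialHomeomorph.trans_source] at ht
    obtain ⟨t', ht', h⟩ := ht.2
    obtain ⟨rfl, rfl⟩ := disc_eq_disc ht' ht.1 h
    exact discChart_disc _ ht'

instance : IsManifold 𝓘(ℂ) ω C.Completion := by
  refine isManifold_of_contDiffOn _ _ _ fun φ φ' hφ hφ' => ?_
  have h := differentiableOn_transition hφ hφ'
  simpa using h.contDiffOn (n := ω) (φ.symm ≫ₕ φ').open_source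

/-! ### Meromorphic functions on the compactification -/

theorem isMeromorphic_of {F : C.Completion → ℂ}
    (h1 : ∀ x, MeromorphicAt (fun z => F (incl ((branchChart C x).symm z))) (C.proj x))
    (h2 : ∀ e, MeromorphicAt (fun t => F (disc e t)) 0) : IsMeromorphic F := by
  intro y
  induction y using ind with
  | h1 x =>
    rw [chartAt_incl, inclChart_incl]
    exact h1 x
  | h2 e =>
    have : discChart e (point e) = 0 := by
      rw [← disc_zero e]
      exact discChart_disc e (Metric.mem_ball_self one_pos)
    rw [chartAt_point, this]
    exact h2 e

theorem isMeromorphic_sphereProj : IsMeromorphic (finitePart ∘ sphereProj C) := by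
  refine isMeromorphic_of (fun x => ?_) fun e => ?_
  · refine MeromorphicAt.congr (f := id) (MeromorphicAt.id _) (Filter.Eventually.filter_mono
      nhdsWithin_le_nhds ?_)
    filter_upwards [(branchChart C x).open_target.mem_nhds (proj_mem_branchChart_target x)]
      with z hz
    simp [finitePart, proj_branchChart_symm x hz]
  · have h : MeromorphicAt (fun t : ℂ => C.coord e.puncture (t ^ e.order)) 0 := by
      cases e.puncture with
      | none => unfold coord; fun_prop
      | some s => unfold coord; fun_prop
    refine h.congr ?_
    filter_upwards [eventually_mem_puncturedDisc] with t ht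
    rw [Function.comp_apply, sphereProj_disc e (by simpa using ht.2),
      sphereCoord_of_ne_zero _ _ (pow_ne_zero _ ht.1)]
    simp [finitePart]

variable (C) in
/-- Holomorphy of a function on the covering surface in terms of the local coordinate `proj`. -/
def IsHolomorphic (g : X → ℂ) : Prop :=
  ∀ x, ∃ φ : ℂ → ℂ, AnalyticAt ℂ φ (C.proj x) ∧ ∀ᶠ y in 𝓝 x, g y = φ (C.proj y)

theorem exists_norm_coord_le (s : Option C.punctures) :
    ∃ B : ℝ, 0 ≤ B ∧ ∀ u ∈ puncturedDisc, ‖u‖ * (1 + ‖C.coord s u‖) ≤ B := by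
  have hr := C.radius_pos
  cases s with
  | none =>
    refine ⟨1 + C.radius⁻¹, by positivity, fun u hu => ?_⟩
    have h1 : ‖C.coord none u‖ = C.radius⁻¹ * ‖u‖⁻¹ := by
      rw [coord, norm_inv, norm_radius_mul, mul_inv]
    have h2 : ‖u‖ ≠ 0 := norm_ne_zero_iff.2 hu.1
    have h3 := hu.2
    rw [h1, mul_add, mul_one, mul_left_comm, mul_inv_cancel₀ h2, mul_one]
    linarith
  | some s =>
    refine ⟨1 + (‖(s : ℂ)‖ + C.radius), by positivity, fun u hu => ?_⟩
    have h1 : ‖C.coord (some s) u‖ ≤ ‖(s : ℂ)‖ + C.radius := by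
      refine (norm_add_le _ _).trans ?_
      rw [norm_radius_mul]
      nlinarith [hu.2]
    calc ‖u‖ * (1 + ‖C.coord (some s) u‖) ≤ 1 * (1 + ‖C.coord (some s) u‖) := by
          gcongr
          exact hu.2.le
      _ ≤ _ := by linarith

theorem IsHolomorphic.meromorphicAt_param {g : X → ℂ} (hg : IsHolomorphic C g) {A : ℝ} {M : ℕ}
    (hA : ∀ x, ‖g x‖ ≤ A * (1 + ‖C.proj x‖) ^ M) (e : C.Ends) :
    MeromorphicAt (fun t => g (e.param t)) 0 := by
  obtain ⟨B, hB0, hB⟩ := exists_norm_coord_le (C := C) e.puncture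
  have hA' : 0 ≤ |A| := abs_nonneg A
  have hdiff : ∀ t ∈ puncturedDisc, DifferentiableAt ℂ (fun t => g (e.param t)) t := by
    intro t ht
    obtain ⟨φ, hφ, hgφ⟩ := hg (e.param t)
    have hcont : ContinuousAt e.param t :=
      Ends.continuousOn_param.continuousAt (isOpen_puncturedDisc.mem_nhds ht)
    obtain ⟨c, -, hc⟩ := Ends.hasDerivAt_coord_pow (e := e) ht.1
    rw [Ends.proj_param ht] at hφ
    have h1 : DifferentiableAt ℂ (fun t => φ (C.coord e.puncture (t ^ e.order))) t :=
      hφ.differentiableAt.comp t hc.differentiableAt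
    refine h1.congr_of_eventuallyEq ?_
    filter_upwards [hcont.eventually hgφ, isOpen_puncturedDisc.mem_nhds ht] with t h2 h3
    rw [h2, Ends.proj_param h3]
  -- the power of `t` is one higher than needed for boundedness, so that the product tends to `0`
  refine ⟨e.order * M + 1, ?_⟩
  simp only [sub_zero, smul_eq_mul]
  refine Complex.analyticAt_of_differentiable_on_punctured_nhds_of_continuousAt ?_ ?_
  · filter_upwards [eventually_mem_puncturedDisc] with t ht
    exact (differentiableAt_id.pow _).mul (hdiff t ht)
  · rw [continuousAt_iff_punctured_nhds]
    simp only [ne_eq, Nat.add_eq_zero_iff, one_ne_zero, and_false, not_false_eq_true, zero_pow,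
      zero_mul]
    refine squeeze_zero_norm' (a := fun t : ℂ => |A| * B ^ M * ‖t‖) ?_ ?_
    · filter_upwards [eventually_mem_puncturedDisc] with t ht
      have h1 := hB _ (pow_mem_puncturedDisc ht e.order_pos)
      have h2 : ‖g (e.param t)‖ ≤ |A| * (1 + ‖C.coord e.puncture (t ^ e.order)‖) ^ M := by
        rw [← Ends.proj_param ht]
        refine (hA _).trans ?_
        gcongr
        exact le_abs_self A
      calc ‖t ^ (e.order * M + 1) * g (e.param t)‖
          = ‖t‖ * ‖t ^ e.order‖ ^ M * ‖g (e.param t)‖ := by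
            rw [norm_mul, norm_pow, norm_pow, pow_succ, pow_mul]
            ring
        _ ≤ ‖t‖ * ‖t ^ e.order‖ ^ M *
            (|A| * (1 + ‖C.coord e.puncture (t ^ e.order)‖) ^ M) := by gcongr
        _ = |A| * (‖t ^ e.order‖ * (1 + ‖C.coord e.puncture (t ^ e.order)‖)) ^ M * ‖t‖ := by
          rw [mul_pow]
          ring
        _ ≤ _ := by gcongr
    · have : Continuous fun t : ℂ => |A| * B ^ M * ‖t‖ := by fun_prop
      simpa using (this.tendsto 0).mono_left nhdsWithin_le_nhds

/-- A holomorphic function on the covering surface, divided by a polynomial in the coordinate of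
the plane, is meromorphic on the compactification if the numerator has at most polynomial growth;
the values at the ends do not matter. -/
theorem isMeromorphic_of_growth {g h : X → ℂ} (hg : IsHolomorphic C g) (hh : IsHolomorphic C h)
    {A A' : ℝ} {M M' : ℕ} (hA : ∀ x, ‖g x‖ ≤ A * (1 + ‖C.proj x‖) ^ M)
    (hA' : ∀ x, ‖h x‖ ≤ A' * (1 + ‖C.proj x‖) ^ M')
    {F : C.Completion → ℂ} (hF : ∀ x, F (incl x) = g x / h x) : IsMeromorphic F := by
  have key : ∀ {g : X → ℂ}, IsHolomorphic C g → ∀ x,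
      MeromorphicAt (fun z => g ((branchChart C x).symm z)) (C.proj x) := by
    intro g hg x
    obtain ⟨φ, hφ, hgφ⟩ := hg x
    refine hφ.meromorphicAt.congr (Filter.Eventually.filter_mono nhdsWithin_le_nhds ?_)
    have hcont := (branchChart C x).continuousAt_symm (proj_mem_branchChart_target x)
    rw [ContinuousAt, branchChart_symm_proj] at hcont
    filter_upwards [hcont.eventually hgφ,
      (branchChart C x).open_target.mem_nhds (proj_mem_branchChart_target x)] with z h1 h2
    rw [h1, proj_branchChart_symm x h2]
  refine isMeromorphic_of (fun x => ?_) fun e => ?_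
  · simp only [hF]
    exact (key hg x).div (key hh x)
  · refine ((hg.meromorphicAt_param hA e).div (hh.meromorphicAt_param hA' e)).congr ?_
    filter_upwards [self_mem_nhdsWithin] with t ht
    rw [disc_of_ne_zero e ht, hF]
    rfl

/-! ### The number of sheets -/

variable (C) in
/-- The number of sheets of the covering. -/
noncomputable def degree : ℕ := (C.proj ⁻¹' {C.coord none (Complex.exp (-1))}).ncard

theorem exp_neg_one_mem : Complex.exp (-1) ∈ puncturedDisc :=
  ⟨Complex.exp_ne_zero _, norm_exp_lt_one.2 neg_one_mem_leftHalfPlane⟩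

theorem ncard_fiber {z : ℂ} (hz : z ∉ C.punctures) : (C.proj ⁻¹' {z}).ncard = degree C := by
  have hconn : IsPreconnected {z : ℂ | z ∉ C.punctures} :=
    (C.punctures.countable_toSet.isConnected_compl_of_one_lt_rank (by simp)).isPreconnected
  refine hconn.constant (f := fun z => (C.proj ⁻¹' {z}).ncard) (fun z hz => ?_) hz
    (C.coord_notMem none exp_neg_one_mem.1 exp_neg_one_mem.2)
  obtain ⟨hd, U, hzU, hU, hpU, H, hH⟩ := C.isCoveringMapOn z hz
  refine ContinuousAt.continuousWithinAt ?_
  refine (continuousAt_const (y := Nat.card (C.proj ⁻¹' {z}))).congr ?_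
  filter_upwards [hU.mem_nhds hzU] with w hw
  have h : IsEvenlyCovered C.proj w (C.proj ⁻¹' {z}) := ⟨hd, U, hw, hU, hpU, H, hH⟩
  exact Nat.card_congr h.fiberHomeomorph.toEquiv

theorem sphereCoord_zero_injective :
    Function.Injective fun s : Option C.punctures => C.sphereCoord s 0 := by
  intro s s' h
  cases s <;> cases s' <;> simp_all [sphereCoord]

theorem fiber_coe {z : ℂ} (hz : z ∉ C.punctures) :
    sphereProj C ⁻¹' {(z : OnePoint ℂ)} = incl '' (C.proj ⁻¹' {z}) := by
  ext y
  induction y using ind with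
  | h1 x =>
    constructor
    · intro h
      exact ⟨x, by simpa using h, rfl⟩
    · rintro ⟨x', h, h'⟩
      rw [← h']
      simpa using h
  | h2 e =>
    constructor
    · intro h
      simp only [Set.mem_preimage, sphereProj_point, Set.mem_singleton_iff] at h
      cases hs : e.puncture with
      | none => simp [hs, sphereCoord] at h
      | some s =>
        simp only [hs, sphereCoord, mul_zero, add_zero, OnePoint.coe_eq_coe] at h
        exact absurd (h ▸ s.2) hz
    · rintro ⟨x, -, h⟩
      exact absurd h (incl_ne_point x e)

theorem fiber_sphereCoord (s : Option C.punctures) :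
    sphereProj C ⁻¹' {C.sphereCoord s 0} = point '' {e | e.puncture = s} := by
  ext y
  induction y using ind with
  | h1 x =>
    constructor
    · intro h
      exfalso
      cases s with
      | none => simp [sphereCoord] at h
      | some s =>
        simp only [Set.mem_preimage, sphereProj_incl, sphereCoord, mul_zero, add_zero,
          Set.mem_singleton_iff, OnePoint.coe_eq_coe] at h
        exact C.proj_notMem x (h ▸ s.2)
    · rintro ⟨e, -, h⟩
      exact absurd h.symm (incl_ne_point x e)
  | h2 e =>
    constructor
    · intro h
      exact ⟨e, sphereCoord_zero_injective h, rfl⟩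
    · rintro ⟨e', h, h'⟩
      rw [← h', ← h]
      rfl

theorem eq_or_eq_sphereCoord (y : OnePoint ℂ) :
    (∃ z : ℂ, z ∉ C.punctures ∧ y = z) ∨ ∃ s, y = C.sphereCoord s 0 := by
  induction y using OnePoint.rec with
  | infty => exact Or.inr ⟨none, by simp [sphereCoord]⟩
  | coe z =>
    by_cases hz : z ∈ C.punctures
    · exact Or.inr ⟨some ⟨z, hz⟩, by simp [sphereCoord]⟩
    · exact Or.inl ⟨z, hz, rfl⟩

theorem ncard_fiber_coe {z : ℂ} (hz : z ∉ C.punctures) :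
    (sphereProj C ⁻¹' {(z : OnePoint ℂ)}).ncard = degree C := by
  rw [fiber_coe hz, Set.ncard_image_of_injective _ incl_injective, ncard_fiber hz]

theorem isFiniteSheetedSurface [ConnectedSpace X] :
    IsFiniteSheetedSurface C.Completion (sphereProj C) (degree C) where
  t2 := inferInstance
  compact := inferInstance
  connected := inferInstance
  isManifold := inferInstance
  continuous_proj := continuous_sphereProj
  meromorphic_proj := isMeromorphic_sphereProj
  finite_fiber y := by
    rcases eq_or_eq_sphereCoord (C := C) y with ⟨z, hz, rfl⟩ | ⟨s, rfl⟩
    · rw [fiber_coe hz]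
      exact (C.finite_fiber z).image _
    · rw [fiber_sphereCoord]
      exact (Set.toFinite _).image _
  card_fiber_le y := by
    rcases eq_or_eq_sphereCoord (C := C) y with ⟨z, hz, rfl⟩ | ⟨s, rfl⟩
    · exact (ncard_fiber_coe hz).le
    · rw [fiber_sphereCoord, Set.ncard_image_of_injective _ point_injective,
        ← ncard_fiber (C.coord_notMem s exp_neg_one_mem.1 exp_neg_one_mem.2)]
      exact Set.ncard_le_ncard_of_injOn _ (Ends.mapsTo_lift s) (Ends.lift_injOn s)
        (C.finite_fiber _)
  finite_branch := by
    refine (Set.finite_range fun s : Option C.punctures => C.sphereCoord s 0).subset fun y hy => ?_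
    rcases eq_or_eq_sphereCoord (C := C) y with ⟨z, hz, rfl⟩ | ⟨s, rfl⟩
    · exact absurd (ncard_fiber_coe hz) hy
    · exact ⟨s, rfl⟩

/-! ### Extension of sections -/

theorem mdifferentiableAt_of_chart {σ : ℂ → C.Completion} {z : ℂ} (hc : ContinuousAt σ z)
    (hd : DifferentiableAt ℂ (fun w => chartAt ℂ (σ z) (σ w)) z) :
    MDifferentiableAt 𝓘(ℂ) 𝓘(ℂ) σ z := by
  rw [mdifferentiableAt_iff]
  refine ⟨hc, ?_⟩
  simp only [writtenInExtChartAt, extChartAt, mfld_simps]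
  exact hd.differentiableWithinAt

/-- A continuous section of the covering over an open set minus the punctures extends to a
holomorphic section of the compactification. -/
theorem exists_section {Ω : Set ℂ} (hΩ : IsOpen Ω)
    (hball : ∀ s ∈ C.punctures, s ∈ Ω → Metric.ball s C.radius ⊆ Ω) {σ₀ : ℂ → X}
    (hσ₀ : ContinuousOn σ₀ {z | z ∈ Ω ∧ z ∉ C.punctures})
    (hproj : ∀ z ∈ Ω, z ∉ C.punctures → C.proj (σ₀ z) = z) :
    ∃ σ : ℂ → C.Completion, MDifferentiableOn 𝓘(ℂ) 𝓘(ℂ) σ Ω ∧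
      (∀ z ∈ Ω, sphereProj C (σ z) = z) ∧ ∀ z ∈ Ω, z ∉ C.punctures → σ z = incl (σ₀ z) := by
  classical
  have hr := C.radius_pos
  have hopen : IsOpen {z | z ∈ Ω ∧ z ∉ C.punctures} :=
    hΩ.inter C.punctures.finite_toSet.isClosed.isOpen_compl
  -- The section over the disc about a puncture parametrizes an end.
  have hend : ∀ s : C.punctures, (s : ℂ) ∈ Ω → ∃ e : C.Ends, e.puncture = some s ∧
      ∀ u ∈ puncturedDisc, ∃ t ∈ puncturedDisc, t ^ e.order = u ∧
        e.param t = σ₀ (C.coord (some s) u) := by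
    intro s hs
    have hmem : ∀ u ∈ puncturedDisc, C.coord (some s) u ∈ {z | z ∈ Ω ∧ z ∉ C.punctures} := by
      intro u hu
      refine ⟨hball s s.2 hs ?_, C.coord_notMem _ hu.1 hu.2⟩
      rw [coord, mem_ball_iff_norm, add_sub_cancel_left, norm_radius_mul]
      nlinarith [hu.2]
    have hexp : ∀ ζ ∈ leftHalfPlane, Complex.exp ζ ∈ puncturedDisc := fun ζ hζ =>
      ⟨Complex.exp_ne_zero _, norm_exp_lt_one.2 hζ⟩
    have hL : C.IsLift (some s) fun ζ => σ₀ (C.coord (some s) (Complex.exp ζ)) := by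
      refine ⟨hσ₀.comp ?_ fun ζ hζ => hmem _ (hexp ζ hζ), fun ζ hζ => ?_⟩
      · exact (C.continuousOn_coord (some s)).comp (by fun_prop) fun ζ _ => Complex.exp_ne_zero ζ
      · exact hproj _ (hmem _ (hexp ζ hζ)).1 (hmem _ (hexp ζ hζ)).2
    refine ⟨Ends.ofLift hL, Ends.puncture_ofLift hL, fun u hu => ?_⟩
    obtain ⟨e, -, t, ht, htu, htx⟩ := Ends.exists_param_eq (s := some s) hu
      (hproj _ (hmem u hu).1 (hmem u hu).2)
    have : e = Ends.ofLift hL := Ends.eq_of_mem (x := e.param t) (Ends.param_mem ht)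
      ⟨Complex.log u, log_mem_leftHalfPlane hu.1 hu.2, by
        simp only [Complex.exp_log hu.1, htx]⟩
    subst this
    exact ⟨t, ht, htu, htx⟩
  choose e he hparam using hend
  let σ : ℂ → C.Completion := fun z =>
    if h : z ∈ C.punctures ∧ z ∈ Ω then point (e ⟨z, h.1⟩ h.2) else incl (σ₀ z)
  have hσ1 : ∀ z ∉ C.punctures, σ z = incl (σ₀ z) := fun z hz => by simp [σ, hz]
  have hσ2 : ∀ (s : C.punctures) (hs : (s : ℂ) ∈ Ω), σ s = point (e s hs) := fun s hs => by
    simp [σ, hs]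
  have hσ3 : ∀ z ∈ {z | z ∈ Ω ∧ z ∉ C.punctures}, σ =ᶠ[𝓝 z] fun z => incl (σ₀ z) := fun z hz => by
    filter_upwards [hopen.mem_nhds hz] with w hw
    exact hσ1 w hw.2
  have hcont : ∀ z ∈ {z | z ∈ Ω ∧ z ∉ C.punctures}, ContinuousAt σ z := fun z hz => by
    have h1 := hσ₀.continuousAt (hopen.mem_nhds hz)
    exact ((isOpenEmbedding_incl (C := C)).continuous.continuousAt.comp h1).congr (hσ3 z hz).symm
  refine ⟨σ, fun z hz => MDifferentiableAt.mdifferentiableWithinAt ?_, fun z hz => ?_,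
    fun z _ hz => hσ1 z hz⟩
  · by_cases hzS : z ∈ C.punctures
    swap
    · refine mdifferentiableAt_of_chart (hcont z ⟨hz, hzS⟩) ?_
      refine differentiableAt_id.congr_of_eventuallyEq ?_
      filter_upwards [hopen.mem_nhds ⟨hz, hzS⟩] with w hw
      rw [hσ1 z hzS, hσ1 w hw.2, chartAt_incl, inclChart_incl, hproj w hw.1 hw.2, id]
    obtain ⟨s, rfl⟩ : ∃ s : C.punctures, (s : ℂ) = z := ⟨⟨z, hzS⟩, rfl⟩
    set E := e s hz with hE
    -- the section in the chart at the end; its `E.order`-th power is the coordinate of the disc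
    set h : ℂ → ℂ := fun w => discChart E (σ w) with hh
    have hdisc0 : discChart E (point E) = 0 := by
      rw [← disc_zero E]
      exact discChart_disc E (Metric.mem_ball_self one_pos)
    have h0 : h s = 0 := by rw [hh]; simp only [hσ2 s hz]; exact hdisc0
    have hpunct : ∀ w ∈ Metric.ball (s : ℂ) C.radius, w ≠ s →
        h w ∈ puncturedDisc ∧ h w ^ E.order = (w - s) / C.radius ∧ disc E (h w) = σ w ∧
          w ∈ {z | z ∈ Ω ∧ z ∉ C.punctures} := by
      intro w hw hws
      have hu : (w - s) / C.radius ∈ puncturedDisc := by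
        refine ⟨div_ne_zero (sub_ne_zero.2 hws) C.radius_ne_zero, ?_⟩
        rw [norm_div, Complex.norm_real, Real.norm_of_nonneg hr.le, div_lt_one hr]
        simpa [dist_eq_norm] using hw
      have hcoord : C.coord (some s) ((w - s) / C.radius) = w := by
        have := C.radius_ne_zero
        simp only [coord]
        field_simp
        ring
      obtain ⟨t, ht, htu, htx⟩ := hparam s hz _ hu
      have hwS : w ∉ C.punctures := hcoord ▸ C.coord_notMem _ hu.1 hu.2
      have h1 : disc E t = σ w := by
        rw [disc_of_ne_zero E ht.1, hσ1 w hwS, htx, hcoord]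
      have h2 : h w = t := by
        rw [hh]
        simp only [← h1]
        exact discChart_disc E (by simpa using ht.2)
      rw [h2]
      exact ⟨ht, htu, h1, hball s s.2 hz hw, hwS⟩
    have hhcont : ContinuousAt h s := by
      rw [continuousAt_iff_punctured_nhds, h0]
      refine Metric.tendsto_nhds.2 fun ε hε => ?_
      have h1 : Metric.ball (s : ℂ) (C.radius * ε ^ E.order) ∈ 𝓝[≠] (s : ℂ) :=
        nhdsWithin_le_nhds (Metric.ball_mem_nhds _ (by positivity))
      filter_upwards [h1, nhdsWithin_le_nhds (Metric.ball_mem_nhds _ hr), self_mem_nhdsWithin]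
        with w hw1 hw2 hws
      obtain ⟨-, h2, -⟩ := hpunct w hw2 hws
      rw [dist_zero_right]
      refine lt_of_pow_lt_pow_left₀ E.order hε.le ?_
      rw [← norm_pow, h2, norm_div, Complex.norm_real, Real.norm_of_nonneg hr.le,
        div_lt_iff₀ hr, mul_comm]
      simpa [dist_eq_norm] using hw1
    have hσcont : ContinuousAt σ s := by
      have h1 : ContinuousAt (disc E) (h s) := by
        rw [h0]
        exact (continuousOn_disc E).continuousAt (Metric.ball_mem_nhds _ one_pos)
      refine (h1.comp hhcont).congr ?_
      filter_upwards [Metric.ball_mem_nhds _ hr] with w hw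
      by_cases hws : w = s
      · rw [hws, Function.comp_apply, h0, hσ2 s hz, disc_zero]
      · exact (hpunct w hw hws).2.2.1
    refine mdifferentiableAt_of_chart hσcont ?_
    rw [hσ2 s hz, chartAt_point]
    refine (Complex.analyticAt_of_differentiable_on_punctured_nhds_of_continuousAt ?_
      hhcont).differentiableAt
    filter_upwards [nhdsWithin_le_nhds (Metric.ball_mem_nhds _ hr), self_mem_nhdsWithin]
      with w hw hws
    obtain ⟨h1, -, h3, h4⟩ := hpunct w hw hws
    obtain ⟨c, hc, hder⟩ := Ends.hasDerivAt_coord_pow (e := E) h1.1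
    have hmem : σ w ∈ (discChart E).source := ⟨h w, by simpa using h1.2, h3⟩
    refine (HasDerivAt.of_local_left_inverse (((discChart E).continuousAt hmem).comp (hcont w h4))
      hder hc ?_).differentiableAt
    filter_upwards [(Metric.isOpen_ball.inter isOpen_ne).mem_nhds ⟨hw, hws⟩] with v hv
    obtain ⟨-, h5, -⟩ := hpunct v hv.1 hv.2
    change C.coord E.puncture (h v ^ E.order) = v
    have := C.radius_ne_zero
    rw [h5, he s hz, coord]
    field_simp
    ring
  · by_cases hzS : z ∈ C.punctures
    · obtain ⟨s, rfl⟩ : ∃ s : C.punctures, (s : ℂ) = z := ⟨⟨z, hzS⟩, rfl⟩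
      rw [hσ2 s hz, sphereProj_point, he s hz]
      simp [sphereCoord]
    · rw [hσ1 z hzS, sphereProj_incl, hproj z hz hzS]

end Completion

end PuncturedCover
end JacobiTree

namespace JacobiTree

open Polynomial

/-! ### Simple roots of a polynomial with polynomial coefficients -/

theorem hasDerivAt_evalEval (Q : ℂ[X][X]) (z w : ℂ) :
    HasDerivAt (fun w => Q.evalEval z w) ((derivative Q).evalEval z w) w := by
  have h := (Q.map (evalRingHom z)).hasDerivAt w
  rw [derivative_map] at h
  simpa only [map_evalRingHom_eval] using h

theorem exists_analyticAt_root {Q : ℂ[X][X]} {z₀ w₀ : ℂ} (h0 : Q.evalEval z₀ w₀ = 0)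
    (h1 : (derivative Q).evalEval z₀ w₀ ≠ 0) :
    ∃ φ : ℂ → ℂ, AnalyticAt ℂ φ z₀ ∧ φ z₀ = w₀ ∧ (∀ᶠ z in 𝓝 z₀, Q.evalEval z (φ z) = 0) ∧
      ∀ᶠ y in 𝓝 (z₀, w₀), Q.evalEval y.1 y.2 = 0 → y.2 = φ y.1 := by
  let f : ℂ × ℂ → ℂ := fun y => Q.evalEval y.1 y.2
  have hf : ContDiff ℂ ω f := by
    simp only [f, evalEval_eq_sum]
    have : ∀ p : ℂ[X], ContDiff ℂ ω fun z => p.eval z := fun p => by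
      simpa only [coe_aeval_eq_eval] using p.contDiff_aeval (𝕜 := ℂ) ω
    fun_prop
  have hinv : (fderiv ℂ f (z₀, w₀) ∘L .inr ℂ ℂ ℂ).IsInvertible := by
    refine ⟨ContinuousLinearEquiv.unitsEquivAut ℂ (Units.mk0 _ h1), ?_⟩
    refine ContinuousLinearMap.ext_ring ?_
    have h2 : HasFDerivAt f (fderiv ℂ f (z₀, w₀)) (z₀, w₀) :=
      (hf.differentiable (by simp)).differentiableAt.hasFDerivAt
    have h3 : HasDerivAt (fun w : ℂ => (z₀, w)) ((0 : ℂ), (1 : ℂ)) w₀ :=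
      (hasDerivAt_const w₀ z₀).prodMk (hasDerivAt_id w₀)
    have h4 := h2.comp_hasDerivAt w₀ h3
    have h5 := h4.unique (hasDerivAt_evalEval Q z₀ w₀)
    simp [← h5]
  have hn : (ω : WithTop ℕ∞) ≠ 0 := by simp
  have hc := hf.contDiffAt (x := (z₀, w₀))
  refine ⟨hc.implicitFunction hn hinv, (hc.contDiffAt_implicitFunction hn hinv).analyticAt,
    hc.implicitFunction_apply_self hn hinv, ?_, ?_⟩
  · filter_upwards [hc.eventually_apply_implicitFunction hn hinv] with z hz
    exact hz.trans h0
  · filter_upwards [hc.eventually_apply_eq_iff_implicitFunction hn hinv] with y hy hy0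
    exact (hy.1 (hy0.trans h0.symm)).symm

theorem exists_norm_eval_le (p : ℂ[X]) :
    ∃ A : ℝ, ∃ M : ℕ, 0 ≤ A ∧ ∀ z, ‖p.eval z‖ ≤ A * (1 + ‖z‖) ^ M := by
  refine ⟨∑ i ∈ Finset.range (p.natDegree + 1), ‖p.coeff i‖, p.natDegree,
    Finset.sum_nonneg fun _ _ => norm_nonneg _, fun z => ?_⟩
  rw [eval_eq_sum_range, Finset.sum_mul]
  refine norm_sum_le_of_le _ fun i hi => ?_
  rw [norm_mul, norm_pow]
  gcongr
  have hz := norm_nonneg z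
  calc ‖z‖ ^ i ≤ (1 + ‖z‖) ^ i := by gcongr; linarith
    _ ≤ (1 + ‖z‖) ^ p.natDegree :=
      pow_le_pow_right₀ (by linarith) (by simpa [Nat.lt_succ_iff] using hi)

theorem exists_rootBound_le (Q : ℂ[X][X]) :
    ∃ A : ℝ, ∃ M : ℕ, ∀ z, rootBound Q z ≤ A * (1 + ‖z‖) ^ M := by
  choose A M hA h using fun i => exists_norm_eval_le (Q.coeff i)
  refine ⟨1 + ∑ i ∈ Finset.range Q.natDegree, A i, ∑ i ∈ Finset.range Q.natDegree, M i,
    fun z => ?_⟩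
  have hz : 1 ≤ 1 + ‖z‖ := by linarith [norm_nonneg z]
  rw [rootBound, add_mul, Finset.sum_mul, one_mul]
  refine add_le_add (one_le_pow₀ hz) (Finset.sum_le_sum fun i hi => (h i z).trans ?_)
  gcongr
  · exact hA i
  · exact Finset.single_le_sum (fun _ _ => Nat.zero_le _) hi

/-! ### Connectedness of punctured domains -/

theorem isPreconnected_diff_singleton {U : Set ℂ} (hU : IsOpen U) (hc : IsPreconnected U) (s : ℂ) :
    IsPreconnected (U \ {s}) := by
  by_cases hs : s ∈ U
  swap
  · rwa [Set.sdiff_singleton_eq_self hs]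
  obtain ⟨r, hr, hball⟩ := Metric.isOpen_iff.1 hU s hs
  have hpunct : IsPreconnected (Metric.ball s r \ {s}) := by
    convert PuncturedCover.convex_leftHalfPlane.isPreconnected.image
      (fun ζ => s + r * Complex.exp ζ) (by fun_prop) using 1
    ext z
    constructor
    · rintro ⟨hz, hzs⟩
      have hr' : (r : ℂ) ≠ 0 := by exact_mod_cast hr.ne'
      have h0 : (z - s) / r ≠ 0 := div_ne_zero (sub_ne_zero.2 hzs) hr'
      refine ⟨Complex.log ((z - s) / r), PuncturedCover.log_mem_leftHalfPlane h0 ?_, ?_⟩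
      · rw [norm_div, Complex.norm_real, Real.norm_of_nonneg hr.le, div_lt_one hr]
        simpa [dist_eq_norm] using hz
      · simp only [Complex.exp_log h0]
        field_simp
        ring
    · rintro ⟨ζ, hζ, rfl⟩
      refine ⟨?_, by simp [hr.ne']⟩
      rw [mem_ball_iff_norm, add_sub_cancel_left, norm_mul, Complex.norm_real,
        Real.norm_of_nonneg hr.le]
      nlinarith [PuncturedCover.norm_exp_lt_one.2 hζ]
  rw [isPreconnected_iff_subset_of_disjoint] at hpunct ⊢
  -- The part that contains the punctured disc about `s` stays open when `s` is added.
  have key : ∀ u v : Set ℂ, IsOpen u → IsOpen v → U \ {s} ⊆ u ∪ v → U \ {s} ∩ (u ∩ v) = ∅ →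
      Metric.ball s r \ {s} ⊆ u → U \ {s} ⊆ u := by
    intro u v hu hv huv hd hsub
    have h1 := isPreconnected_iff_subset_of_disjoint.1 hc (u ∪ Metric.ball s r) (v ∩ {s}ᶜ)
      (hu.union Metric.isOpen_ball) (hv.inter isOpen_compl_singleton) ?_ ?_
    · rcases h1 with h1 | h1
      · rintro x ⟨hx, hxs⟩
        rcases h1 hx with h | h
        · exact h
        · exact hsub ⟨h, hxs⟩
      · exact absurd rfl (h1 hs).2
    · intro x hx
      by_cases hxs : x = s
      · exact Or.inl (Or.inr (hxs ▸ Metric.mem_ball_self hr))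
      · rcases huv ⟨hx, hxs⟩ with h | h
        · exact Or.inl (Or.inl h)
        · exact Or.inr ⟨h, hxs⟩
    · refine Set.eq_empty_of_forall_notMem ?_
      rintro x ⟨hx, h | h, hxv, hxs⟩
      · exact Set.notMem_empty x (hd ▸ ⟨⟨hx, hxs⟩, h, hxv⟩)
      · exact Set.notMem_empty x (hd ▸ ⟨⟨hx, hxs⟩, hsub ⟨h, hxs⟩, hxv⟩)
  intro u v hu hv huv hd
  have hsub : Metric.ball s r \ {s} ⊆ U \ {s} := Set.sdiff_subset_sdiff_left hball
  rcases hpunct u v hu hv (hsub.trans huv)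
    (Set.subset_eq_empty (Set.inter_subset_inter_left _ hsub) hd) with h | h
  · exact Or.inl (key u v hu hv huv hd h)
  · exact Or.inr (key v u hv hu (by rwa [Set.union_comm]) (by rwa [Set.inter_comm v u]) h)

theorem isPreconnected_diff_finset {U : Set ℂ} (hU : IsOpen U) (hc : IsPreconnected U)
    (S : Finset ℂ) : IsPreconnected {z | z ∈ U ∧ z ∉ S} := by
  classical
  induction S using Finset.induction_on with
  | empty => simpa using hc
  | insert s S _ ih =>
    have hopen : IsOpen {z | z ∈ U ∧ z ∉ S} := hU.inter S.finite_toSet.isClosed.isOpen_compl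
    convert isPreconnected_diff_singleton hopen ih s using 1
    ext z
    simp only [Finset.mem_insert, not_or, Set.mem_ofPred_eq, Set.mem_sdiff, Set.mem_singleton_iff]
    tauto

/-! ### The covering surface on which several algebraic functions are single-valued -/

section spread

variable {ι : Type} [Finite ι] (Q : ι → ℂ[X][X]) (S : Finset ℂ)

/-- The points `(z, w)`, with `z` outside of the finite set `S`, for which `w i` is a root of
`Q i` at `z` for all `i`. -/
def spread : Set (ℂ × (ι → ℂ)) := {y | y.1 ∉ S ∧ ∀ i, (Q i).evalEval y.1 (y.2 i) = 0}

/-- Outside of `S`, the polynomials `Q i` have no multiple roots. -/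
def SimpleRootsOutside : Prop :=
  ∀ z ∉ S, ∀ i w, (Q i).evalEval z w = 0 → (derivative (Q i)).evalEval z w ≠ 0

variable {Q S}

theorem exists_local_section (hs : SimpleRootsOutside Q S) {y₀ : ℂ × (ι → ℂ)}
    (hy₀ : y₀ ∈ spread Q S) : ∃ φ : ℂ → ι → ℂ, (∀ i, AnalyticAt ℂ (fun z => φ z i) y₀.1) ∧
      φ y₀.1 = y₀.2 ∧ (∀ᶠ z in 𝓝 y₀.1, (z, φ z) ∈ spread Q S) ∧
      ∀ᶠ y in 𝓝 y₀, y ∈ spread Q S → y.2 = φ y.1 := by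
  choose φ h1 h2 h3 h4 using fun i =>
    exists_analyticAt_root (hy₀.2 i) (hs _ hy₀.1 i _ (hy₀.2 i))
  refine ⟨fun z i => φ i z, h1, funext h2, ?_, ?_⟩
  · have hS : IsOpen {z | z ∉ S} := S.finite_toSet.isClosed.isOpen_compl
    filter_upwards [hS.mem_nhds hy₀.1, eventually_all.2 h3] with z hz1 hz2
    exact ⟨hz1, hz2⟩
  · have h5 : ∀ i, ∀ᶠ y in 𝓝 y₀, (Q i).evalEval y.1 (y.2 i) = 0 → y.2 i = φ i y.1 := fun i => by
      have hcont : Continuous fun y : ℂ × (ι → ℂ) => (y.1, y.2 i) := by fun_prop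
      exact hcont.continuousAt.eventually (h4 i)
    filter_upwards [eventually_all.2 h5] with y hy hyQ
    exact funext fun i => hy i (hyQ.2 i)

theorem isCompact_spread_inter (hQ : ∀ i, (Q i).Monic) {K : Set ℂ} (hK : IsCompact K)
    (hKS : ∀ z ∈ K, z ∉ S) : IsCompact (spread Q S ∩ Prod.fst ⁻¹' K) := by
  have heq : spread Q S ∩ Prod.fst ⁻¹' K =
      Prod.fst ⁻¹' K ∩ ⋂ i, {y : ℂ × (ι → ℂ) | (Q i).evalEval y.1 (y.2 i) = 0} := by
    ext y
    simp only [spread, Set.mem_inter_iff, Set.mem_ofPred_eq, Set.mem_preimage, Set.mem_iInter]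
    exact ⟨fun h => ⟨h.2, h.1.2⟩, fun h => ⟨⟨hKS _ h.1, h.2⟩, h.1⟩⟩
  have := Fintype.ofFinite ι
  choose R hR using fun i => hK.bddAbove_image (continuous_rootBound (Q i)).continuousOn
  refine (hK.prod (isCompact_univ_pi fun i =>
    isCompact_closedBall (0 : ℂ) (R i))).of_isClosed_subset ?_ ?_
  · rw [heq]
    refine (hK.isClosed.preimage continuous_fst).inter (isClosed_iInter fun i => ?_)
    have hcont : Continuous fun y : ℂ × (ι → ℂ) => (y.1, y.2 i) := by fun_prop
    exact isClosed_singleton.preimage ((continuous_evalEval (Q i)).comp hcont)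
  · rintro y ⟨hy, hyK⟩
    refine ⟨hyK, fun i _ => ?_⟩
    rw [mem_closedBall_zero_iff]
    exact (norm_le_rootBound (hQ i) (hy.2 i)).trans (hR i (Set.mem_image_of_mem _ hyK))

variable (Q S) in
/-- The component of a point of the spread. -/
def sheet (y₀ : ℂ × (ι → ℂ)) : Set (ℂ × (ι → ℂ)) := connectedComponentIn (spread Q S) y₀

theorem sheet_subset (y₀ : ℂ × (ι → ℂ)) : sheet Q S y₀ ⊆ spread Q S :=
  connectedComponentIn_subset _ _

variable {b : ℂ × (ι → ℂ)}

theorem exists_local_section_sheet (hs : SimpleRootsOutside Q S) {y₀ : ℂ × (ι → ℂ)}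
    (hy₀ : y₀ ∈ sheet Q S b) : ∃ φ : ℂ → ι → ℂ, (∀ i, AnalyticAt ℂ (fun z => φ z i) y₀.1) ∧
      φ y₀.1 = y₀.2 ∧ (∀ᶠ z in 𝓝 y₀.1, (z, φ z) ∈ sheet Q S b) ∧
      ∀ᶠ y in 𝓝 y₀, y ∈ spread Q S → y.2 = φ y.1 := by
  obtain ⟨φ, h1, h2, h3, h4⟩ := exists_local_section hs (sheet_subset b hy₀)
  refine ⟨φ, h1, h2, ?_, h4⟩
  have h5 : ∀ᶠ z in 𝓝 y₀.1, ContinuousAt φ z := by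
    have := eventually_all.2 fun i => (h1 i).eventually_analyticAt
    filter_upwards [this] with z hz
    exact continuousAt_pi.2 fun i => (hz i).continuousAt
  obtain ⟨r, hr, hball⟩ := Metric.eventually_nhds_iff_ball.1 (h3.and h5)
  have hpre : IsPreconnected ((fun z => (z, φ z)) '' Metric.ball y₀.1 r) :=
    (convex_ball y₀.1 r).isPreconnected.image _ fun z hz =>
      (continuousAt_id.prodMk (hball z hz).2).continuousWithinAt
  have hmem : y₀ ∈ (fun z => (z, φ z)) '' Metric.ball y₀.1 r :=
    ⟨y₀.1, Metric.mem_ball_self hr, Prod.ext rfl h2⟩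
  have hsub := hpre.subset_connectedComponentIn hmem
    (by rintro _ ⟨z, hz, rfl⟩; exact (hball z hz).1)
  rw [← connectedComponentIn_eq hy₀] at hsub
  filter_upwards [Metric.ball_mem_nhds y₀.1 hr] with z hz
  exact hsub (Set.mem_image_of_mem _ hz)

theorem isCompact_sheet_inter (hQ : ∀ i, (Q i).Monic) {K : Set ℂ} (hK : IsCompact K)
    (hKS : ∀ z ∈ K, z ∉ S) : IsCompact (sheet Q S b ∩ Prod.fst ⁻¹' K) := by
  by_cases hb : b ∈ spread Q S
  swap
  · simp [sheet, connectedComponentIn_eq_empty hb]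
  -- A component is relatively closed.
  have hcl : closure (sheet Q S b) ∩ spread Q S ⊆ sheet Q S b := by
    have hb' : b ∈ sheet Q S b := mem_connectedComponentIn hb
    refine IsPreconnected.subset_connectedComponentIn (x := b) ?_ ⟨subset_closure hb', hb⟩
      Set.inter_subset_right
    exact isPreconnected_connectedComponentIn.subset_closure
      (Set.subset_inter subset_closure (sheet_subset b)) Set.inter_subset_left
  have heq : sheet Q S b ∩ Prod.fst ⁻¹' K =
      closure (sheet Q S b) ∩ (spread Q S ∩ Prod.fst ⁻¹' K) := by
    ext y
    exact ⟨fun h => ⟨subset_closure h.1, sheet_subset b h.1, h.2⟩,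
      fun h => ⟨hcl ⟨h.1, h.2.1⟩, h.2.2⟩⟩
  rw [heq]
  exact (isCompact_spread_inter hQ hK hKS).inter_left isClosed_closure

theorem isOpenMap_fst_sheet (hs : SimpleRootsOutside Q S) :
    IsOpenMap fun y : sheet Q S b => y.1.1 := by
  refine IsOpenMap.of_nhds_le fun y A hA => ?_
  obtain ⟨φ, h1, h2, h3, -⟩ := exists_local_section_sheet hs y.2
  rw [mem_map, mem_nhds_subtype] at hA
  obtain ⟨B, hB, hBA⟩ := hA
  have hcont : ContinuousAt (fun z => (z, φ z)) y.1.1 :=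
    continuousAt_id.prodMk (continuousAt_pi.2 fun i => (h1 i).continuousAt)
  rw [ContinuousAt, h2] at hcont
  filter_upwards [hcont hB, h3] with z hz1 hz2
  exact @hBA ⟨(z, φ z), hz2⟩ hz1

theorem isLocalHomeomorph_fst_sheet (hs : SimpleRootsOutside Q S) :
    IsLocalHomeomorph fun y : sheet Q S b => y.1.1 := by
  rw [isLocalHomeomorph_iff_isOpenEmbedding_restrict]
  intro y
  obtain ⟨φ, -, -, -, h4⟩ := exists_local_section_sheet hs y.2
  obtain ⟨W, hW, hWo, hyW⟩ := eventually_nhds_iff.1 h4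
  have hU : IsOpen (Subtype.val ⁻¹' W : Set (sheet Q S b)) := hWo.preimage continuous_subtype_val
  refine ⟨_, hU.mem_nhds hyW, IsOpenEmbedding.of_continuous_injective_isOpenMap ?_ ?_ ?_⟩
  · exact (continuous_fst.comp continuous_subtype_val).comp continuous_subtype_val
  · rintro ⟨y₁, h₁⟩ ⟨y₂, h₂⟩ h
    have h' : y₁.1.1 = y₂.1.1 := h
    refine Subtype.ext (Subtype.ext (Prod.ext h' ?_))
    rw [hW _ h₁ (sheet_subset b y₁.2), hW _ h₂ (sheet_subset b y₂.2), h']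
  · exact (isOpenMap_fst_sheet hs).domRestrict hU

/-- All small radii are admissible in `PuncturedCover`, and discs of a small radius about the
punctures in an open set are contained in it. -/
theorem exists_radius (S : Finset ℂ) {Ω : Set ℂ} (hΩ : IsOpen Ω) : ∃ r : ℝ, 0 < r ∧
    (∀ s ∈ S, ∀ t ∈ S, s ≠ t → 2 * r ≤ dist s t) ∧ (∀ s ∈ S, ‖s‖ + r ≤ r⁻¹) ∧
      ∀ s ∈ S, s ∈ Ω → Metric.ball s r ⊆ Ω := by
  have h0 : ∀ᶠ r in 𝓝[>] (0 : ℝ), 0 < r := self_mem_nhdsWithin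
  have hsmall : ∀ ε : ℝ, 0 < ε → ∀ᶠ r in 𝓝[>] (0 : ℝ), r < ε := fun ε hε =>
    nhdsWithin_le_nhds (Iio_mem_nhds hε)
  have h1 : ∀ᶠ r in 𝓝[>] (0 : ℝ), ∀ s ∈ S, ∀ t ∈ S, s ≠ t → 2 * r ≤ dist s t := by
    refine (Finset.eventually_all S).2 fun s _ => (Finset.eventually_all S).2 fun t _ => ?_
    by_cases hst : s = t
    · simp [hst]
    · filter_upwards [hsmall (dist s t / 2) (half_pos (dist_pos.2 hst))] with r hr _
      linarith
  have h2 : ∀ᶠ r in 𝓝[>] (0 : ℝ), ∀ s ∈ S, ‖s‖ + r ≤ r⁻¹ := by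
    refine (Finset.eventually_all S).2 fun s _ => ?_
    have hs : 0 < ‖s‖ + 1 := by positivity
    filter_upwards [h0, hsmall 1 one_pos, hsmall _ (inv_pos.2 hs)] with r hr0 hr1 hr2
    have h3 : ‖s‖ + 1 ≤ r⁻¹ := by
      rw [le_inv_comm₀ hs hr0]
      exact hr2.le
    linarith
  have h3 : ∀ᶠ r in 𝓝[>] (0 : ℝ), ∀ s ∈ S, s ∈ Ω → Metric.ball s r ⊆ Ω := by
    refine (Finset.eventually_all S).2 fun s _ => ?_
    by_cases hs : s ∈ Ω
    · obtain ⟨ε, hε, hball⟩ := Metric.isOpen_iff.1 hΩ s hs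
      filter_upwards [hsmall ε hε] with r hr _
      exact (Metric.ball_subset_ball hr.le).trans hball
    · simp [hs]
  obtain ⟨r, hr⟩ := (((h0.and h1).and h2).and h3).exists
  exact ⟨r, hr.1.1.1, hr.1.1.2, hr.1.2, hr.2⟩

/-- The covering of the punctured plane by a component of the spread. -/
noncomputable def sheetCover (hQ : ∀ i, (Q i).Monic) (hs : SimpleRootsOutside Q S) {r : ℝ}
    (hr : 0 < r) (h1 : ∀ s ∈ S, ∀ t ∈ S, s ≠ t → 2 * r ≤ dist s t)
    (h2 : ∀ s ∈ S, ‖s‖ + r ≤ r⁻¹) (b : ℂ × (ι → ℂ)) : PuncturedCover (sheet Q S b) where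
  proj y := y.1.1
  punctures := S
  radius := r
  radius_pos := hr
  isLocalHomeomorph := isLocalHomeomorph_fst_sheet hs
  proj_notMem y := (sheet_subset b y.2).1
  isCompact_preimage K hK hKS := by
    rw [Topology.IsInducing.subtypeVal.isCompact_iff]
    convert isCompact_sheet_inter (b := b) hQ hK hKS using 1
    ext y
    constructor
    · rintro ⟨y, hy, rfl⟩
      exact ⟨y.2, hy⟩
    · rintro ⟨hy, hyK⟩
      exact ⟨⟨y, hy⟩, hyK, rfl⟩
  two_radius_le := h1
  norm_add_radius_le := h2

end spread

/-- Finitely many algebraic functions on a connected open set `Ω` extend to meromorphic functions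
on one compact Riemann surface, of which `Ω` is a part of one sheet. -/
theorem exists_finiteSheetedSurface {ι : Type} [Finite ι] {Ω : Set ℂ} (ho : IsOpen Ω)
    (hc : IsPreconnected Ω) (hinf : Ω.Infinite) {f : ι → ℂ → ℂ}
    (hf : ∀ i, AnalyticOnNhd ℂ (f i) Ω) (halg : ∀ i, IsAlgebraicFunctionOn (f i) Ω) :
    ∃ (R : Type) (_ : TopologicalSpace R) (_ : ChartedSpace ℂ R) (p : R → OnePoint ℂ) (n : ℕ)
        (σ : ℂ → R),
      IsFiniteSheetedSurface R p n ∧ MDifferentiableOn 𝓘(ℂ) 𝓘(ℂ) σ Ω ∧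
      (∀ z ∈ Ω, p (σ z) = (z : OnePoint ℂ)) ∧
      ∀ i, ∃ F : R → ℂ, IsMeromorphic F ∧ ∀ z ∈ Ω, F (σ z) = f i z := by
  classical
  have := Fintype.ofFinite ι
  choose c Q A B d hc0 hQ hd hAB hroot using fun i =>
    (halg i).exists_monic_separable hc ho hinf.nonempty (hf i)
  let S : Finset ℂ := Finset.univ.biUnion fun i => (c i).roots.toFinset ∪ (d i).roots.toFinset
  have hcS : ∀ i, ∀ z ∉ S, (c i).eval z ≠ 0 := fun i z hz h => hz <| by
    simp only [S, Finset.mem_biUnion, Finset.mem_union, Multiset.mem_toFinset]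
    exact ⟨i, Finset.mem_univ i, Or.inl ((mem_roots (hc0 i)).2 h)⟩
  have hdS : ∀ i, ∀ z ∉ S, (d i).eval z ≠ 0 := fun i z hz h => hz <| by
    simp only [S, Finset.mem_biUnion, Finset.mem_union, Multiset.mem_toFinset]
    exact ⟨i, Finset.mem_univ i, Or.inr ((mem_roots (hd i)).2 h)⟩
  have hs : SimpleRootsOutside Q S := by
    intro z hz i w h0 h1
    refine hdS i z hz ?_
    have h2 := congrArg (evalEval z w) (hAB i)
    simpa [evalEval_add, evalEval_mul, h0, h1, evalEval_C] using h2.symm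
  obtain ⟨r, hr, hr1, hr2, hr3⟩ := exists_radius S ho
  let τ : ℂ → ℂ × (ι → ℂ) := fun z => (z, fun i => (c i).eval z * f i z)
  have hτ : ∀ z ∈ {z | z ∈ Ω ∧ z ∉ S}, τ z ∈ spread Q S := fun z hz =>
    ⟨hz.2, fun i => hroot i z hz.1⟩
  have hτcont : ContinuousOn τ {z | z ∈ Ω ∧ z ∉ S} := by
    refine continuousOn_id.prodMk (continuousOn_pi.2 fun i => ?_)
    exact (c i).continuous.continuousOn.mul ((hf i).continuousOn.mono fun z hz => hz.1)
  obtain ⟨z₀, hz₀⟩ : {z | z ∈ Ω ∧ z ∉ S}.Nonempty := (hinf.sdiff S.finite_toSet).nonempty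
  have hsheet : ∀ z ∈ {z | z ∈ Ω ∧ z ∉ S}, τ z ∈ sheet Q S (τ z₀) := fun z hz =>
    ((isPreconnected_diff_finset ho hc S).image τ hτcont).subset_connectedComponentIn
      (Set.mem_image_of_mem τ hz₀) (by rintro _ ⟨z, hz, rfl⟩; exact hτ z hz)
      (Set.mem_image_of_mem τ hz)
  let C := sheetCover hQ hs hr hr1 hr2 (τ z₀)
  have hconn : ConnectedSpace (sheet Q S (τ z₀)) :=
    isConnected_iff_connectedSpace.1 (isConnected_connectedComponentIn_iff.2 (hτ z₀ hz₀))
  let σ₀ : ℂ → sheet Q S (τ z₀) := fun z =>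
    if h : z ∈ {z | z ∈ Ω ∧ z ∉ S} then ⟨τ z, hsheet z h⟩ else ⟨τ z₀, hsheet z₀ hz₀⟩
  have hσ₀ : ∀ z ∈ {z | z ∈ Ω ∧ z ∉ S}, (σ₀ z).1 = τ z := fun z hz => by
    simp only [σ₀, dif_pos hz]
  obtain ⟨σ, hσ1, hσ2, hσ3⟩ := PuncturedCover.Completion.exists_section (C := C) ho hr3
    (σ₀ := σ₀) (Topology.IsInducing.subtypeVal.continuousOn_iff.2
      (hτcont.congr fun z hz => hσ₀ z hz))
    (fun z hz hzS => by
      change (σ₀ z).1.1 = z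
      rw [hσ₀ z ⟨hz, hzS⟩])
  refine ⟨C.Completion, inferInstance, inferInstance, PuncturedCover.Completion.sphereProj C,
    PuncturedCover.Completion.degree C, σ, PuncturedCover.Completion.isFiniteSheetedSurface,
    hσ1, hσ2, fun i => ?_⟩
  -- At the ends, the values are chosen such that they are right at the punctures in `Ω`.
  refine ⟨Sum.elim (fun y : sheet Q S (τ z₀) => y.1.2 i / (c i).eval y.1.1) fun e =>
    f i (finitePart (PuncturedCover.Completion.sphereProj C (.point e))), ?_, fun z hz => ?_⟩
  · obtain ⟨A₁, M₁, hb1⟩ := exists_rootBound_le (Q i)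
    obtain ⟨A₂, M₂, -, hb2⟩ := exists_norm_eval_le (c i)
    refine PuncturedCover.Completion.isMeromorphic_of_growth (C := C)
      (g := fun y => y.1.2 i) (h := fun y => (c i).eval y.1.1) ?_ ?_
      (A := A₁) (M := M₁) (A' := A₂) (M' := M₂) ?_ ?_ fun y => rfl
    · intro y
      obtain ⟨φ, h1, -, -, h4⟩ := exists_local_section_sheet hs y.2
      refine ⟨fun z => φ z i, h1 i, ?_⟩
      filter_upwards [continuous_subtype_val.continuousAt.eventually h4] with x hx
      exact congrFun (hx (sheet_subset _ x.2)) i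
    · intro y
      refine ⟨fun z => (c i).eval z, ?_, Eventually.of_forall fun x => rfl⟩
      exact (c i).differentiable.analyticAt _
    · intro y
      exact (norm_le_rootBound (hQ i) ((sheet_subset _ y.2).2 i)).trans (hb1 _)
    · intro y
      exact hb2 _
  · by_cases hzS : z ∈ S
    · have h := hσ2 z hz
      generalize σ z = y at h
      induction y using PuncturedCover.Completion.ind with
      | h1 x =>
        rw [PuncturedCover.Completion.sphereProj_incl, OnePoint.coe_eq_coe] at h
        exact absurd hzS (h ▸ C.proj_notMem x)
      | h2 e =>
        change f i (finitePart (PuncturedCover.Completion.sphereProj C (.point e))) = f i z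
        rw [h]
        rfl
    · rw [hσ3 z hz hzS]
      change (σ₀ z).1.2 i / (c i).eval (σ₀ z).1.1 = f i z
      rw [hσ₀ z ⟨hz, hzS⟩]
      exact mul_div_cancel_left₀ _ (hcS i z hzS)

end JacobiTree

theorem theorem6p6 {V D U : Type*} [Finite V] [Finite D] [Nonempty V]
    (G : JacobiTree.Multigraph V D) (hconn : G.Connected) (hleaf : ∀ v, 2 ≤ G.degree v)
    (J : G.JacobiParameters) (T : G.UniversalCover U) :
    -- on `ℂ \ [A, B]` the resolvents exist, and the functions are analytic and algebraic
    ((∀ z ∈ J.domain T, IsUnit (J.operator T - algebraMap ℂ _ z) ∧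
        ∀ e, IsUnit (J.branchOperator T e - algebraMap ℂ _ z)) ∧
      ∀ f ∈ J.functions T,
        AnalyticOnNhd ℂ f (J.domain T) ∧ JacobiTree.IsAlgebraicFunctionOn f (J.domain T)) ∧
    -- boundary values, possibly infinite, off one finite set
    (∃ F₀ : Set ℝ, F₀.Finite ∧ ∀ f ∈ J.functions T, JacobiTree.HasBoundaryValuesOn f F₀ᶜ) ∧
    -- `ℂ \ [A, B]` is (by `σ`) a part of one sheet of a finite-sheeted Riemann surface,
    -- and all functions extend from there to meromorphic functions on the surface
    (∃ (R : Type) (_ : TopologicalSpace R) (_ : ChartedSpace ℂ R) (p : R → OnePoint ℂ) (n : ℕ)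
        (σ : ℂ → R),
      JacobiTree.IsFiniteSheetedSurface R p n ∧
      MDifferentiableOn 𝓘(ℂ) 𝓘(ℂ) σ (J.domain T) ∧
      (∀ z ∈ J.domain T, p (σ z) = (z : OnePoint ℂ)) ∧
      ∀ f ∈ J.functions T, ∃ F : R → ℂ, JacobiTree.IsMeromorphic F ∧ ∀ z ∈ J.domain T, F (σ z) = f z) := by
  have hup : {z : ℂ | 0 < z.im} ⊆ J.domain T := fun z hz =>
    J.mem_domain_of_im_ne_zero T (ne_of_gt hz)
  refine ⟨⟨fun z hz => ⟨J.isUnit_operator_sub T hz, fun e => J.isUnit_branchOperator_sub T e hz⟩,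
    fun f hf => ⟨?_, ?_⟩⟩, ?_, ?_⟩
  · rcases hf with ⟨j, rfl⟩ | ⟨e, rfl⟩
    · exact J.analyticOnNhd_green T j
    · exact J.analyticOnNhd_mFunction T e
  · obtain ⟨i, hi⟩ := J.exists_eqOn_indexed T hf
    obtain ⟨P, h1, h2, h3⟩ := J.isAlgebraicFunctionOn_indexed T i
    exact ⟨P, h1, h2, fun z hz => hi hz ▸ h3 z hz⟩
  · choose F hF hbv using fun i => (J.isAlgebraicFunctionOn_indexed T i).exists_hasBoundaryValuesOn
      (J.isPreconnected_domain T) (J.isOpen_domain T) (J.analyticOnNhd_indexed T i) hup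
    refine ⟨⋃ i, F i, Set.finite_iUnion hF, fun f hf => ?_⟩
    obtain ⟨i, hi⟩ := J.exists_eqOn_indexed T hf
    obtain ⟨g, hg⟩ := hbv i
    refine ⟨g, fun L hL hLc => ?_⟩
    let _ : UniformSpace (OnePoint ℂ) := uniformSpaceOfCompactR1
    refine TendstoUniformlyOn.congr (hg L (hL.trans (Set.compl_subset_compl.2 (Set.subset_iUnion F i))) hLc) ?_
    filter_upwards [self_mem_nhdsWithin] with ε hε x _
    have hmem : (x + ε * Complex.I : ℂ) ∈ J.domain T := hup (by simpa using hε)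
    simp only [hi hmem]
  · obtain ⟨N, ⟨equiv⟩⟩ := Finite.exists_equiv_fin (JacobiTree.Multigraph.JacobiParameters.Index T)
    have hinf : (J.domain T).Infinite := by
      refine Set.infinite_of_injective_forall_mem (f := fun n : ℕ => (n : ℂ) + Complex.I)
        (fun m n h => by simpa using h) fun n => hup (by simp)
    obtain ⟨R, i1, i2, p, n, σ, h1, h2, h3, h4⟩ := JacobiTree.exists_finiteSheetedSurface
      (J.isOpen_domain T) (J.isPreconnected_domain T) hinf
      (f := fun i => J.indexed T (equiv.symm i)) (fun i => J.analyticOnNhd_indexed T _)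
      fun i => J.isAlgebraicFunctionOn_indexed T _
    refine ⟨R, i1, i2, p, n, σ, h1, h2, h3, fun f hf => ?_⟩
    obtain ⟨i, hi⟩ := J.exists_eqOn_indexed T hf
    obtain ⟨F, hF, hFσ⟩ := h4 (equiv i)
    refine ⟨F, hF, fun z hz => ?_⟩
    rw [hFσ z hz, hi hz, equiv.symm_apply_apply]
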